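/- Fix a dimension $d\ge 1$ and $\gamma\in(1/2,1]$, and let $V'(r)=-(2\gamma-1)(2r-1)+\gamma^2(2r-1)^3$. Let $\mathbb T_N=\mathbb Z/N\mathbb Z$ and $\Omega_N=\{0,1\}^{\mathbb T_N^d}$. Let $(K_N)_{N\ge1}$ be a sequence of real numbers with $K_N\to\infty$. Let $\ell_N>0$ be the solution of $\ell_N^{3d/2}g_d(\ell_N)=N^2$, where $g_1(\ell)=\ell$, $g_2(\ell)=\log\ell$ and $g_d(\ell)=1$ for $d\ge3$. Assume that $\sup_{N\ge1}K_N^2/\ell_N^d<\infty$. Let $\rho^{K}:\mathbb R\to(0,1)$ be the two-layer solution with period $\sqrt{K}$: it is $C^2$ and $\sqrt K$-periodic, satisfies $(\rho^K)''=V'(\rho^K)$, $\rho^K(0)=1/2$, $(\rho^K)'(0)<0$, and takes the value $1/2$ exactly twice in a period. Let $\boldsymbol u^N(x)=\rho^{K_N}(x_1\sqrt{K_N}/N)$ for $x\in\mathbb T_N^d$, let $\nu^N$ be the product measure on $\Omega_N$ with $\nu^N\{\eta_x=1\}=\boldsymbol u^N(x)$, and let $\omega_x=\eta_x-\boldsymbol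 u^N(x)$. For a density $f\ge 0$ with respect to $\nu^N$ ($\int f\,d\nu^N=1$), let $$H_N(f)=\int f\log f\,d\nu^N,\qquad I^E_N(f;\nu^N)=\frac12\sum_{j=1}^d\sum_{x\in\mathbb T_N^d}\int\Big[\sqrt{f(T^{x,x+e_j}\eta)}-\sqrt{f(\eta)}\Big]^2d\nu^N,$$ where $T^{x,y}\eta$ is obtained from $\eta$ by exchanging $\eta_x$ and $\eta_y$. For $G:\mathbb T_N^d\to\mathbb R$ and a finite $A\subset\mathbb Z^d$, let $$\mathcal W^{G,A}(\eta)=\sum_{x\in\mathbb T_N^d}G(x)\prod_{z\in x+A}\omega_z ,$$ where $x+A=\{x+y:y\in A\}$ is regarded as a subset of $\mathbb T_N^d$. **Theorem.** Let $A\subset\mathbb Z^d$ be a finite set with at least two elements. Then there is a finite constant $C$, depending only on $d$, $A$, and the sequence of profiles $(\boldsymbol u^N)_N$ (that is, on $\gamma$ and $(K_N)_N$), and not on $N$, $G$, $\delta$, $f$, such that $$K_N\int\mathcal W^{G,A}\,f\,d\nu^N\;\le\;\delta N^2 I^E_N(f;\nu^N)+C\,\frac1\delta\,\{1+\|G\|_\infty^2\}\,K_N^2\,\big\{H_N(f)+(N/\ell_N)^d\big\}$$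 for every $N\ge1$ for which the two-layer solution $\rho^{K_N}$ exists, every $G:\mathbb T_N^d\to\mathbb R$, every $0<\delta<1$, and every density $f$ with respect to $\nu^N$. -/

import Mathlib

open Filter

namespace GlauberKawasaki

/-- The discrete torus `(ℤ / N ℤ)^d`. -/
abbrev Torus (d N : ℕ) : Type := Fin d → ZMod N

/-- The configuration space `{0,1}^{(ℤ / N ℤ)^d}`; `true` means that the site is occupied. -/
abbrev Config (d N : ℕ) : Type := Torus d N → Bool

/-- The occupation variable `η_x ∈ {0,1}`, as a real number. -/
def occ {d N : ℕ} (η : Config d N) (x : Torus d N) : ℝ := if η x then 1 else 0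

/-- The canonical basis vector `e_j`, reduced modulo `N`. -/
def unitVec (d N : ℕ) (j : Fin d) : Torus d N := Pi.single j 1

/-- The configuration `T^{x,y} η`, obtained by exchanging the occupation variables at `x`, `y`. -/
def exchange {d N : ℕ} (x y : Torus d N) (η : Config d N) : Config d N :=
  fun z => η (Equiv.swap x y z)

/-- The mass of the configuration `η` under the product measure on `{0,1}^{(ℤ / N ℤ)^d}` whose
marginal at the site `x` is Bernoulli with parameter `v x`. -/
noncomputable def productWeight {d N : ℕ} [NeZero N] (v : Torus d N → ℝ) (η : Config d N) : ℝ :=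
  ∏ x, if η x then v x else 1 - v x

/-- The integral of `g` with respect to the product measure with density profile `v`. -/
noncomputable def integralProd {d N : ℕ} [NeZero N] (v : Torus d N → ℝ)
    (g : Config d N → ℝ) : ℝ :=
  ∑ η, g η * productWeight v η

/-- `f` is a probability density with respect to the product measure with density profile `v`. -/
def IsDensity {d N : ℕ} [NeZero N] (v : Torus d N → ℝ) (f : Config d N → ℝ) : Prop :=
  (∀ η, 0 ≤ f η) ∧ integralProd v f = 1

/-- The entropy `∫ f log f dν` (with `0 log 0 = 0`). -/
noncomputable def entropy {d N : ℕ} [NeZero N] (v : Torus d N → ℝ) (f : Config d N → ℝ) : ℝ :=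
  integralProd v fun η => f η * Real.log (f η)

/-- The integrated carré du champ of the symmetric exclusion dynamics:
`(1/2) ∑_j ∑_x ∫ [√f(T^{x,x+e_j} η) - √f(η)]² dν`. -/
noncomputable def exclusionForm {d N : ℕ} [NeZero N] (v : Torus d N → ℝ)
    (f : Config d N → ℝ) : ℝ :=
  (1 / 2) * ∑ j : Fin d, ∑ x : Torus d N,
    integralProd v fun η => (√(f (exchange x (x + unitVec d N j) η)) - √(f η)) ^ 2

/-- The set `x + A ⊂ (ℤ / N ℤ)^d`, for a finite set `A ⊂ ℤ^d`. -/
def translate {d N : ℕ} (x : Torus d N) (A : Finset (Fin d → ℤ)) : Finset (Torus d N) :=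
  A.image fun y => fun j => x j + (y j : ZMod N)

/-- `ω_B = ∏_{x ∈ B} ω_x`, where `ω_x = η_x - v(x)`. -/
def omega {d N : ℕ} (v : Torus d N → ℝ) (B : Finset (Torus d N)) (η : Config d N) : ℝ :=
  ∏ x ∈ B, (occ η x - v x)

/-- `W^{G,A}(η) = ∑_x G(x) ω_{x+A}`. -/
noncomputable def observable {d N : ℕ} [NeZero N] (v : Torus d N → ℝ) (G : Torus d N → ℝ)
    (A : Finset (Fin d → ℤ)) (η : Config d N) : ℝ :=
  ∑ x, G x * omega v (translate x A) η

/-- The derivative `V'(ρ) = -(2γ - 1)(2ρ - 1) + γ² (2ρ - 1)³` of the double-well potential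
associated to the Glauber rates
`c₀ = 1 - γ σ₀ (σ_{-e₁} + σ_{e₁}) + γ² σ_{-e₁} σ_{e₁}`, where `σ_x = 2 η_x - 1`. -/
def potentialDeriv (γ r : ℝ) : ℝ := -(2 * γ - 1) * (2 * r - 1) + γ ^ 2 * (2 * r - 1) ^ 3

/-- `ρ` is (the lift to `ℝ` of) the two-layer stationary profile on the torus of length `√K`:
a `(0,1)`-valued, `√K`-periodic, `C²` solution of `ρ'' = V'(ρ)` which takes the value
`ρ^* = 1/2` (the local maximum of `V`) at exactly two points of the torus, normalized by
`ρ(0) = 1/2`, `ρ'(0) < 0`. -/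
structure IsTwoLayerProfile (γ K : ℝ) (ρ : ℝ → ℝ) : Prop where
  contDiff : ContDiff ℝ 2 ρ
  mem_Ioo : ∀ t, ρ t ∈ Set.Ioo (0 : ℝ) 1
  periodic : Function.Periodic ρ (√K)
  equation : ∀ t, deriv (deriv ρ) t = potentialDeriv γ (ρ t)
  at_zero : ρ 0 = 1 / 2
  deriv_zero : deriv ρ 0 < 0
  two_layers : {t | t ∈ Set.Ico 0 (√K) ∧ ρ t = 1 / 2}.ncard = 2

/-- The discrete density profile `u^N(x) = ρ(x₁ √K / N)`, `x ∈ (ℤ / N ℤ)^d`. The first coordinate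
is represented in `{0, …, N - 1}`, which is immaterial as `ρ` has period `√K`. -/
noncomputable def discreteProfile (d N : ℕ) [NeZero d] (K : ℝ) (ρ : ℝ → ℝ) : Torus d N → ℝ :=
  fun x => ρ (((x 0).val : ℝ) * √K / N)

/-- `g_d(l)`: equal to `l` for `d = 1`, to `log l` for `d = 2`, and to `1` for `d ≥ 3`. -/
noncomputable def gFun (d : ℕ) (l : ℝ) : ℝ :=
  if d = 1 then l else if d = 2 then Real.log l else 1

/-- `l > 0` solves `l^{3d/2} g_d(l) = N²`. For `d, N ≥ 1` this has exactly one solution: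
`N^{4/5}` for `d = 1`, the solution of `l³ log l = N²` for `d = 2`, and `N^{4/(3d)}` for
`d ≥ 3`. -/
def IsMesoscopicScale (d N : ℕ) (l : ℝ) : Prop :=
  0 < l ∧ l ^ (3 * (d : ℝ) / 2) * gFun d l = (N : ℝ) ^ 2

end GlauberKawasaki

open GlauberKawasaki

/-!
The estimate rests on replacing one factor of `ω_{x+A}` by its average over a cube of side about
`ℓ_N`.

*Factorization.* Let `a` be the point of `A` with the largest coordinate sum and `P = A - a` without
the origin. Then `ω_{x+A} = ω_s ω_{s+P}` with `s = x + a`, and every vector of `P` has a negative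
coordinate (`exists_extremal`, `observable_eq_smoothed`): `P` looks backwards. With `χ = u (1 - u)`
and `ω̂ = ω / χ`, the observable is `∑ G χ_s ω_{s+P} ω̂_s`.

*Transport.* The average of `ω̂` over a cube is reached along a flow from the point mass to the
uniform distribution on a cube of side `m`, whose energy is of order `g_d(m)`
(`boxWeight_one_sub`, `sum_boxFlow_sq_le`, `flowEnergy_le`). Summation by parts turns the difference
into `∑_w h_w (ω̂_w - ω̂_{w+e})`, where the currents `h_w` are combinations of the `ω_{x+P}` behind
`w`, hence independent of `η_w` and `η_{w+e}`.

*Integration by parts.* Under the product measure with a non-constant profile, `ω̂_z - ω̂_y` is not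
antisymmetric under the exchange of `z` and `y`, but `ω̂_z - ω̂_y + (u_z - u_y) ω̂_z ω̂_y` is
(`bondCurrent`). Its integral against `h f` is at most the Dirichlet form of the bond plus the
integral of `h² f` (`integralProd_mul_bondCurrent_le`). The terms `h²` and the nonlinear corrections
`(u_z - u_y) h ω̂_z ω̂_y` are bounded by the entropy inequality: a colouring of the torus separates
the observables into independent ones, and their exponential moments are finite because the fields
are sub-Gaussian and because the corrections are products of two independent fields, one looking
backwards and the other one forwards (`sum_integralProd_sq_le`, `sum_integralProd_mul_le`).

*Two scales.* Going to the scale `ℓ` at once, the nonlinear correction would be too large. So `ω̂`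
is averaged first over a cube of side `r ≈ √ℓ`, which is affordable as long as `r^d ℓ^d g_d(ℓ)` is of
order `N²`: this is the equation `ℓ^{3d/2} g_d(ℓ) = N²`. Then it is averaged over cubes of side
`m ≈ ℓ`, where the correction is already averaged over `r^d` sites, and `m^d ℓ^d g_d(ℓ) r^{-d}` is
again of order `N²`. The step at scale `m` is made twice, so that in the end both factors, `ω_{s+P}`
and `ω̂`, are averages over cubes of side `m`, to which the entropy inequality applies directly
(`exists_smoothing_step_bound`, `exists_smoothed_bound`, `exists_smoothed_one_bound`).

*Profile.* Ratios of `χ` over distances of order `ℓ` and the relative gradient of `u` have to be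
bounded. The maximum principle and conservation of energy give `|ρ'| ≤ 2 ρ (1 - ρ)` uniformly in the
period, including `γ = 1`, where `ρ` may approach `0` and `1`
(`IsTwoLayerProfile.abs_deriv_le`); and `√K ℓ ≤ M N` by the hypothesis on `K² / ℓ^d`
(`IsMesoscopicScale.sqrt_mul_le`).
The finitely many remaining `N` are covered by the trivial bound of the observable.
-/

set_option linter.unusedSectionVars false

namespace GlauberKawasaki

/-! ### Product measures -/

section Expectation

variable {d N : ℕ} [NeZero N] {u : Torus d N → ℝ}

lemma productWeight_pos (hu : ∀ x, u x ∈ Set.Ioo (0 : ℝ) 1) (η : Config d N) :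
    0 < productWeight u η := by
  refine Finset.prod_pos fun x _ => ?_
  have := hu x
  split_ifs
  · exact this.1
  · linarith [this.2]

lemma sum_productWeight (u : Torus d N → ℝ) : ∑ η : Config d N, productWeight u η = 1 := by
  have h := Finset.prod_univ_sum (fun _ : Torus d N => (Finset.univ : Finset Bool))
    (fun x b => if b then u x else 1 - u x)
  simp only [Fintype.piFinset_univ] at h
  unfold productWeight
  rw [← h]
  simp

lemma integralProd_add (F G : Config d N → ℝ) :
    integralProd u (fun η => F η + G η) = integralProd u F + integralProd u G := by
  simp [integralProd, add_mul, Finset.sum_add_distrib]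

lemma integralProd_const_mul (c : ℝ) (F : Config d N → ℝ) :
    integralProd u (fun η => c * F η) = c * integralProd u F := by
  simp [integralProd, mul_assoc, Finset.mul_sum]

lemma integralProd_sub (F G : Config d N → ℝ) :
    integralProd u (fun η => F η - G η) = integralProd u F - integralProd u G := by
  simp [integralProd, sub_mul, Finset.sum_sub_distrib]

lemma integralProd_sum {ι : Type*} (s : Finset ι) (F : ι → Config d N → ℝ) :
    integralProd u (fun η => ∑ i ∈ s, F i η) = ∑ i ∈ s, integralProd u (F i) := by
  simp only [integralProd, Finset.sum_mul]
  exact Finset.sum_comm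

lemma integralProd_const (c : ℝ) : integralProd u (fun _ => c) = c := by
  simp [integralProd, ← Finset.mul_sum, sum_productWeight]

lemma integralProd_mono (hu : ∀ x, u x ∈ Set.Ioo (0 : ℝ) 1) {F G : Config d N → ℝ}
    (h : ∀ η, F η ≤ G η) : integralProd u F ≤ integralProd u G :=
  Finset.sum_le_sum fun η _ => mul_le_mul_of_nonneg_right (h η) (productWeight_pos hu η).le

lemma integralProd_nonneg (hu : ∀ x, u x ∈ Set.Ioo (0 : ℝ) 1) {F : Config d N → ℝ}
    (h : ∀ η, 0 ≤ F η) : 0 ≤ integralProd u F :=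
  Finset.sum_nonneg fun η _ => mul_nonneg (h η) (productWeight_pos hu η).le

/-- Exchanging two independent copies of the configuration outside the set `S` preserves their
joint law: hence two observables with disjoint supports may be integrated separately. -/
lemma integralProd_fubini {α β : Type*} {S T : Set (Torus d N)} (hST : Disjoint S T)
    {h : Config d N → α} {X : Config d N → β} (hh : DependsOn h S) (hX : DependsOn X T)
    (Φ : α → β → ℝ) :
    integralProd u (fun η => Φ (h η) (X η))
      = integralProd u (fun η => integralProd u fun ξ => Φ (h η) (X ξ)) := by
  classical
  let mix : Config d N × Config d N → Config d N × Config d N := fun p =>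
    (fun x => if x ∈ S then p.1 x else p.2 x, fun x => if x ∈ S then p.2 x else p.1 x)
  have hmix : Function.Involutive mix := by
    rintro ⟨η, ξ⟩
    ext x <;> by_cases hx : x ∈ S <;> simp [mix, hx]
  have hw : ∀ p, productWeight u (mix p).1 * productWeight u (mix p).2
      = productWeight u p.1 * productWeight u p.2 := by
    rintro ⟨η, ξ⟩
    simp only [productWeight, ← Finset.prod_mul_distrib]
    refine Finset.prod_congr rfl fun x _ => ?_
    by_cases hx : x ∈ S <;> simp [mix, hx, mul_comm]
  have hΦ : ∀ p, Φ (h (mix p).1) (X (mix p).1) = Φ (h p.1) (X p.2) := by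
    rintro ⟨η, ξ⟩
    have h1 : h (mix (η, ξ)).1 = h η := hh fun x hx => by simp [mix, hx]
    have h2 : X (mix (η, ξ)).1 = X ξ := hX fun x hx => by
      have : x ∉ S := fun hxS => Set.disjoint_left.1 hST hxS hx
      simp [mix, this]
    rw [h1, h2]
  have key : ∑ p : Config d N × Config d N,
        Φ (h p.1) (X p.1) * (productWeight u p.1 * productWeight u p.2)
      = ∑ p : Config d N × Config d N,
        Φ (h p.1) (X p.2) * (productWeight u p.1 * productWeight u p.2) := by
    rw [← Equiv.sum_comp hmix.toPerm]
    refine Finset.sum_congr rfl fun p _ => ?_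
    change Φ (h (mix p).1) (X (mix p).1)
      * (productWeight u (mix p).1 * productWeight u (mix p).2) = _
    rw [hΦ, hw]
  rw [Fintype.sum_prod_type, Fintype.sum_prod_type] at key
  simp only [integralProd]
  calc _ = ∑ η : Config d N, ∑ ξ : Config d N,
        Φ (h η) (X η) * (productWeight u η * productWeight u ξ) := by
        refine Finset.sum_congr rfl fun η _ => ?_
        simp_rw [← mul_assoc]
        rw [← Finset.mul_sum, sum_productWeight, mul_one]
    _ = _ := key
    _ = _ := by
        refine Finset.sum_congr rfl fun η _ => ?_
        rw [Finset.sum_mul]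
        exact Finset.sum_congr rfl fun ξ _ => by ring

lemma integralProd_mul_of_disjoint {S T : Set (Torus d N)} (hST : Disjoint S T)
    {F G : Config d N → ℝ} (hF : DependsOn F S) (hG : DependsOn G T) :
    integralProd u (fun η => F η * G η) = integralProd u F * integralProd u G := by
  rw [integralProd_fubini hST hF hG fun a b => a * b]
  simp_rw [integralProd_const_mul]
  simp [integralProd, Finset.sum_mul, mul_right_comm]

lemma dependsOn_finset_sum {ι : Type*} {s : Finset ι} {F : ι → Config d N → ℝ}
    {S : Set (Torus d N)} (h : ∀ i ∈ s, DependsOn (F i) S) :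
    DependsOn (fun η => ∑ i ∈ s, F i η) S := fun _ _ hxy =>
  Finset.sum_congr rfl fun i hi => h i hi hxy

lemma dependsOn_finset_prod {ι : Type*} {s : Finset ι} {F : ι → Config d N → ℝ}
    {S : Set (Torus d N)} (h : ∀ i ∈ s, DependsOn (F i) S) :
    DependsOn (fun η => ∏ i ∈ s, F i η) S := fun _ _ hxy =>
  Finset.prod_congr rfl fun i hi => h i hi hxy

lemma integralProd_prod_of_disjoint {ι : Type*} (s : Finset ι) {F : ι → Config d N → ℝ}
    {S : ι → Set (Torus d N)} (hF : ∀ i ∈ s, DependsOn (F i) (S i))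
    (hS : ∀ i ∈ s, ∀ j ∈ s, i ≠ j → Disjoint (S i) (S j)) :
    integralProd u (fun η => ∏ i ∈ s, F i η) = ∏ i ∈ s, integralProd u (F i) := by
  classical
  induction s using Finset.induction_on with
  | empty => simp [integralProd_const]
  | insert a s ha ih =>
    simp_rw [Finset.prod_insert ha]
    rw [integralProd_mul_of_disjoint (S := S a) (T := ⋃ i ∈ s, S i) _
      (hF a (Finset.mem_insert_self a s))
      (dependsOn_finset_prod fun i hi => (hF i (Finset.mem_insert_of_mem hi)).mono
        (Set.subset_biUnion_of_mem (u := S) hi)),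
      ih (fun i hi => hF i (Finset.mem_insert_of_mem hi))
        (fun i hi j hj => hS i (Finset.mem_insert_of_mem hi) j (Finset.mem_insert_of_mem hj))]
    rw [Set.disjoint_iUnion₂_right]
    intro i hi
    exact hS a (Finset.mem_insert_self a s) i (Finset.mem_insert_of_mem hi)
      (fun h => ha (h ▸ hi))

lemma dependsOn_omega (B : Finset (Torus d N)) : DependsOn (omega u B) (B : Set (Torus d N)) := by
  intro η ξ h
  refine Finset.prod_congr rfl fun x hx => ?_
  simp [occ, h x hx]

lemma abs_occ_sub_le (hu : ∀ x, u x ∈ Set.Ioo (0 : ℝ) 1) (η : Config d N) (x : Torus d N) :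
    |occ η x - u x| ≤ 1 := by
  have := hu x
  unfold occ
  rw [abs_le]
  split_ifs <;> constructor <;> linarith [this.1, this.2]

lemma abs_omega_le_one (hu : ∀ x, u x ∈ Set.Ioo (0 : ℝ) 1) (B : Finset (Torus d N))
    (η : Config d N) : |omega u B η| ≤ 1 := by
  rw [omega, Finset.abs_prod]
  exact Finset.prod_le_one (fun _ _ => abs_nonneg _) fun x _ => abs_occ_sub_le hu η x

lemma integralProd_occ_sub (x : Torus d N) : integralProd u (fun η => occ η x - u x) = 0 := by
  classical
  have h := Finset.prod_univ_sum (fun _ : Torus d N => (Finset.univ : Finset Bool))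
    (fun y b => (if y = x then (if b then (1 : ℝ) else 0) - u x else 1)
      * (if b then u y else 1 - u y))
  simp only [Fintype.piFinset_univ, Finset.prod_mul_distrib, Finset.prod_ite_eq',
    Finset.mem_univ, if_true] at h
  unfold integralProd productWeight
  simp only [occ]
  rw [← h]
  refine Finset.prod_eq_zero (Finset.mem_univ x) ?_
  simp
  ring

lemma integralProd_omega {B : Finset (Torus d N)} (hB : B.Nonempty) :
    integralProd u (omega u B) = 0 := by
  classical
  have h := integralProd_prod_of_disjoint (u := u) B (F := fun x η => occ η x - u x)
    (S := fun x => {x}) (fun x _ η ξ h => by simp [occ, h x rfl])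
    (fun x _ y _ hxy => by simpa using hxy)
  obtain ⟨x, hx⟩ := hB
  refine h.trans (Finset.prod_eq_zero hx (integralProd_occ_sub x))

end Expectation

/-! ### Entropy inequality and sub-Gaussian observables -/

section Concentration

variable {d N : ℕ} [NeZero N] {u : Torus d N → ℝ}

/-- Young's inequality for the pair of conjugate functions `a ↦ a log a - a` and `exp`. -/
lemma mul_le_mul_log_sub_add_exp {a : ℝ} (ha : 0 ≤ a) (y : ℝ) :
    a * y ≤ a * Real.log a - a + Real.exp y := by
  rcases ha.eq_or_lt with rfl | ha
  · simpa using (Real.exp_pos y).le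
  · have h := Real.add_one_le_exp (y - Real.log a)
    rw [Real.exp_sub, Real.exp_log ha, le_div_iff₀ ha] at h
    nlinarith

/-- The entropy inequality. -/
lemma mul_integralProd_le_entropy_add (hu : ∀ x, u x ∈ Set.Ioo (0 : ℝ) 1) {f : Config d N → ℝ}
    (hf : IsDensity u f) (F : Config d N → ℝ) (κ : ℝ) {b : ℝ}
    (hb : integralProd u (fun η => Real.exp (κ * F η)) ≤ Real.exp b) :
    κ * integralProd u (fun η => F η * f η) ≤ entropy u f + b := by
  have h : integralProd u (fun η => κ * (F η * f η) - b * f η)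
      ≤ integralProd u (fun η => (f η * Real.log (f η) - f η)
        + Real.exp (-b) * Real.exp (κ * F η)) := by
    refine integralProd_mono hu fun η => ?_
    have := mul_le_mul_log_sub_add_exp (hf.1 η) (κ * F η - b)
    rw [← Real.exp_add, neg_add_eq_sub]
    linarith
  rw [integralProd_sub, integralProd_add, integralProd_sub, integralProd_const_mul,
    integralProd_const_mul, integralProd_const_mul, hf.2] at h
  have h2 : Real.exp (-b) * integralProd u (fun η => Real.exp (κ * F η)) ≤ 1 := by
    calc _ ≤ Real.exp (-b) * Real.exp b := by gcongr
      _ = 1 := by rw [← Real.exp_add]; simp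
  unfold entropy
  linarith

lemma entropy_nonneg (hu : ∀ x, u x ∈ Set.Ioo (0 : ℝ) 1) {f : Config d N → ℝ}
    (hf : IsDensity u f) : 0 ≤ entropy u f := by
  have := mul_integralProd_le_entropy_add hu hf (fun _ => 0) 0 (b := 0)
    (by simp [integralProd_const])
  simpa using this

lemma card_torus (d N : ℕ) [NeZero N] : (Fintype.card (Torus d N) : ℝ) = (N : ℝ) ^ d := by
  simp [Torus, ZMod.card]

/-- The entropy inequality for a sum of local observables: observables of the same colour have
disjoint supports, hence are independent, and each colour class costs one entropy. -/
lemma sum_integralProd_le_of_coloring (hu : ∀ x, u x ∈ Set.Ioo (0 : ℝ) 1) {f : Config d N → ℝ}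
    (hf : IsDensity u f) {ι : Type*} [Fintype ι] (c : Torus d N → ι)
    {Y : Torus d N → Config d N → ℝ} {S : Torus d N → Set (Torus d N)}
    (hY : ∀ w, DependsOn (Y w) (S w))
    (hc : ∀ w w', c w = c w' → w ≠ w' → Disjoint (S w) (S w')) {κ : ℝ} (hκ : 0 < κ) {b : ℝ}
    (hb : ∀ w, integralProd u (fun η => Real.exp (κ * Y w η)) ≤ Real.exp b) :
    ∑ w, integralProd u (fun η => Y w η * f η)
      ≤ Fintype.card ι / κ * entropy u f + (N : ℝ) ^ d / κ * b := by
  classical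
  have hcol : ∀ i : ι, κ * ∑ w with c w = i, integralProd u (fun η => Y w η * f η)
      ≤ entropy u f + (Finset.univ.filter fun w => c w = i).card * b := by
    intro i
    rw [← integralProd_sum]
    simp_rw [← Finset.sum_mul]
    refine mul_integralProd_le_entropy_add hu hf _ κ ?_
    simp_rw [Finset.mul_sum, Real.exp_sum]
    rw [integralProd_prod_of_disjoint _ (F := fun w η => Real.exp (κ * Y w η)) (S := S)]
    · calc _ ≤ ∏ w with c w = i, Real.exp b :=
            Finset.prod_le_prod (fun w _ => integralProd_nonneg hu fun _ => (Real.exp_pos _).le)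
              fun w _ => hb w
        _ = _ := by rw [Finset.prod_const, ← Real.exp_nat_mul]
    · intro w _ η ξ h
      simp only [hY w h]
    · intro w hw w' hw' hne
      simp only [Finset.mem_filter, Finset.mem_univ, true_and] at hw hw'
      exact hc w w' (hw.trans hw'.symm) hne
  have htot : κ * ∑ w, integralProd u (fun η => Y w η * f η)
      ≤ Fintype.card ι * entropy u f + (N : ℝ) ^ d * b := by
    rw [← Finset.sum_fiberwise Finset.univ c, Finset.mul_sum]
    refine (Finset.sum_le_sum fun i _ => hcol i).trans (le_of_eq ?_)
    rw [Finset.sum_add_distrib, ← Finset.sum_mul, ← card_torus d N]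
    have := Finset.card_eq_sum_card_fiberwise (s := (Finset.univ : Finset (Torus d N)))
      (t := Finset.univ) (f := c) (fun _ _ => Finset.mem_coe.2 (Finset.mem_univ _))
    rw [← Finset.card_univ (α := Torus d N), this]
    simp
  rw [div_mul_eq_mul_div, div_mul_eq_mul_div, ← add_div, le_div_iff₀ hκ]
  linarith

/-- `F` is centred and sub-Gaussian with variance proxy `S` under the product measure. -/
def IsSubgaussian (u : Torus d N → ℝ) (F : Config d N → ℝ) (S : ℝ) : Prop :=
  ∀ s : ℝ, integralProd u (fun η => Real.exp (s * F η)) ≤ Real.exp (s ^ 2 * S / 2)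

lemma IsSubgaussian.mono {F : Config d N → ℝ} {S S' : ℝ} (h : IsSubgaussian u F S)
    (hS : S ≤ S') : IsSubgaussian u F S' := fun s =>
  (h s).trans (Real.exp_le_exp.2 (by gcongr))

/-- Hoeffding's lemma for a centred observable with values in `[-1, 1]`. -/
lemma isSubgaussian_of_abs_le_one (hu : ∀ x, u x ∈ Set.Ioo (0 : ℝ) 1) {F : Config d N → ℝ}
    (h1 : ∀ η, |F η| ≤ 1) (h0 : integralProd u F = 0) : IsSubgaussian u F 1 := by
  intro s
  have h : ∀ η, Real.exp (s * F η) ≤ Real.cosh s + Real.sinh s * F η := by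
    intro η
    obtain ⟨hl, hr⟩ := abs_le.1 (h1 η)
    have := convexOn_exp.2 (Set.mem_univ s) (Set.mem_univ (-s))
      (show 0 ≤ (1 + F η) / 2 by linarith) (show 0 ≤ (1 - F η) / 2 by linarith) (by ring)
    simp only [smul_eq_mul] at this
    rw [Real.cosh_eq, Real.sinh_eq]
    calc Real.exp (s * F η) = Real.exp ((1 + F η) / 2 * s + (1 - F η) / 2 * -s) := by
          congr 1; ring
      _ ≤ _ := this
      _ = _ := by ring
  refine (integralProd_mono hu h).trans ?_
  rw [integralProd_add, integralProd_const, integralProd_const_mul, h0]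
  simpa using Real.cosh_le_exp_half_sq s

/-- Exponential moments of the square of a sub-Gaussian variable: `exp (t F²)` is a Gaussian
average of the exponentials `exp (s F)`. -/
lemma IsSubgaussian.exp_sq {F : Config d N → ℝ} {S t : ℝ}
    (h : IsSubgaussian u F S) (hS : 0 ≤ S) (ht : 0 ≤ t) (htS : t * S ≤ 1 / 4) :
    integralProd u (fun η => Real.exp (t * F η ^ 2)) ≤ Real.exp (2 * t * S) := by
  have hgauss : ∀ a : ℝ, ∫ y : ℝ, Real.exp (-(1 / 2) * (y - a) ^ 2) = √(2 * Real.pi) := by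
    intro a
    rw [MeasureTheory.integral_sub_right_eq_self (fun y : ℝ => Real.exp (-(1 / 2) * y ^ 2)) a,
      integral_gaussian]
    congr 1
    ring
  have hint : ∀ a : ℝ, MeasureTheory.Integrable
      (fun y : ℝ => Real.exp (-(1 / 2) * (y - a) ^ 2)) := fun a =>
    (integrable_exp_neg_mul_sq (b := 1 / 2) (by norm_num)).comp_sub_right a
  have hsq : √(2 * t) ^ 2 = 2 * t := Real.sq_sqrt (by linarith)
  have hleft : integralProd u (fun η => Real.exp (t * F η ^ 2)) * √(2 * Real.pi)
      = ∫ y : ℝ, ∑ η, (Real.exp (t * F η ^ 2)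
          * Real.exp (-(1 / 2) * (y - √(2 * t) * F η) ^ 2)) * productWeight u η := by
    rw [MeasureTheory.integral_finsetSum]
    · rw [integralProd, Finset.sum_mul]
      refine Finset.sum_congr rfl fun η _ => ?_
      rw [MeasureTheory.integral_mul_const, MeasureTheory.integral_const_mul, hgauss]
      ring
    · exact fun η _ => ((hint _).const_mul _).mul_const _
  have hb : 0 < 1 / 2 - t * S := by linarith
  have hright : ∫ y : ℝ, ∑ η, (Real.exp (t * F η ^ 2)
          * Real.exp (-(1 / 2) * (y - √(2 * t) * F η) ^ 2)) * productWeight u η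
      ≤ √(Real.pi / (1 / 2 - t * S)) := by
    rw [← integral_gaussian]
    refine MeasureTheory.integral_mono ?_ (integrable_exp_neg_mul_sq hb) fun y => ?_
    · exact MeasureTheory.integrable_finsetSum _ fun η _ =>
        ((hint _).const_mul _).mul_const _
    · have hy := h (√(2 * t) * y)
      have e1 : ∀ η, Real.exp (t * F η ^ 2) * Real.exp (-(1 / 2) * (y - √(2 * t) * F η) ^ 2)
          = Real.exp (-(1 / 2) * y ^ 2) * Real.exp (√(2 * t) * y * F η) := by
        intro η
        rw [← Real.exp_add, ← Real.exp_add]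
        congr 1
        linear_combination (-(1 / 2) * F η ^ 2) * hsq
      simp only [e1]
      have e2 : ∑ η, Real.exp (-(1 / 2) * y ^ 2) * Real.exp (√(2 * t) * y * F η)
            * productWeight u η
          = Real.exp (-(1 / 2) * y ^ 2)
            * integralProd u (fun η => Real.exp (√(2 * t) * y * F η)) := by
        rw [← integralProd_const_mul]; rfl
      rw [e2]
      calc _ ≤ Real.exp (-(1 / 2) * y ^ 2) * Real.exp ((√(2 * t) * y) ^ 2 * S / 2) := by gcongr
        _ = _ := by
          rw [← Real.exp_add]
          congr 1
          linear_combination (y ^ 2 * S / 2) * hsq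
  have hfin : √(Real.pi / (1 / 2 - t * S)) ≤ Real.exp (2 * t * S) * √(2 * Real.pi) := by
    rw [Real.sqrt_le_iff]
    refine ⟨by positivity, ?_⟩
    rw [mul_pow, Real.sq_sqrt (by positivity), div_le_iff₀ hb, ← Real.exp_nat_mul]
    have hx : 0 ≤ t * S := mul_nonneg ht hS
    have hq := Real.quadratic_le_exp_of_nonneg (x := ((2 : ℕ) : ℝ) * (2 * t * S))
      (by push_cast; linarith)
    set z := t * S with hz
    have hq' : 1 + 4 * z + 8 * z ^ 2 ≤ Real.exp (((2 : ℕ) : ℝ) * (2 * t * S)) := by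
      refine le_trans (le_of_eq ?_) hq
      push_cast
      rw [hz]; ring
    have h3 : 1 ≤ (1 + 4 * z + 8 * z ^ 2) * (1 - 2 * z) := by
      nlinarith [mul_nonneg hx (show 0 ≤ 1 / 4 - z by linarith), mul_nonneg hx hx,
        mul_nonneg (mul_nonneg hx hx) (show 0 ≤ 1 / 4 - z by linarith)]
    have h4 : 1 ≤ Real.exp (((2 : ℕ) : ℝ) * (2 * t * S)) * (1 - 2 * z) :=
      h3.trans (mul_le_mul_of_nonneg_right hq' (by linarith))
    generalize Real.exp (((2 : ℕ) : ℝ) * (2 * t * S)) = e at h4 ⊢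
    have h5 := mul_le_mul_of_nonneg_left h4 Real.pi_pos.le
    linarith
  have hpos : 0 < √(2 * Real.pi) := by positivity
  exact le_of_mul_le_mul_right ((hleft.le.trans hright).trans hfin) hpos

/-- Exponential moments of the product of two independent sub-Gaussian variables. -/
lemma IsSubgaussian.exp_mul (hu : ∀ x, u x ∈ Set.Ioo (0 : ℝ) 1) {F G : Config d N → ℝ}
    {A B : Set (Torus d N)} (hAB : Disjoint A B) (hFA : DependsOn F A) (hGB : DependsOn G B)
    {S S' κ : ℝ} (hF : IsSubgaussian u F S) (hG : IsSubgaussian u G S') (hS : 0 ≤ S)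
    (hS' : 0 ≤ S') (hκ : κ ^ 2 * S * S' ≤ 1 / 2) :
    integralProd u (fun η => Real.exp (κ * (F η * G η))) ≤ Real.exp (κ ^ 2 * S * S') := by
  rw [integralProd_fubini hAB hFA hGB fun a b => Real.exp (κ * (a * b))]
  have h1 : ∀ η, integralProd u (fun ξ => Real.exp (κ * (F η * G ξ)))
      ≤ Real.exp (κ ^ 2 * S' / 2 * F η ^ 2) := by
    intro η
    have := hG (κ * F η)
    simp_rw [mul_assoc] at this ⊢
    refine this.trans (Real.exp_le_exp.2 (le_of_eq ?_))
    ring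
  refine (integralProd_mono hu h1).trans ?_
  refine (hF.exp_sq hS (by positivity) ?_).trans (Real.exp_le_exp.2 (le_of_eq ?_))
  · linarith
  · ring

/-- A linear combination of the `ω_{x+B}` is sub-Gaussian. The translates of `B` may overlap, but
within each colour class they are disjoint, so that the corresponding variables are
independent; the classes are recombined by convexity of the exponential. -/
lemma isSubgaussian_sum_omega (hu : ∀ x, u x ∈ Set.Ioo (0 : ℝ) 1) {B : Finset (Fin d → ℤ)}
    (hB : B.Nonempty) {ι : Type*} [Fintype ι] [Nonempty ι] (c : Torus d N → ι)
    (hc : ∀ w w', c w = c w' → w ≠ w' → Disjoint (translate w B) (translate w' B))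
    (α : Torus d N → ℝ) :
    IsSubgaussian u (fun η => ∑ x, α x * omega u (translate x B) η)
      ((Fintype.card ι : ℝ) ^ 2 * ∑ x, α x ^ 2) := by
  classical
  intro s
  set k : ℝ := (Fintype.card ι : ℝ) with hk
  have hkpos : 0 < k := by
    rw [hk]; exact_mod_cast Fintype.card_pos
  have hcol : ∀ i : ι, integralProd u (fun η =>
      Real.exp (s * k * ∑ x with c x = i, α x * omega u (translate x B) η))
      ≤ Real.exp (s ^ 2 * (k ^ 2 * ∑ x, α x ^ 2) / 2) := by
    intro i
    simp_rw [Finset.mul_sum, Real.exp_sum]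
    rw [integralProd_prod_of_disjoint _
      (F := fun x η => Real.exp (s * k * (α x * omega u (translate x B) η)))
      (S := fun x => (translate x B : Set (Torus d N)))]
    · calc _ ≤ ∏ x with c x = i, Real.exp ((s * k * α x) ^ 2 * 1 / 2) := by
            refine Finset.prod_le_prod
              (fun w _ => integralProd_nonneg hu fun _ => (Real.exp_pos _).le) fun x _ => ?_
            have := isSubgaussian_of_abs_le_one hu (abs_omega_le_one hu (translate x B))
              (integralProd_omega (u := u) (hB.image _)) (s * k * α x)
            simpa only [mul_assoc] using this
        _ = Real.exp (∑ x with c x = i, (s * k * α x) ^ 2 * 1 / 2) := by rw [Real.exp_sum]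
        _ ≤ Real.exp (∑ x, (s * k * α x) ^ 2 * 1 / 2) := by
            refine Real.exp_le_exp.2 (Finset.sum_le_sum_of_subset_of_nonneg
              (Finset.filter_subset _ _) fun x _ _ => by positivity)
        _ = _ := by
            congr 1
            simp only [Finset.sum_div]
            exact Finset.sum_congr rfl fun x _ => by ring
    · intro x _ η ξ h
      simp only [dependsOn_omega (translate x B) h]
    · intro w hw w' hw' hne
      simp only [Finset.mem_filter, Finset.mem_univ, true_and] at hw hw'
      exact Finset.disjoint_coe.2 (hc w w' (hw.trans hw'.symm) hne)
  have hconv : ∀ η, Real.exp (s * ∑ x, α x * omega u (translate x B) η)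
      ≤ ∑ i : ι, k⁻¹ * Real.exp (s * k * ∑ x with c x = i, α x * omega u (translate x B) η) := by
    intro η
    have hj := convexOn_exp.map_sum_le (t := (Finset.univ : Finset ι)) (w := fun _ => k⁻¹)
      (p := fun i => s * k * ∑ x with c x = i, α x * omega u (translate x B) η)
      (fun _ _ => by positivity) (by simp [← hk, hkpos.ne']) (fun _ _ => Set.mem_univ _)
    simp only [smul_eq_mul] at hj
    refine le_trans (le_of_eq ?_) hj
    congr 1
    have hfib := Finset.sum_fiberwise Finset.univ c fun x => α x * omega u (translate x B) η
    rw [← Finset.mul_sum, ← Finset.mul_sum, hfib]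
    field_simp
  refine (integralProd_mono hu hconv).trans ?_
  rw [integralProd_sum]
  simp_rw [integralProd_const_mul]
  calc _ ≤ ∑ _i : ι, k⁻¹ * Real.exp (s ^ 2 * (k ^ 2 * ∑ x, α x ^ 2) / 2) :=
        Finset.sum_le_sum fun i _ => mul_le_mul_of_nonneg_left (hcol i) (by positivity)
    _ = _ := by
        rw [Finset.sum_const, Finset.card_univ, nsmul_eq_mul, ← hk]
        field_simp

end Concentration

/-! ### Colourings and sums of local fields -/

section Local

variable {d N : ℕ} [NeZero N] {u : Torus d N → ℝ}

/-- A colouring of the discrete circle with `2 L` colours in which distinct points of the same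
colour are at distance at least `L`: the residues modulo `L` up to the largest multiple of `L`,
and one separate colour for each remaining point. -/
lemma exists_coloring_zmod {L : ℕ} (hL : 0 < L) :
    ∃ c : ZMod N → Fin (2 * L), ∀ x y, c x = c y →
      (∃ k : ℤ, |k| < L ∧ x - y = (k : ZMod N)) → x = y := by
  set q := N / L
  have hqN : L * q ≤ N := Nat.mul_div_le N L
  have hNq : N < L * q + L := by
    have := Nat.lt_div_mul_add (a := N) hL
    rw [mul_comm]; exact this
  refine ⟨fun x => if h : x.val < L * q then ⟨x.val % L, by
    have := Nat.mod_lt x.val hL; omega⟩ else ⟨L + (x.val - L * q), by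
    have := ZMod.val_lt x; omega⟩, ?_⟩
  rintro x y hc ⟨k, hk, hxy⟩
  have hmod : ((x.val : ℤ) - y.val - k : ℤ) ≡ 0 [ZMOD N] := by
    rw [← ZMod.intCast_eq_intCast_iff]
    push_cast
    rw [ZMod.natCast_zmod_val, ZMod.natCast_zmod_val, hxy]
    simp
  obtain ⟨t, ht⟩ := (Int.modEq_zero_iff_dvd).1 hmod
  rw [abs_lt] at hk
  have hval : x.val = y.val → x = y := fun h => ZMod.val_injective N h
  by_cases h1 : x.val < L * q <;> by_cases h2 : y.val < L * q
  · simp only [h1, h2, dif_pos, Fin.mk.injEq] at hc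
    apply hval
    obtain ⟨s, hs⟩ : (L : ℤ) ∣ (x.val : ℤ) - y.val := (Nat.modEq_iff_dvd.1 (Eq.symm hc))
    have hLpos : (0 : ℤ) < L := by exact_mod_cast hL
    have hqN' : (L : ℤ) * q ≤ N := by exact_mod_cast hqN
    have h1' : (x.val : ℤ) < L * q := by exact_mod_cast h1
    have h2' : (y.val : ℤ) < L * q := by exact_mod_cast h2
    have hsq : s < q := by
      by_contra! h
      nlinarith
    have hsq' : -(q : ℤ) < s := by
      by_contra! h
      nlinarith
    have ht0 : t = 0 := by
      rcases lt_trichotomy t 0 with h | h | h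
      · have : (L : ℤ) * (s + q) ≥ L * 1 := by
          apply mul_le_mul_of_nonneg_left _ hLpos.le; linarith
        nlinarith
      · exact h
      · have : (L : ℤ) * (q - s) ≥ L * 1 := by
          apply mul_le_mul_of_nonneg_left _ hLpos.le; linarith
        nlinarith
    rw [ht0, mul_zero] at ht
    have hs0 : s = 0 := by
      rcases lt_trichotomy s 0 with h | h | h
      · nlinarith
      · exact h
      · nlinarith
    rw [hs0, mul_zero] at hs
    omega
  · simp only [h1, h2, dif_pos, dif_neg, not_false_eq_true, Fin.mk.injEq] at hc
    have := Nat.mod_lt x.val hL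
    omega
  · simp only [h1, h2, dif_pos, dif_neg, not_false_eq_true, Fin.mk.injEq] at hc
    have := Nat.mod_lt y.val hL
    omega
  · simp only [h1, h2, dif_neg, not_false_eq_true, Fin.mk.injEq] at hc
    exact hval (by omega)

/-- The cube of side `2 a + 1` centred at `w`. -/
def cube (a : ℕ) (w : Torus d N) : Set (Torus d N) :=
  {z | ∀ i, ∃ k : ℤ, |k| ≤ a ∧ z i = w i + k}

lemma exists_coloring_torus (d : ℕ) {a L : ℕ} (haL : 2 * a < L) :
    ∃ c : Torus d N → (Fin d → Fin (2 * L)), ∀ w w', c w = c w' → w ≠ w' →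
      Disjoint (cube a w) (cube a w') := by
  obtain ⟨c, hc⟩ := exists_coloring_zmod (N := N) (L := L) (by omega)
  refine ⟨fun x i => c (x i), fun w w' h hne => Set.disjoint_left.2 fun z hz hz' => hne ?_⟩
  funext i
  refine hc _ _ (congrFun h i) ?_
  obtain ⟨k, hk, hzk⟩ := hz i
  obtain ⟨k', hk', hzk'⟩ := hz' i
  refine ⟨k' - k, ?_, ?_⟩
  · rw [abs_le] at hk hk'
    rw [abs_lt]
    omega
  · push_cast
    linear_combination hzk' - hzk

/-- The `ℓ^∞`-size of the torus vector `v` for representatives in `{0, …, N - 1}` is at most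
`R`: `v` belongs to the image of the cube `{0, …, R}^d`. -/
def InBox (R : ℕ) (v : Torus d N) : Prop := ∀ i, (v i).val ≤ R

lemma mem_translate {x y : Torus d N} {B : Finset (Fin d → ℤ)} :
    y ∈ translate x B ↔ ∃ b ∈ B, ∀ j, y j = x j + (b j : ZMod N) := by
  simp only [translate, Finset.mem_image, funext_iff, eq_comm]

/-- The set of sites on which `∑ x, α x * ω_{x+B}` depends, when `α` is supported on
`w - {0, …, R}^d`. -/
def backSupport (R : ℕ) (B : Finset (Fin d → ℤ)) (w : Torus d N) : Set (Torus d N) :=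
  {y | ∃ x, InBox R (w - x) ∧ y ∈ translate x B}

/-- The set of sites on which `∑ z, β z * ω_{z+B}` depends, when `β` is supported on
`w + {0, …, R}^d`. -/
def frontSupport (R : ℕ) (B : Finset (Fin d → ℤ)) (w : Torus d N) : Set (Torus d N) :=
  {y | ∃ x, InBox R (x - w) ∧ y ∈ translate x B}

lemma backSupport_subset_cube {R D : ℕ} {B : Finset (Fin d → ℤ)}
    (hB : ∀ b ∈ B, ∀ i, |b i| ≤ D) (w : Torus d N) : backSupport R B w ⊆ cube (R + D) w := by
  rintro y ⟨x, hx, hy⟩ i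
  obtain ⟨b, hb, hyb⟩ := mem_translate.1 hy
  refine ⟨b i - ((w - x) i).val, ?_, ?_⟩
  · have h1 := hB b hb i
    have h2 := hx i
    rw [abs_le] at h1 ⊢
    push_cast
    omega
  · push_cast
    rw [hyb, ZMod.natCast_zmod_val, Pi.sub_apply]
    ring

lemma frontSupport_subset_cube {R D : ℕ} {B : Finset (Fin d → ℤ)}
    (hB : ∀ b ∈ B, ∀ i, |b i| ≤ D) (w : Torus d N) : frontSupport R B w ⊆ cube (R + D) w := by
  rintro y ⟨x, hx, hy⟩ i
  obtain ⟨b, hb, hyb⟩ := mem_translate.1 hy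
  refine ⟨b i + ((x - w) i).val, ?_, ?_⟩
  · have h1 := hB b hb i
    have h2 := hx i
    rw [abs_le] at h1 ⊢
    push_cast
    omega
  · push_cast
    rw [hyb, ZMod.natCast_zmod_val, Pi.sub_apply]
    ring

/-- If every vector of `P` has a negative coordinate and those of `Q` are nonnegative, then
looking backwards along `P` and forwards along `Q` involves different sites. -/
lemma disjoint_backSupport_frontSupport {R D : ℕ} {P Q : Finset (Fin d → ℤ)}
    (hP : ∀ b ∈ P, ∃ i, b i < 0) (hPD : ∀ b ∈ P, ∀ i, |b i| ≤ D)
    (hQ : ∀ b ∈ Q, ∀ i, 0 ≤ b i) (hQD : ∀ b ∈ Q, ∀ i, |b i| ≤ D)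
    (hN : 2 * R + 2 * D < N) (w : Torus d N) :
    Disjoint (backSupport R P w) (frontSupport R Q w) := by
  refine Set.disjoint_left.2 ?_
  rintro y ⟨x, hx, hy⟩ ⟨z, hz, hy'⟩
  obtain ⟨b, hb, hyb⟩ := mem_translate.1 hy
  obtain ⟨b', hb', hyb'⟩ := mem_translate.1 hy'
  obtain ⟨i, hi⟩ := hP b hb
  have h1 := hPD b hb i
  have h2 := hQ b' hb' i
  have h3 := hQD b' hb' i
  have h4 := hx i
  have h5 := hz i
  have hmod : (((w - x) i).val + ((z - w) i).val + b' i - b i : ℤ) ≡ 0 [ZMOD N] := by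
    rw [← ZMod.intCast_eq_intCast_iff]
    push_cast
    rw [ZMod.natCast_zmod_val, ZMod.natCast_zmod_val, Pi.sub_apply, Pi.sub_apply]
    linear_combination hyb i - hyb' i
  obtain ⟨t, ht⟩ := Int.modEq_zero_iff_dvd.1 hmod
  rw [abs_le] at h1 h3
  have ht1 : 0 < t := by
    by_contra! h
    nlinarith [Int.natCast_nonneg N]
  nlinarith

lemma dependsOn_sum_back {R : ℕ} {B : Finset (Fin d → ℤ)} {w : Torus d N} {α : Torus d N → ℝ}
    (hα : ∀ x, α x ≠ 0 → InBox R (w - x)) :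
    DependsOn (fun η => ∑ x, α x * omega u (translate x B) η) (backSupport R B w) := by
  refine dependsOn_finset_sum fun x _ η ξ h => ?_
  by_cases h0 : α x = 0
  · simp [h0]
  · have := dependsOn_omega (u := u) (translate x B) (x := η) (y := ξ)
      fun y hy => h y ⟨x, hα x h0, hy⟩
    simp only [this]

lemma dependsOn_sum_front {R : ℕ} {B : Finset (Fin d → ℤ)} {w : Torus d N} {α : Torus d N → ℝ}
    (hα : ∀ x, α x ≠ 0 → InBox R (x - w)) :
    DependsOn (fun η => ∑ x, α x * omega u (translate x B) η) (frontSupport R B w) := by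
  refine dependsOn_finset_sum fun x _ η ξ h => ?_
  by_cases h0 : α x = 0
  · simp [h0]
  · have := dependsOn_omega (u := u) (translate x B) (x := η) (y := ξ)
      fun y hy => h y ⟨x, hα x h0, hy⟩
    simp only [this]

/-- The number of colours needed to separate cubes of side `2 a + 1`. -/
def colors (d a : ℕ) : ℝ := (2 * (2 * a + 1) : ℝ) ^ d

lemma colors_pos (d a : ℕ) : 0 < colors d a := by unfold colors; positivity

lemma card_colors (d a : ℕ) :
    (Fintype.card (Fin d → Fin (2 * (2 * a + 1))) : ℝ) = colors d a := by
  simp [colors]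

lemma isSubgaussian_sum_omega_of_bounded (hu : ∀ x, u x ∈ Set.Ioo (0 : ℝ) 1)
    {B : Finset (Fin d → ℤ)} (hB : B.Nonempty) {D : ℕ} (hD : ∀ b ∈ B, ∀ i, |b i| ≤ D)
    {α : Torus d N → ℝ} {S : ℝ} (hS : ∑ x, α x ^ 2 ≤ S) :
    IsSubgaussian u (fun η => ∑ x, α x * omega u (translate x B) η) (colors d D ^ 2 * S) := by
  obtain ⟨c, hc⟩ := exists_coloring_torus (N := N) d (a := D) (L := 2 * D + 1) (by omega)
  have hsub : ∀ w, (translate w B : Set (Torus d N)) ⊆ cube D w := by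
    intro w y hy i
    obtain ⟨b, hb, hyb⟩ := mem_translate.1 (Finset.mem_coe.1 hy)
    exact ⟨b i, hD b hb i, hyb i⟩
  have h := isSubgaussian_sum_omega hu hB c (fun w w' h1 h2 =>
    Finset.disjoint_coe.1 ((hc w w' h1 h2).mono (hsub w) (hsub w'))) α
  rw [card_colors] at h
  exact h.mono (mul_le_mul_of_nonneg_left hS (by positivity))

/-- Entropy bound for the sum of the squares of local fields. -/
lemma sum_integralProd_sq_le (hu : ∀ x, u x ∈ Set.Ioo (0 : ℝ) 1) {f : Config d N → ℝ}
    (hf : IsDensity u f) {P : Finset (Fin d → ℤ)} (hPne : P.Nonempty) {D R : ℕ}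
    (hPD : ∀ b ∈ P, ∀ i, |b i| ≤ D)
    {α : Torus d N → Torus d N → ℝ} (hα : ∀ w x, α w x ≠ 0 → InBox R (w - x))
    {S : ℝ} (hS : 0 < S) (hαS : ∀ w, ∑ x, α w x ^ 2 ≤ S) :
    ∑ w, integralProd u (fun η => (∑ x, α w x * omega u (translate x P) η) ^ 2 * f η)
      ≤ 4 * colors d D ^ 2 * S * (colors d (R + D) * entropy u f + (N : ℝ) ^ d) := by
  obtain ⟨c, hc⟩ := exists_coloring_torus (N := N) d (a := R + D) (L := 2 * (R + D) + 1) (by omega)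
  have hk := colors_pos d D
  set T := colors d D ^ 2 * S with hT
  have hTpos : 0 < T := by positivity
  have h := sum_integralProd_le_of_coloring hu hf c
    (Y := fun w η => (∑ x, α w x * omega u (translate x P) η) ^ 2) (S := cube (R + D))
    (fun w η ξ hηξ => by
      have := dependsOn_sum_back (u := u) (B := P) (hα w)
        fun y hy => hηξ y (backSupport_subset_cube hPD w hy)
      simp only at this ⊢
      rw [this])
    hc (κ := 1 / (4 * T)) (by positivity) (b := 1 / 2) fun w => by
      have hs := isSubgaussian_sum_omega_of_bounded hu hPne hPD (hαS w)
      refine (hs.exp_sq (by positivity) (by positivity) ?_).trans (Real.exp_le_exp.2 ?_)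
      · rw [← hT]; apply le_of_eq; field_simp
      · rw [← hT]; apply le_of_eq; field_simp; norm_num
  rw [card_colors] at h
  refine h.trans ?_
  have hNd : (0 : ℝ) ≤ (N : ℝ) ^ d := by positivity
  rw [show (4 : ℝ) * colors d D ^ 2 * S = 4 * T by rw [hT]; ring]
  have e1 : colors d (R + D) / (1 / (4 * T)) * entropy u f + (N : ℝ) ^ d / (1 / (4 * T)) * (1 / 2)
      = 4 * T * (colors d (R + D) * entropy u f + (N : ℝ) ^ d / 2) := by
    field_simp
  rw [e1]
  gcongr
  linarith

/-- Entropy bound for the sum of the products of two local fields, one looking backwards and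
the other one looking forwards. -/
lemma sum_integralProd_mul_le (hu : ∀ x, u x ∈ Set.Ioo (0 : ℝ) 1) {f : Config d N → ℝ}
    (hf : IsDensity u f) {P Q : Finset (Fin d → ℤ)} (hPne : P.Nonempty) (hQne : Q.Nonempty)
    {D R : ℕ} (hP : ∀ b ∈ P, ∃ i, b i < 0) (hPD : ∀ b ∈ P, ∀ i, |b i| ≤ D)
    (hQ : ∀ b ∈ Q, ∀ i, 0 ≤ b i) (hQD : ∀ b ∈ Q, ∀ i, |b i| ≤ D)
    (hN : 2 * (R + D) + 1 ≤ N)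
    {α β : Torus d N → Torus d N → ℝ} (hα : ∀ w x, α w x ≠ 0 → InBox R (w - x))
    (hβ : ∀ w x, β w x ≠ 0 → InBox R (x - w))
    {S S' κ : ℝ} (hS : 0 ≤ S) (hS' : 0 ≤ S') (hαS : ∀ w, ∑ x, α w x ^ 2 ≤ S)
    (hβS : ∀ w, ∑ x, β w x ^ 2 ≤ S') (hκ : 0 < κ)
    (hκS : colors d D ^ 4 * (κ ^ 2 * S * S') ≤ 1 / 2) :
    ∑ w, integralProd u (fun η => (∑ x, α w x * omega u (translate x P) η)
        * (∑ x, β w x * omega u (translate x Q) η) * f η)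
      ≤ colors d (R + D) / κ * entropy u f
        + (N : ℝ) ^ d * (colors d D ^ 4 * (κ * S * S')) := by
  obtain ⟨c, hc⟩ := exists_coloring_torus (N := N) d (a := R + D) (L := 2 * (R + D) + 1) (by omega)
  have h := sum_integralProd_le_of_coloring hu hf c
    (Y := fun w η => (∑ x, α w x * omega u (translate x P) η)
        * (∑ x, β w x * omega u (translate x Q) η)) (S := cube (R + D))
    (fun w η ξ hηξ => by
      have h1 := dependsOn_sum_back (u := u) (B := P) (hα w)
        fun y hy => hηξ y (backSupport_subset_cube hPD w hy)
      have h2 := dependsOn_sum_front (u := u) (B := Q) (hβ w)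
        fun y hy => hηξ y (frontSupport_subset_cube hQD w hy)
      simp only at h1 h2 ⊢
      rw [h1, h2])
    hc hκ (b := colors d D ^ 4 * (κ ^ 2 * S * S')) fun w => by
      have h1 := isSubgaussian_sum_omega_of_bounded hu hPne hPD (hαS w)
      have h2 := isSubgaussian_sum_omega_of_bounded hu hQne hQD (hβS w)
      have e : κ ^ 2 * (colors d D ^ 2 * S) * (colors d D ^ 2 * S')
        = colors d D ^ 4 * (κ ^ 2 * S * S') := by ring
      have := h1.exp_mul hu (disjoint_backSupport_frontSupport hP hPD hQ hQD (by omega) w)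
        (dependsOn_sum_back (hα w)) (dependsOn_sum_front (hβ w)) h2 (by positivity)
        (by positivity) (κ := κ) (by rw [e]; exact hκS)
      rw [e] at this
      exact this
  rw [card_colors] at h
  refine h.trans (le_of_eq ?_)
  field_simp

end Local

/-! ### Integration by parts along a bond -/

section IntegrationByParts

variable {d N : ℕ} [NeZero N] {u : Torus d N → ℝ}

/-- The variance `u_x (1 - u_x)` of the occupation variable `η_x`. -/
def chi (u : Torus d N → ℝ) (x : Torus d N) : ℝ := u x * (1 - u x)

/-- The normalized variable `ω_x / (u_x (1 - u_x))`. -/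
noncomputable def omegaHat (u : Torus d N → ℝ) (x : Torus d N) (η : Config d N) : ℝ :=
  (occ η x - u x) / chi u x

/-- The function of `(η_z, η_y)`, antisymmetric under the exchange of `z` and `y` once it is
multiplied by the weight of the product measure, whose linear part is `ω̂_z - ω̂_y`. -/
noncomputable def bondCurrent (u : Torus d N → ℝ) (z y : Torus d N) (η : Config d N) : ℝ :=
  omegaHat u z η - omegaHat u y η + (u z - u y) * (omegaHat u z η * omegaHat u y η)

lemma chi_pos (hu : ∀ x, u x ∈ Set.Ioo (0 : ℝ) 1) (x : Torus d N) : 0 < chi u x :=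
  mul_pos (hu x).1 (by linarith [(hu x).2])

lemma chi_mul_bondCurrent_mul_weight (hu : ∀ x, u x ∈ Set.Ioo (0 : ℝ) 1) {z y : Torus d N}
    (hzy : z ≠ y) (η : Config d N) :
    chi u z * bondCurrent u z y η * productWeight u η
      = (if η z then (if η y then 0 else chi u z) else (if η y then -chi u z else 0))
        * ∏ x ∈ (Finset.univ.erase z).erase y, if η x then u x else 1 - u x := by
  have hw : productWeight u η = (if η z then u z else 1 - u z) * ((if η y then u y else 1 - u y)
      * ∏ x ∈ (Finset.univ.erase z).erase y, if η x then u x else 1 - u x) := by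
    rw [Finset.mul_prod_erase _ (fun x => if η x then u x else 1 - u x)
      (Finset.mem_erase.2 ⟨hzy.symm, Finset.mem_univ y⟩),
      Finset.mul_prod_erase _ (fun x => if η x then u x else 1 - u x) (Finset.mem_univ z)]
    rfl
  rw [hw]
  generalize (∏ x ∈ (Finset.univ.erase z).erase y, if η x then u x else 1 - u x) = r
  have h1 := (hu z).1.ne'
  have h2 := (hu y).1.ne'
  have h3 : 1 - u z ≠ 0 := by linarith [(hu z).2]
  have h4 : 1 - u y ≠ 0 := by linarith [(hu y).2]
  unfold bondCurrent omegaHat chi occ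
  cases hz : η z <;> cases hy : η y <;> simp only [Bool.false_eq_true, if_true, if_false] <;>
    field_simp <;>
    ring

lemma abs_chi_mul_bondCurrent_le (hu : ∀ x, u x ∈ Set.Ioo (0 : ℝ) 1) {z y : Torus d N} {θ : ℝ}
    (h1 : u z ≤ θ * u y) (h2 : 1 - u z ≤ θ * (1 - u y)) (η : Config d N) :
    |chi u z * bondCurrent u z y η| ≤ θ := by
  have a1 := (hu z).1
  have a2 := (hu y).1
  have a3 : 0 < 1 - u z := by linarith [(hu z).2]
  have a4 : 0 < 1 - u y := by linarith [(hu y).2]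
  have hθ : 0 ≤ θ := by
    by_contra! h
    nlinarith
  have e : chi u z * bondCurrent u z y η
      = (if η z then (if η y then 0 else (1 - u z) / (1 - u y))
          else (if η y then -(u z / u y) else 0)) := by
    unfold bondCurrent omegaHat chi occ
    cases hz : η z <;> cases hy : η y <;> simp only [Bool.false_eq_true, if_true, if_false] <;>
    field_simp <;>
    ring
  rw [e]
  split_ifs
  · simpa using hθ
  · rw [abs_of_nonneg (by positivity), div_le_iff₀ a4]; exact h2
  · rw [abs_neg, abs_of_nonneg (by positivity), div_le_iff₀ a2]; exact h1
  · simpa using hθ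

lemma exchange_exchange (z y : Torus d N) (η : Config d N) :
    exchange z y (exchange z y η) = η := by
  funext x
  simp [exchange]

lemma sum_exchange (z y : Torus d N) (F : Config d N → ℝ) :
    ∑ η, F (exchange z y η) = ∑ η, F η :=
  Equiv.sum_comp (Function.Involutive.toPerm _ (exchange_exchange z y)) F

/-- Integration by parts along a bond: the integral of `f` against the antisymmetric function of
the bond is controlled by the Dirichlet form of the bond. -/
lemma integralProd_mul_bondCurrent_le (hu : ∀ x, u x ∈ Set.Ioo (0 : ℝ) 1) {z y : Torus d N}
    (hzy : z ≠ y) {S : Set (Torus d N)} {h : Config d N → ℝ} (hh : DependsOn h S) (hz : z ∉ S)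
    (hy : y ∉ S) {f : Config d N → ℝ} (hf : ∀ η, 0 ≤ f η) {β θ : ℝ} (hβ : 0 < β)
    (h1 : u z ≤ θ * u y) (h2 : 1 - u z ≤ θ * (1 - u y)) :
    integralProd u (fun η => h η * (chi u z * bondCurrent u z y η) * f η)
      ≤ θ * β * integralProd u (fun η => (√(f (exchange z y η)) - √(f η)) ^ 2)
        + θ / β * integralProd u (fun η => h η ^ 2 * f η) := by
  set a : Config d N → ℝ := fun η => chi u z * bondCurrent u z y η * productWeight u η with ha
  have hθ : 0 ≤ θ := (abs_nonneg _).trans (abs_chi_mul_bondCurrent_le hu h1 h2 fun _ => true)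
  have hanti : ∀ η, a (exchange z y η) = -a η := by
    intro η
    simp only [ha]
    rw [chi_mul_bondCurrent_mul_weight hu hzy, chi_mul_bondCurrent_mul_weight hu hzy]
    have hr : (∏ x ∈ (Finset.univ.erase z).erase y,
          if exchange z y η x then u x else 1 - u x)
        = ∏ x ∈ (Finset.univ.erase z).erase y, if η x then u x else 1 - u x := by
      refine Finset.prod_congr rfl fun x hx => ?_
      simp only [Finset.mem_erase, Finset.mem_univ, and_true] at hx
      simp [exchange, Equiv.swap_apply_of_ne_of_ne hx.2 hx.1]
    rw [hr]
    have e1 : exchange z y η z = η y := by simp [exchange]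
    have e2 : exchange z y η y = η z := by simp [exchange]
    rw [e1, e2]
    cases η z <;> cases η y <;> simp
  have hinv : ∀ η, h (exchange z y η) = h η := fun η => hh fun x hx => by
    have hxz : x ≠ z := fun e => hz (e ▸ hx)
    have hxy : x ≠ y := fun e => hy (e ▸ hx)
    simp [exchange, Equiv.swap_apply_of_ne_of_ne hxz hxy]
  have habs : ∀ η, |a η| ≤ θ * productWeight u η := by
    intro η
    simp only [ha]
    rw [abs_mul, abs_of_pos (productWeight_pos hu η)]
    exact mul_le_mul_of_nonneg_right (abs_chi_mul_bondCurrent_le hu h1 h2 η)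
      (productWeight_pos hu η).le
  have habs' : ∀ η, |a (exchange z y η)| ≤ θ * productWeight u η := by
    intro η
    rw [hanti, abs_neg]
    exact habs η
  have hhalf : integralProd u (fun η => h η * (chi u z * bondCurrent u z y η) * f η)
      = ∑ η, (1 / 2) * (h η * a η * (f η - f (exchange z y η))) := by
    have e1 : integralProd u (fun η => h η * (chi u z * bondCurrent u z y η) * f η)
        = ∑ η, h η * a η * f η := by
      refine Finset.sum_congr rfl fun η _ => ?_
      simp only [ha]; ring
    have e2 := sum_exchange z y fun η => h η * a η * f η
    simp only [hinv, hanti] at e2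
    have e3 : ∑ η, (1 / 2) * (h η * a η * (f η - f (exchange z y η)))
        = (1 / 2) * ∑ η, h η * a η * f η
          + (1 / 2) * ∑ η, h η * -a η * f (exchange z y η) := by
      rw [Finset.mul_sum, Finset.mul_sum, ← Finset.sum_add_distrib]
      exact Finset.sum_congr rfl fun η _ => by ring
    rw [e1, e3, e2]
    ring
  have hpt : ∀ η, (1 / 2) * (h η * a η * (f η - f (exchange z y η)))
      ≤ θ * β / 2 * ((√(f (exchange z y η)) - √(f η)) ^ 2 * productWeight u η)
        + (1 / (4 * β)) * (h η ^ 2 * (|a η| * f η))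
        + (1 / (4 * β)) * (h η ^ 2 * (|a η| * f (exchange z y η))) := by
    intro η
    set s := √(f η)
    set t := √(f (exchange z y η))
    have hs2 : f η = s ^ 2 := (Real.sq_sqrt (hf _)).symm
    have ht2 : f (exchange z y η) = t ^ 2 := (Real.sq_sqrt (hf _)).symm
    rw [hs2, ht2]
    have hs0 : 0 ≤ s := Real.sqrt_nonneg _
    have ht0 : 0 ≤ t := Real.sqrt_nonneg _
    have hyoung : |h η| * (|t - s| * (s + t))
        ≤ β * (t - s) ^ 2 + 1 / (2 * β) * (h η ^ 2 * (s ^ 2 + t ^ 2)) := by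
      have h3 : 0 ≤ (2 * β * |t - s| - |h η| * (s + t)) ^ 2 := sq_nonneg _
      have h4 : (s + t) ^ 2 ≤ 2 * (s ^ 2 + t ^ 2) := by nlinarith [sq_nonneg (s - t)]
      have e : β * (t - s) ^ 2 + 1 / (2 * β) * (h η ^ 2 * (s ^ 2 + t ^ 2))
          = (4 * β ^ 2 * |t - s| ^ 2 + 2 * (|h η| ^ 2 * (s ^ 2 + t ^ 2))) / (4 * β) := by
        rw [sq_abs, sq_abs]; field_simp; ring
      rw [e, le_div_iff₀ (by positivity)]
      nlinarith
    have hle : h η * a η * (s ^ 2 - t ^ 2) ≤ |a η| * (|h η| * (|t - s| * (s + t))) := by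
      calc _ ≤ |h η * a η * (s ^ 2 - t ^ 2)| := le_abs_self _
        _ = _ := by
          rw [abs_mul (h η * a η), abs_mul (h η),
            show s ^ 2 - t ^ 2 = (s - t) * (s + t) by ring, abs_mul (s - t),
            abs_of_nonneg (add_nonneg hs0 ht0), abs_sub_comm s t]
          ring
    have hfirst : |a η| * (β * (t - s) ^ 2)
        ≤ θ * productWeight u η * (β * (t - s) ^ 2) :=
      mul_le_mul_of_nonneg_right (habs η) (by positivity)
    have h6 := mul_le_mul_of_nonneg_left hyoung (abs_nonneg (a η))
    have e : |a η| * (β * (t - s) ^ 2 + 1 / (2 * β) * (h η ^ 2 * (s ^ 2 + t ^ 2)))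
        = |a η| * (β * (t - s) ^ 2) + 2 * ((1 / (4 * β)) * (h η ^ 2 * (|a η| * s ^ 2))
        + (1 / (4 * β)) * (h η ^ 2 * (|a η| * t ^ 2))) := by field_simp; ring
    rw [e] at h6
    linarith
  have hsq : ∑ η, h η ^ 2 * (|a η| * f η) ≤ θ * integralProd u (fun η => h η ^ 2 * f η) := by
    rw [integralProd, Finset.mul_sum]
    refine Finset.sum_le_sum fun η _ => ?_
    have := mul_le_mul_of_nonneg_right (habs η) (mul_nonneg (sq_nonneg (h η)) (hf η))
    linarith
  have hsq' : ∑ η, h η ^ 2 * (|a η| * f (exchange z y η))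
      ≤ θ * integralProd u (fun η => h η ^ 2 * f η) := by
    rw [← sum_exchange z y]
    simp only [exchange_exchange, hinv]
    rw [integralProd, Finset.mul_sum]
    refine Finset.sum_le_sum fun η _ => ?_
    have := mul_le_mul_of_nonneg_right (habs' η) (mul_nonneg (sq_nonneg (h η)) (hf η))
    linarith
  rw [hhalf]
  refine (Finset.sum_le_sum fun η _ => hpt η).trans ?_
  rw [Finset.sum_add_distrib, Finset.sum_add_distrib, ← Finset.mul_sum, ← Finset.mul_sum,
    ← Finset.mul_sum]
  have hD : 0 ≤ integralProd u (fun η => (√(f (exchange z y η)) - √(f η)) ^ 2) :=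
    integralProd_nonneg hu fun _ => sq_nonneg _
  have hH : 0 ≤ integralProd u (fun η => h η ^ 2 * f η) :=
    integralProd_nonneg hu fun η => mul_nonneg (sq_nonneg _) (hf η)
  have hb : 0 ≤ 1 / (4 * β) := by positivity
  have s1 := mul_le_mul_of_nonneg_left hsq hb
  have s2 := mul_le_mul_of_nonneg_left hsq' hb
  have e3 : θ / β * integralProd u (fun η => h η ^ 2 * f η)
      = 4 * (1 / (4 * β) * (θ * integralProd u (fun η => h η ^ 2 * f η))) := by field_simp
  have e4 : 0 ≤ 1 / (4 * β) * (θ * integralProd u (fun η => h η ^ 2 * f η)) := by positivity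
  have e5 : 0 ≤ θ * β * integralProd u (fun η => (√(f (exchange z y η)) - √(f η)) ^ 2) := by
    positivity
  have e6 : ∑ η, (√(f (exchange z y η)) - √(f η)) ^ 2 * productWeight u η
    = integralProd u (fun η => (√(f (exchange z y η)) - √(f η)) ^ 2) := rfl
  rw [e6, e3]
  linarith

end IntegrationByParts

/-! ### The flow from a point mass to a uniform distribution -/

section Flow

variable {d N : ℕ} [NeZero N]

/-- The uniform distribution on `{0, …, k - 1} ⊂ ℤ / N ℤ`. -/
noncomputable def unifWeight (k : ℕ) (t : ZMod N) : ℝ := if t.val < k then 1 / (k : ℝ) else 0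

/-- The flow on the edges `(t, t + 1)` which transports the uniform distribution on
`{0, …, k - 1}` to the uniform distribution on `{0, …, k}`. -/
noncomputable def edgeFlow (k : ℕ) (t : ZMod N) : ℝ :=
  if t.val < k then ((t.val : ℝ) + 1) / (k * (k + 1)) else 0

/-- The uniform distribution on the cube `{0, …, k - 1}^d` of the torus. -/
noncomputable def boxWeight (k : ℕ) (y : Torus d N) : ℝ := ∏ i, unifWeight k (y i)

/-- The flow, along the edges of direction `j`, which transports the uniform distribution on the
cube of side `k` to the one on the cube of side `k + 1`, one coordinate after the other. -/
noncomputable def layerFlow (k : ℕ) (j : Fin d) (y : Torus d N) : ℝ :=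
  edgeFlow k (y j) * (∏ i with i < j, unifWeight (k + 1) (y i)) * ∏ i with j < i, unifWeight k (y i)

/-- The flow, along the edges of direction `j`, which transports the point mass at the origin to
the uniform distribution on the cube of side `m`. -/
noncomputable def boxFlow (m : ℕ) (j : Fin d) (y : Torus d N) : ℝ :=
  ∑ k ∈ Finset.Ioo 0 m, layerFlow k j y

/-- The order of magnitude of the energy of the flow `boxFlow m`. -/
noncomputable def flowEnergy (d m : ℕ) : ℝ := ∑ k ∈ Finset.Ioo 0 m, (k : ℝ) * (1 / k) ^ d

lemma unifWeight_nonneg (k : ℕ) (t : ZMod N) : 0 ≤ unifWeight k t := by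
  unfold unifWeight; split_ifs <;> positivity

lemma unifWeight_le (k : ℕ) (t : ZMod N) : unifWeight k t ≤ 1 / (k : ℝ) := by
  unfold unifWeight; split_ifs
  · exact le_rfl
  · positivity

lemma edgeFlow_nonneg (k : ℕ) (t : ZMod N) : 0 ≤ edgeFlow k t := by
  unfold edgeFlow; split_ifs <;> positivity

lemma edgeFlow_le {k : ℕ} (hk : 0 < k) (t : ZMod N) : edgeFlow k t ≤ 1 / (k : ℝ) := by
  unfold edgeFlow
  have hk' : (0 : ℝ) < k := by exact_mod_cast hk
  split_ifs with h
  · rw [div_le_div_iff₀ (by positivity) hk']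
    have : (t.val : ℝ) + 1 ≤ k := by exact_mod_cast h
    nlinarith
  · positivity

lemma unifWeight_sub (k : ℕ) (hk : 0 < k) (hkN : k < N) (t : ZMod N) :
    unifWeight k t - unifWeight (k + 1) t = edgeFlow k t - edgeFlow k (t - 1) := by
  have hk' : (0 : ℝ) < k := by exact_mod_cast hk
  have hv : t = 0 ∧ (t - 1).val = N - 1 ∨ t.val ≠ 0 ∧ (t - 1).val = t.val - 1 := by
    by_cases h : t = 0
    · left
      refine ⟨h, ?_⟩
      subst h
      obtain ⟨n, rfl⟩ : ∃ n, N = n + 1 := ⟨N - 1, by omega⟩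
      simp [ZMod.val_neg_one n]
    · right
      have h0 : t.val ≠ 0 := by rwa [Ne, ZMod.val_eq_zero]
      refine ⟨h0, ?_⟩
      have h1 : (1 : ZMod N).val = 1 := by
        have : Fact (1 < N) := ⟨by omega⟩
        exact ZMod.val_one N
      rw [ZMod.val_sub (by omega), h1]
  unfold unifWeight edgeFlow
  rcases hv with ⟨h0, h1⟩ | ⟨h0, h1⟩
  · subst h0
    rw [h1, ZMod.val_zero, if_pos hk, if_pos (by omega), if_pos hk, if_neg (by omega)]
    push_cast
    field_simp
    ring
  · rw [h1]
    have hc : ((t.val - 1 : ℕ) : ℝ) = t.val - 1 := by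
      rw [Nat.cast_sub (by omega)]; simp
    rw [hc]
    rcases lt_trichotomy t.val k with h | h | h
    · rw [if_pos h, if_pos (by omega), if_pos h, if_pos (by omega)]
      push_cast
      field_simp
      ring
    · rw [if_neg (by omega), if_pos (by omega), if_neg (by omega), if_pos (by omega), h]
      push_cast
      field_simp
      ring
    · rw [if_neg (by omega), if_neg (by omega), if_neg (by omega), if_neg (by omega)]

lemma boxWeight_sub_succ (k : ℕ) (hk : 0 < k) (hkN : k < N) (y : Torus d N) :
    boxWeight k y - boxWeight (k + 1) y
      = ∑ j, (layerFlow k j y - layerFlow k j (y - unitVec d N j)) := by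
  have h := Finset.prod_add_ordered (Finset.univ : Finset (Fin d)) (fun i => unifWeight k (y i))
    (fun i => unifWeight (k + 1) (y i) - unifWeight k (y i))
  simp only [add_sub_cancel] at h
  unfold boxWeight
  rw [h, sub_add_cancel_left, ← Finset.sum_neg_distrib]
  refine Finset.sum_congr rfl fun j _ => ?_
  have hne : ∀ i, i ≠ j → (y - unitVec d N j) i = y i := by
    intro i hi
    simp [unitVec, hi]
  have e1 : ∏ i with i < j, unifWeight (k + 1) ((y - unitVec d N j) i)
      = ∏ i with i < j, unifWeight (k + 1) (y i) :=
    Finset.prod_congr rfl fun i hi => by rw [hne i (Finset.mem_filter.1 hi).2.ne]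
  have e2 : ∏ i with j < i, unifWeight k ((y - unitVec d N j) i)
      = ∏ i with j < i, unifWeight k (y i) :=
    Finset.prod_congr rfl fun i hi => by rw [hne i (Finset.mem_filter.1 hi).2.ne']
  have e3 : (y - unitVec d N j) j = y j - 1 := by simp [unitVec]
  unfold layerFlow
  rw [e1, e2, e3, ← sub_mul, ← sub_mul, ← unifWeight_sub k hk hkN]
  ring

/-- The divergence of `boxFlow m`. -/
lemma boxWeight_one_sub (m : ℕ) (hm : 0 < m) (hmN : m ≤ N) (y : Torus d N) :
    boxWeight 1 y - boxWeight m y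
      = ∑ j, (boxFlow m j y - boxFlow m j (y - unitVec d N j)) := by
  induction m, hm using Nat.le_induction with
  | base => simp [boxFlow, show Finset.Ioo 0 1 = (∅ : Finset ℕ) from rfl]
  | succ k hk ih =>
    have hs : Finset.Ioo 0 (k + 1) = insert k (Finset.Ioo 0 k) := by
      ext i; simp only [Finset.mem_Ioo, Finset.mem_insert]; omega
    have hb : ∀ j (z : Torus d N), boxFlow (k + 1) j z = layerFlow k j z + boxFlow k j z := by
      intro j z
      unfold boxFlow
      rw [hs, Finset.sum_insert (by simp)]
    have h1 := ih (by omega)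
    have h2 := boxWeight_sub_succ k hk (by omega) y
    simp only [hb]
    rw [show boxWeight 1 y - boxWeight (k + 1) y
      = (boxWeight k y - boxWeight (k + 1) y) + (boxWeight 1 y - boxWeight k y) by ring, h1, h2,
      ← Finset.sum_add_distrib]
    exact Finset.sum_congr rfl fun j _ => by ring

lemma boxWeight_one (y : Torus d N) : boxWeight 1 y = if y = 0 then 1 else 0 := by
  unfold boxWeight unifWeight
  split_ifs with h
  · subst h; simp
  · obtain ⟨i, hi⟩ := Function.ne_iff.1 h
    refine Finset.prod_eq_zero (Finset.mem_univ i) ?_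
    rw [if_neg]
    have : (y i).val ≠ 0 := by rwa [Ne, ZMod.val_eq_zero]
    omega

lemma boxWeight_nonneg (k : ℕ) (y : Torus d N) : 0 ≤ boxWeight k y :=
  Finset.prod_nonneg fun _ _ => unifWeight_nonneg _ _

lemma boxWeight_le (k : ℕ) (y : Torus d N) : boxWeight k y ≤ (1 / (k : ℝ)) ^ d := by
  refine (Finset.prod_le_prod (fun _ _ => unifWeight_nonneg _ _)
    fun i _ => unifWeight_le k (y i)).trans (le_of_eq ?_)
  simp

lemma inBox_of_boxWeight_ne_zero {k : ℕ} {y : Torus d N} (h : boxWeight k y ≠ 0) :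
    InBox (k - 1) y := by
  intro i
  have := (Finset.prod_ne_zero_iff.1 h) i (Finset.mem_univ i)
  unfold unifWeight at this
  have h2 : (y i).val < k := by
    by_contra h3
    exact this (if_neg h3)
  omega

lemma sum_unifWeight {k : ℕ} (hk : 0 < k) (hkN : k ≤ N) :
    ∑ t : ZMod N, unifWeight k t = 1 := by
  obtain ⟨n, rfl⟩ : ∃ n, N = n + 1 := ⟨N - 1, by omega⟩
  have h := Fin.sum_univ_eq_sum_range (fun i => if i < k then 1 / (k : ℝ) else 0) (n + 1)
  refine (show ∑ t : ZMod (n + 1), unifWeight k t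
    = ∑ t : Fin (n + 1), if (t : ℕ) < k then 1 / (k : ℝ) else 0 from rfl).trans (h.trans ?_)
  rw [← Finset.sum_filter]
  have : (Finset.range (n + 1)).filter (· < k) = Finset.range k := by
    ext i; simp only [Finset.mem_filter, Finset.mem_range]; omega
  rw [this]
  have hk' : (k : ℝ) ≠ 0 := by positivity
  simp [hk']

lemma sum_boxWeight {k : ℕ} (hk : 0 < k) (hkN : k ≤ N) :
    ∑ y : Torus d N, boxWeight k y = 1 := by
  have h := Finset.prod_univ_sum (fun _ : Fin d => (Finset.univ : Finset (ZMod N)))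
    (fun _ t => unifWeight k t)
  simp only [Fintype.piFinset_univ, sum_unifWeight hk hkN, Finset.prod_const_one] at h
  exact h.symm

lemma layerFlow_nonneg (k : ℕ) (j : Fin d) (y : Torus d N) : 0 ≤ layerFlow k j y :=
  mul_nonneg (mul_nonneg (edgeFlow_nonneg _ _)
    (Finset.prod_nonneg fun _ _ => unifWeight_nonneg _ _))
    (Finset.prod_nonneg fun _ _ => unifWeight_nonneg _ _)

lemma layerFlow_le {k : ℕ} (hk : 0 < k) (j : Fin d) (y : Torus d N) :
    layerFlow k j y ≤ (1 / (k : ℝ)) ^ d := by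
  have hk' : (0 : ℝ) < k := by exact_mod_cast hk
  have h1 : ∏ i with i < j, unifWeight (k + 1) (y i) ≤ (1 / (k : ℝ)) ^ (j : ℕ) := by
    refine (Finset.prod_le_prod (fun _ _ => unifWeight_nonneg _ _) fun i _ =>
      (unifWeight_le (k + 1) (y i)).trans (one_div_le_one_div_of_le hk' ?_)).trans
        (le_of_eq ?_)
    · push_cast; linarith
    · rw [Finset.prod_const, Finset.filter_gt_eq_Iio, Fin.card_Iio]
  have h2 : ∏ i with j < i, unifWeight k (y i) ≤ (1 / (k : ℝ)) ^ (d - 1 - (j : ℕ)) := by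
    refine (Finset.prod_le_prod (fun _ _ => unifWeight_nonneg _ _) fun i _ =>
      unifWeight_le k (y i)).trans (le_of_eq ?_)
    rw [Finset.prod_const, Finset.filter_lt_eq_Ioi, Fin.card_Ioi]
  calc layerFlow k j y
      ≤ 1 / (k : ℝ) * (1 / (k : ℝ)) ^ (j : ℕ) * (1 / (k : ℝ)) ^ (d - 1 - (j : ℕ)) := by
        unfold layerFlow
        refine mul_le_mul (mul_le_mul (edgeFlow_le hk _) h1 ?_ (by positivity)) h2 ?_
          (by positivity)
        · exact Finset.prod_nonneg fun _ _ => unifWeight_nonneg _ _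
        · exact Finset.prod_nonneg fun _ _ => unifWeight_nonneg _ _
    _ = (1 / (k : ℝ)) ^ (1 + (j : ℕ) + (d - 1 - (j : ℕ))) := by
        rw [pow_add, pow_add, pow_one]
    _ = _ := by congr 1; omega

lemma inBox_of_layerFlow_ne_zero {k : ℕ} {j : Fin d} {y : Torus d N}
    (h : layerFlow k j y ≠ 0) : InBox k y := by
  intro i
  unfold layerFlow at h
  have h1 := left_ne_zero_of_mul (left_ne_zero_of_mul h)
  have h2 := Finset.prod_ne_zero_iff.1 (right_ne_zero_of_mul (left_ne_zero_of_mul h))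
  have h3 := Finset.prod_ne_zero_iff.1 (right_ne_zero_of_mul h)
  rcases lt_trichotomy i j with hij | hij | hij
  · have := h2 i (by simpa using hij)
    unfold unifWeight at this
    by_contra hc
    exact this (if_neg (by omega))
  · subst hij
    unfold edgeFlow at h1
    by_contra hc
    exact h1 (if_neg (by omega))
  · have := h3 i (by simpa using hij)
    unfold unifWeight at this
    by_contra hc
    exact this (if_neg (by omega))

lemma inBox_of_boxFlow_ne_zero {m : ℕ} {j : Fin d} {y : Torus d N}
    (h : boxFlow m j y ≠ 0) : InBox (m - 1) y := by
  obtain ⟨k, hk, hk0⟩ := Finset.exists_ne_zero_of_sum_ne_zero h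
  intro i
  have := inBox_of_layerFlow_ne_zero hk0 i
  rw [Finset.mem_Ioo] at hk
  omega

open Classical in
lemma card_inBox_le (k : ℕ) :
    (Finset.univ.filter fun y : Torus d N => InBox k y).card ≤ (k + 1) ^ d := by
  have hsub : (Finset.univ.filter fun y : Torus d N => InBox k y)
      ⊆ Fintype.piFinset fun _ : Fin d => Finset.univ.filter fun t : ZMod N => t.val ≤ k := by
    intro y hy
    simp only [Finset.mem_filter, Finset.mem_univ, true_and, Fintype.mem_piFinset] at hy ⊢
    exact hy
  refine (Finset.card_le_card hsub).trans ?_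
  rw [Fintype.card_piFinset, Finset.prod_const, Finset.card_univ, Fintype.card_fin]
  refine Nat.pow_le_pow_left ?_ d
  calc _ ≤ (Finset.range (k + 1)).card := by
        refine Finset.card_le_card_of_injOn ZMod.val ?_ ((ZMod.val_injective N).injOn)
        intro t ht
        simp only [Finset.coe_filter, Finset.mem_univ, true_and, Set.mem_ofPred_eq] at ht
        simp only [Finset.coe_range, Set.mem_Iio]
        omega
    _ = _ := Finset.card_range _

lemma sum_layerFlow_le {k : ℕ} (hk : 0 < k) (j : Fin d) :
    ∑ y : Torus d N, layerFlow k j y ≤ 2 ^ d := by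
  classical
  have hk' : (0 : ℝ) < k := by exact_mod_cast hk
  have h1 : ∑ y : Torus d N, layerFlow k j y
      = ∑ y with InBox k y, layerFlow k j (y : Torus d N) := by
    symm
    refine Finset.sum_subset (Finset.filter_subset _ _) fun y _ hy => ?_
    by_contra h
    exact hy (by simpa using inBox_of_layerFlow_ne_zero h)
  rw [h1]
  calc _ ≤ ∑ y with InBox k (y : Torus d N), (1 / (k : ℝ)) ^ d :=
        Finset.sum_le_sum fun y _ => layerFlow_le hk j y
    _ = ((Finset.univ.filter fun y : Torus d N => InBox k y).card : ℝ) * (1 / (k : ℝ)) ^ d := by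
        rw [Finset.sum_const, nsmul_eq_mul]
    _ ≤ ((k : ℝ) + 1) ^ d * (1 / (k : ℝ)) ^ d := by
        refine mul_le_mul_of_nonneg_right ?_ (by positivity)
        exact_mod_cast card_inBox_le (d := d) (N := N) k
    _ = (((k : ℝ) + 1) * (1 / k)) ^ d := by rw [mul_pow]
    _ ≤ 2 ^ d := by
        refine pow_le_pow_left₀ (by positivity) ?_ d
        rw [mul_one_div, div_le_iff₀ hk']
        have : (1 : ℝ) ≤ k := by exact_mod_cast hk
        linarith

/-- The energy of the flow is the sum over pairs of layers `k, k'` of their overlaps, which are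
at most of order `max (k, k')^{-d}`. -/
lemma sum_boxFlow_sq_le (m : ℕ) (j : Fin d) :
    ∑ y : Torus d N, boxFlow m j y ^ 2 ≤ 2 ^ (d + 1) * flowEnergy d m := by
  have hpair : ∀ k ∈ Finset.Ioo 0 m, ∀ k' ∈ Finset.Ioo 0 m,
      ∑ y : Torus d N, layerFlow k j y * layerFlow k' j y ≤ 2 ^ d * (1 / (k' : ℝ)) ^ d := by
    intro k hk k' hk'
    rw [Finset.mem_Ioo] at hk hk'
    calc _ ≤ ∑ y : Torus d N, layerFlow k j y * (1 / (k' : ℝ)) ^ d :=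
          Finset.sum_le_sum fun y _ =>
            mul_le_mul_of_nonneg_left (layerFlow_le hk'.1 j y) (layerFlow_nonneg k j y)
      _ = (∑ y : Torus d N, layerFlow k j y) * (1 / (k' : ℝ)) ^ d := by rw [Finset.sum_mul]
      _ ≤ _ := mul_le_mul_of_nonneg_right (sum_layerFlow_le hk.1 j) (by positivity)
  set s := Finset.Ioo 0 m with hs
  have h1 : ∑ y : Torus d N, boxFlow m j y ^ 2
      = ∑ k ∈ s, ∑ k' ∈ s, ∑ y : Torus d N, layerFlow k j y * layerFlow k' j y := by
    simp_rw [boxFlow, sq, Finset.sum_mul_sum]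
    rw [Finset.sum_comm]
    exact Finset.sum_congr rfl fun k _ => Finset.sum_comm
  have h2 : ∀ k ∈ s, ∀ k' ∈ s, ∑ y : Torus d N, layerFlow k j y * layerFlow k' j y
      ≤ (if k ≤ k' then 2 ^ d * (1 / (k' : ℝ)) ^ d else 0)
        + (if k' ≤ k then 2 ^ d * (1 / (k : ℝ)) ^ d else 0) := by
    intro k hk k' hk'
    rcases le_total k k' with h | h
    · rw [if_pos h]
      refine (hpair k hk k' hk').trans (le_add_of_nonneg_right ?_)
      split_ifs <;> positivity
    · rw [if_pos h]
      have := hpair k' hk' k hk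
      simp_rw [mul_comm (layerFlow k' j _)] at this
      refine this.trans (le_add_of_nonneg_left ?_)
      split_ifs <;> positivity
  have h3 : ∀ k' ∈ s, ∑ k ∈ s, (if k ≤ k' then (2 : ℝ) ^ d * (1 / (k' : ℝ)) ^ d else 0)
      ≤ 2 ^ d * ((k' : ℝ) * (1 / k') ^ d) := by
    intro k' _
    rw [← Finset.sum_filter, Finset.sum_const, nsmul_eq_mul]
    have hc : ((s.filter fun k => k ≤ k').card : ℝ) ≤ k' := by
      have : s.filter (fun k => k ≤ k') ⊆ Finset.Icc 1 k' := by
        intro k hk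
        rw [Finset.mem_filter, hs, Finset.mem_Ioo] at hk
        rw [Finset.mem_Icc]
        omega
      have := Finset.card_le_card this
      rw [Nat.card_Icc, Nat.add_sub_cancel] at this
      exact_mod_cast this
    calc _ ≤ (k' : ℝ) * (2 ^ d * (1 / (k' : ℝ)) ^ d) :=
          mul_le_mul_of_nonneg_right hc (by positivity)
      _ = _ := by ring
  rw [h1]
  calc _ ≤ ∑ k ∈ s, ∑ k' ∈ s, ((if k ≤ k' then (2 : ℝ) ^ d * (1 / (k' : ℝ)) ^ d else 0)
        + (if k' ≤ k then 2 ^ d * (1 / (k : ℝ)) ^ d else 0)) :=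
        Finset.sum_le_sum fun k hk => Finset.sum_le_sum fun k' hk' => h2 k hk k' hk'
    _ = ∑ k' ∈ s, ∑ k ∈ s, (if k ≤ k' then (2 : ℝ) ^ d * (1 / (k' : ℝ)) ^ d else 0)
        + ∑ k ∈ s, ∑ k' ∈ s, (if k' ≤ k then 2 ^ d * (1 / (k : ℝ)) ^ d else 0) := by
        simp_rw [Finset.sum_add_distrib]
        rw [Finset.sum_comm]
    _ ≤ ∑ k' ∈ s, 2 ^ d * ((k' : ℝ) * (1 / k') ^ d)
        + ∑ k ∈ s, 2 ^ d * ((k : ℝ) * (1 / k) ^ d) :=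
        add_le_add (Finset.sum_le_sum h3) (Finset.sum_le_sum h3)
    _ = _ := by
        rw [← Finset.mul_sum, flowEnergy]
        ring

lemma flowEnergy_le {m : ℕ} {l : ℝ} (hd : 0 < d) (hl : Real.exp 1 ≤ l) (hm : (m : ℝ) ≤ l) :
    flowEnergy d m ≤ 2 * gFun d l := by
  have hl1 : 1 ≤ l := (Real.one_le_exp (by norm_num)).trans hl
  unfold gFun flowEnergy
  split_ifs with h1 h2
  · subst h1
    calc ∑ k ∈ Finset.Ioo 0 m, (k : ℝ) * (1 / k) ^ 1 ≤ ∑ k ∈ Finset.Ioo 0 m, (1 : ℝ) := by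
          refine Finset.sum_le_sum fun k hk => ?_
          have : (k : ℝ) ≠ 0 := by
            have := (Finset.mem_Ioo.1 hk).1
            positivity
          field_simp; exact le_rfl
      _ ≤ m := by
          rw [Finset.sum_const, Nat.card_Ioo, nsmul_eq_mul, mul_one]
          exact_mod_cast (by omega)
      _ ≤ 2 * l := by linarith
  · subst h2
    have hlog : 1 ≤ Real.log l := by
      rw [Real.le_log_iff_exp_le (by linarith)]; exact hl
    rcases Nat.eq_zero_or_pos m with rfl | hm0
    · simp; linarith
    calc ∑ k ∈ Finset.Ioo 0 m, (k : ℝ) * (1 / k) ^ 2 ≤ ∑ k ∈ Finset.Icc 1 m, (k : ℝ)⁻¹ := by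
          calc _ = ∑ k ∈ Finset.Ioo 0 m, (k : ℝ)⁻¹ := by
                refine Finset.sum_congr rfl fun k hk => ?_
                have : (k : ℝ) ≠ 0 := by
                  have := (Finset.mem_Ioo.1 hk).1
                  positivity
                field_simp
            _ ≤ _ := by
                refine Finset.sum_le_sum_of_subset_of_nonneg ?_ fun _ _ _ => by positivity
                intro k hk
                rw [Finset.mem_Ioo] at hk
                rw [Finset.mem_Icc]
                omega
      _ = (harmonic m : ℝ) := by rw [harmonic_eq_sum_Icc]; push_cast; rfl
      _ ≤ 1 + Real.log m := harmonic_le_one_add_log m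
      _ ≤ 1 + Real.log l := by
          have : (0 : ℝ) < m := by exact_mod_cast hm0
          linarith [Real.log_le_log this hm]
      _ ≤ _ := by linarith
  · calc ∑ k ∈ Finset.Ioo 0 m, (k : ℝ) * (1 / k) ^ d ≤ ∑ k ∈ Finset.Ioo 0 m, ((k : ℝ) ^ 2)⁻¹ := by
          refine Finset.sum_le_sum fun k hk => ?_
          have hk0 := (Finset.mem_Ioo.1 hk).1
          have hk1 : (1 : ℝ) ≤ k := by exact_mod_cast hk0
          calc (k : ℝ) * (1 / k) ^ d ≤ k * (1 / k) ^ 3 := by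
                refine mul_le_mul_of_nonneg_left ?_ (by positivity)
                refine pow_le_pow_of_le_one (by positivity) ?_ (by omega)
                rw [div_le_one (by positivity)]; exact hk1
            _ = _ := by field_simp
      _ ≤ 2 / ((0 : ℕ) + 1) := sum_Ioo_inv_sq_le 0 m
      _ = 2 * 1 := by norm_num

end Flow

/-! ### One smoothing step -/

section Step

variable {d N : ℕ} [NeZero N] {u : Torus d N → ℝ}

/-- The convolution of two functions on the torus. -/
def conv (p q : Torus d N → ℝ) (v : Torus d N) : ℝ := ∑ y, p y * q (v - y)

/-- The observable `∑_s G(s) χ_s ω_{s+P} ∑_v q(v) ω̂_{s+v}`: one of the factors has been averaged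
with weights `q`. -/
noncomputable def smoothed (u G : Torus d N → ℝ) (P : Finset (Fin d → ℤ)) (q : Torus d N → ℝ)
    (η : Config d N) : ℝ :=
  ∑ s, G s * chi u s * omega u (translate s P) η * ∑ v, q v * omegaHat u (s + v) η

/-- Quantitative regularity of a density profile: `θ` bounds the ratios of the densities at
neighbouring sites and of the variances at sites whose difference is in `{0, …, R}^d`, and `ε`
bounds the discrete gradient relative to the variance. -/
structure RegularProfile (u : Torus d N → ℝ) (θ ε : ℝ) (R : ℕ) : Prop where
  mem_Ioo : ∀ x, u x ∈ Set.Ioo (0 : ℝ) 1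
  one_le : 1 ≤ θ
  chi_le : ∀ w v, InBox R v → chi u w ≤ θ * chi u (w + v)
  le_edge : ∀ w j, u w ≤ θ * u (w + unitVec d N j)
  one_sub_le_edge : ∀ w j, 1 - u w ≤ θ * (1 - u (w + unitVec d N j))
  grad : ∀ w j, |u w - u (w + unitVec d N j)| ≤ ε * chi u (w + unitVec d N j)

lemma sum_conv_mul (p q θ : Torus d N → ℝ) (s : Torus d N) :
    ∑ v, conv p q v * θ (s + v) = ∑ y, p y * ∑ v, q v * θ (s + y + v) := by
  unfold conv
  simp_rw [Finset.sum_mul, Finset.mul_sum]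
  rw [Finset.sum_comm]
  refine Finset.sum_congr rfl fun y _ => ?_
  rw [← Equiv.sum_comp (Equiv.addRight y)]
  refine Finset.sum_congr rfl fun v _ => ?_
  simp only [Equiv.coe_addRight, add_sub_cancel_right]
  rw [show s + (v + y) = s + y + v by abel]
  ring

/-- Summation by parts along the flow from the point mass to the uniform distribution. -/
lemma sum_mul_sub_boxWeight {m : ℕ} (hm : 0 < m) (hmN : m ≤ N) (g θ : Torus d N → ℝ) :
    ∑ s, g s * (θ s - ∑ y, boxWeight m y * θ (s + y))
      = ∑ j, ∑ w, (∑ x, boxFlow m j (w - x) * g x) * (θ w - θ (w + unitVec d N j)) := by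
  have h1 : ∀ s, θ s - ∑ y, boxWeight m y * θ (s + y)
      = ∑ j, ∑ y, boxFlow m j y * (θ (s + y) - θ (s + y + unitVec d N j)) := by
    intro s
    have e1 : θ s = ∑ y, boxWeight 1 y * θ (s + y) := by
      simp [boxWeight_one]
    rw [e1, ← Finset.sum_sub_distrib]
    simp_rw [← sub_mul, boxWeight_one_sub m hm hmN, Finset.sum_mul]
    rw [Finset.sum_comm]
    refine Finset.sum_congr rfl fun j _ => ?_
    simp_rw [sub_mul, mul_sub, Finset.sum_sub_distrib]
    congr 1
    rw [← Equiv.sum_comp (Equiv.addRight (unitVec d N j))]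
    simp only [Equiv.coe_addRight, add_sub_cancel_right, add_assoc]
  simp_rw [h1, Finset.mul_sum]
  rw [Finset.sum_comm]
  refine Finset.sum_congr rfl fun j _ => ?_
  simp_rw [Finset.sum_mul]
  rw [Finset.sum_comm (γ := Torus d N) (s := (Finset.univ : Finset (Torus d N)))
    (f := fun w x => boxFlow m j (w - x) * g x * (θ w - θ (w + unitVec d N j)))]
  refine Finset.sum_congr rfl fun s _ => ?_
  rw [← Equiv.sum_comp (Equiv.addLeft s)
    (fun w => boxFlow m j (w - s) * g s * (θ w - θ (w + unitVec d N j)))]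
  refine Finset.sum_congr rfl fun y _ => ?_
  simp only [Equiv.coe_addLeft, add_sub_cancel_left]
  ring

/-- The pair `{0, e_j}`. -/
def bondPattern (j : Fin d) : Finset (Fin d → ℤ) := {0, Pi.single j 1}

lemma translate_bondPattern (j : Fin d) (z : Torus d N) :
    translate z (bondPattern j) = {z, z + unitVec d N j} := by
  have e : (fun i => z i + (((Pi.single j 1 : Fin d → ℤ) i : ℤ) : ZMod N))
      = z + unitVec d N j := by
    funext i
    by_cases h : i = j
    · subst h; simp [unitVec]
    · simp [unitVec, h]
  rw [translate, bondPattern, Finset.image_insert, Finset.image_singleton, e]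
  simp

lemma bondPattern_nonneg (j : Fin d) : ∀ b ∈ bondPattern j, ∀ i, 0 ≤ b i := by
  intro b hb i
  simp only [bondPattern, Finset.mem_insert, Finset.mem_singleton] at hb
  rcases hb with rfl | rfl
  · simp
  · by_cases h : i = j
    · subst h; simp
    · simp [h]

lemma bondPattern_abs_le (j : Fin d) {D : ℕ} (hD : 1 ≤ D) :
    ∀ b ∈ bondPattern j, ∀ i, |b i| ≤ D := by
  intro b hb i
  simp only [bondPattern, Finset.mem_insert, Finset.mem_singleton] at hb
  rcases hb with rfl | rfl
  · simp
  · by_cases h : i = j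
    · subst h; simpa using hD
    · simp [h]

lemma ne_add_unitVec (hN : 2 ≤ N) (j : Fin d) (z : Torus d N) : z ≠ z + unitVec d N j := by
  intro h
  have h1 : (1 : ZMod N) = 0 := by
    have := congrFun h j
    simpa [unitVec] using this
  have : Fact (1 < N) := ⟨by omega⟩
  exact one_ne_zero h1

lemma omega_bondPattern (hN : 2 ≤ N) (j : Fin d) (z : Torus d N) (η : Config d N) :
    omega u (translate z (bondPattern j)) η
      = (occ η z - u z) * (occ η (z + unitVec d N j) - u (z + unitVec d N j)) := by
  rw [translate_bondPattern, omega, Finset.prod_pair (ne_add_unitVec hN j z)]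

lemma sum_sq_le_of_abs_le {q β : Torus d N → ℝ} {c Q : ℝ} (w : Torus d N) (hq0 : ∀ v, 0 ≤ q v)
    (hq1 : ∑ v, q v = 1) (hqQ : ∀ v, q v ≤ Q) (hβ : ∀ z, |β z| ≤ c * q (z - w)) :
    ∑ z, β z ^ 2 ≤ c ^ 2 * Q := by
  calc ∑ z, β z ^ 2 ≤ ∑ z, c ^ 2 * (Q * q (z - w)) := by
        refine Finset.sum_le_sum fun z _ => ?_
        rw [← sq_abs]
        calc |β z| ^ 2 ≤ (c * q (z - w)) ^ 2 := pow_le_pow_left₀ (abs_nonneg _) (hβ z) 2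
          _ = c ^ 2 * (q (z - w) * q (z - w)) := by ring
          _ ≤ _ := by
            have := mul_le_mul_of_nonneg_right (hqQ (z - w)) (hq0 (z - w))
            gcongr
    _ = c ^ 2 * Q := by
        have h := Equiv.sum_comp (Equiv.subRight w) q
        simp only [Equiv.subRight_apply] at h
        rw [← Finset.mul_sum, ← Finset.mul_sum, h, hq1, mul_one]

lemma abs_flow_coeff_le {θ ε Γ : ℝ} {R : ℕ} (hreg : RegularProfile u θ ε R)
    {G : Torus d N → ℝ} (hG : ∀ x, |G x| ≤ Γ) (φ : Torus d N → ℝ)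
    (hφ : ∀ y, φ y ≠ 0 → InBox R y) (w x : Torus d N) :
    |φ (w - x) * G x * (chi u x / chi u w)| ≤ θ * Γ * |φ (w - x)| := by
  by_cases h : φ (w - x) = 0
  · simp [h]
  · have h1 := hreg.chi_le x (w - x) (hφ _ h)
    rw [add_sub_cancel] at h1
    have hx := chi_pos hreg.mem_Ioo x
    have hw := chi_pos hreg.mem_Ioo w
    rw [abs_mul, abs_mul, abs_of_pos (div_pos hx hw)]
    have h2 : chi u x / chi u w ≤ θ := (div_le_iff₀ hw).2 h1
    have hΓ : 0 ≤ Γ := (abs_nonneg _).trans (hG x)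
    calc |φ (w - x)| * |G x| * (chi u x / chi u w) ≤ |φ (w - x)| * Γ * θ := by
          refine mul_le_mul (mul_le_mul_of_nonneg_left (hG x) (abs_nonneg _)) h2
            (div_pos hx hw).le (mul_nonneg (abs_nonneg _) hΓ)
      _ = _ := by ring

lemma sum_flow_coeff_sq_le {θ ε Γ : ℝ} {R : ℕ} (hreg : RegularProfile u θ ε R)
    {G : Torus d N → ℝ} (hG : ∀ x, |G x| ≤ Γ) (φ : Torus d N → ℝ)
    (hφ : ∀ y, φ y ≠ 0 → InBox R y) {E : ℝ} (hE : ∑ y, φ y ^ 2 ≤ E) (w : Torus d N) :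
    ∑ x, (φ (w - x) * G x * (chi u x / chi u w)) ^ 2 ≤ (θ * Γ) ^ 2 * E := by
  calc _ ≤ ∑ x, (θ * Γ) ^ 2 * φ (w - x) ^ 2 := by
        refine Finset.sum_le_sum fun x _ => ?_
        rw [← sq_abs, ← sq_abs (φ (w - x)), ← mul_pow]
        exact pow_le_pow_left₀ (abs_nonneg _) (abs_flow_coeff_le hreg hG φ hφ w x) 2
    _ = (θ * Γ) ^ 2 * ∑ y, φ y ^ 2 := by
        have h := Equiv.sum_comp (Equiv.subLeft w) fun y => φ y ^ 2
        simp only [Equiv.subLeft_apply] at h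
        rw [← Finset.mul_sum, h]
    _ ≤ _ := mul_le_mul_of_nonneg_left hE (sq_nonneg _)

/-- One smoothing step: replacing the weights `q` by their convolution with the uniform
distribution on a cube of side `m` costs a small multiple of the Dirichlet form, plus the entropy
bounds for the square of the current and for the nonlinear part of `bondCurrent`. -/
lemma integralProd_smoothed_sub_le {θ ε Γ : ℝ} {R m D : ℕ}
    (hreg : RegularProfile u θ ε R) {f : Config d N → ℝ} (hf : IsDensity u f)
    {P : Finset (Fin d → ℤ)} (hPne : P.Nonempty) (hP : ∀ b ∈ P, ∃ i, b i < 0)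
    (hPD : ∀ b ∈ P, ∀ i, |b i| ≤ D) (hD : 1 ≤ D) (hN : 2 * (R + D) + 1 ≤ N)
    (hm : 0 < m) (hmR : m ≤ R) {G : Torus d N → ℝ} (hG : ∀ x, |G x| ≤ Γ) (hΓ : 0 < Γ)
    {E : ℝ} (hE : flowEnergy d m ≤ E) (hE0 : 0 < E) {q : Torus d N → ℝ} {Q : ℝ}
    (hq0 : ∀ v, 0 ≤ q v) (hq1 : ∑ v, q v = 1) (hqQ : ∀ v, q v ≤ Q)
    (hqR : ∀ v, q v ≠ 0 → InBox R v) {β κ S S' : ℝ} (hβ : 0 < β) (hκ : 0 < κ)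
    (hSdef : S = (θ * Γ) ^ 2 * (2 ^ (d + 1) * E)) (hS'def : S' = (ε * θ) ^ 2 * Q)
    (hκS : colors d D ^ 4 * (κ ^ 2 * S * S') ≤ 1 / 2) :
    integralProd u (fun η => (smoothed u G P q η - smoothed u G P (conv (boxWeight m) q) η) * f η)
      ≤ 2 * θ * β * exclusionForm u f
        + d * (θ ^ 3 / β * (4 * colors d D ^ 2 * S
            * (colors d (R + D) * entropy u f + (N : ℝ) ^ d)))
        + d * (colors d (R + D) / κ * entropy u f
            + (N : ℝ) ^ d * (colors d D ^ 4 * (κ * S * S'))) := by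
  have hu := hreg.mem_Ioo
  have hθ : 0 < θ := by linarith [hreg.one_le]
  have hS0 : 0 < S := by rw [hSdef]; positivity
  have hQ0 : 0 ≤ Q := (hq0 0).trans (hqQ 0)
  have hS'0 : 0 ≤ S' := by rw [hS'def]; positivity
  set e : Fin d → Torus d N := unitVec d N
  set α : Fin d → Torus d N → Torus d N → ℝ :=
    fun j w x => boxFlow m j (w - x) * G x * (chi u x / chi u w) with hα
  set γ : Fin d → Torus d N → Torus d N → ℝ := fun j w z =>
    -(q (z - w) * (u z - u (z + e j)) * (chi u w / (chi u z * chi u (z + e j)))) with hγ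
  set h : Fin d → Torus d N → Config d N → ℝ :=
    fun j w η => ∑ x, α j w x * omega u (translate x P) η with hh
  have hφR : ∀ j, ∀ y : Torus d N, boxFlow m j y ≠ 0 → InBox R y := fun j y hy i =>
    (inBox_of_boxFlow_ne_zero hy i).trans (by omega)
  have hαR : ∀ j w x, α j w x ≠ 0 → InBox R (w - x) := fun j w x hx =>
    hφR j _ (left_ne_zero_of_mul (left_ne_zero_of_mul hx))
  have hαS : ∀ j w, ∑ x, α j w x ^ 2 ≤ S := by
    intro j w
    rw [hSdef]
    refine sum_flow_coeff_sq_le hreg hG (boxFlow m j) (hφR j) ?_ w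
    exact (sum_boxFlow_sq_le m j).trans (mul_le_mul_of_nonneg_left hE (by positivity))
  have hγR : ∀ j w z, γ j w z ≠ 0 → InBox R (z - w) := fun j w z hz =>
    hqR _ (left_ne_zero_of_mul (left_ne_zero_of_mul (neg_ne_zero.1 hz)))
  have hγabs : ∀ j w z, |γ j w z| ≤ ε * θ * q (z - w) := by
    intro j w z
    by_cases hz : q (z - w) = 0
    · simp [hγ, hz]
    · have h1 := hreg.chi_le w (z - w) (hqR _ hz)
      rw [add_sub_cancel] at h1
      have h2 := hreg.grad z j
      have c1 := chi_pos hu w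
      have c2 := chi_pos hu z
      have c3 := chi_pos hu (z + e j)
      have h3 : chi u w / chi u z ≤ θ := (div_le_iff₀ c2).2 h1
      have h4 : |u z - u (z + e j)| / chi u (z + e j) ≤ ε := (div_le_iff₀ c3).2 h2
      have h5 : 0 ≤ |u z - u (z + e j)| / chi u (z + e j) := by positivity
      simp only [hγ]
      rw [abs_neg, abs_mul, abs_mul, abs_of_nonneg (hq0 _), abs_of_pos (div_pos c1 (mul_pos c2 c3))]
      calc q (z - w) * |u z - u (z + e j)| * (chi u w / (chi u z * chi u (z + e j)))
          = (|u z - u (z + e j)| / chi u (z + e j)) * (chi u w / chi u z) * q (z - w) := by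
            field_simp
        _ ≤ ε * θ * q (z - w) :=
            mul_le_mul_of_nonneg_right (mul_le_mul h4 h3 (by positivity) (h5.trans h4)) (hq0 _)
  have hγS : ∀ j w, ∑ z, γ j w z ^ 2 ≤ S' := by
    intro j w
    rw [hS'def]
    exact sum_sq_le_of_abs_le w hq0 hq1 hqQ (hγabs j w)
  -- the pointwise decomposition of the difference
  have hpt : ∀ η, smoothed u G P q η - smoothed u G P (conv (boxWeight m) q) η
      = ∑ j, ∑ w, ((∑ v, q v * (h j w η * (chi u w / chi u (w + v))
            * (chi u (w + v) * bondCurrent u (w + v) (w + v + e j) η)))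
          + h j w η * ∑ z, γ j w z * omega u (translate z (bondPattern j)) η) := by
    intro η
    have e1 : smoothed u G P q η - smoothed u G P (conv (boxWeight m) q) η
        = ∑ s, G s * chi u s * omega u (translate s P) η
          * ((∑ v, q v * omegaHat u (s + v) η)
            - ∑ y, boxWeight m y * ∑ v, q v * omegaHat u (s + y + v) η) := by
      unfold smoothed
      rw [← Finset.sum_sub_distrib]
      refine Finset.sum_congr rfl fun s _ => ?_
      rw [sum_conv_mul _ _ (fun x => omegaHat u x η), mul_sub]
    rw [e1, sum_mul_sub_boxWeight hm (by omega)
      (fun s => G s * chi u s * omega u (translate s P) η)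
      (fun s => ∑ v, q v * omegaHat u (s + v) η)]
    refine Finset.sum_congr rfl fun j _ => Finset.sum_congr rfl fun w _ => ?_
    have cw := (chi_pos hu w).ne'
    have e2 : ∑ x, boxFlow m j (w - x) * (G x * chi u x * omega u (translate x P) η)
        = chi u w * h j w η := by
      simp only [hh, hα, Finset.mul_sum]
      refine Finset.sum_congr rfl fun x _ => ?_
      field_simp
    have e3 : ∑ z, γ j w z * omega u (translate z (bondPattern j)) η
        = ∑ v, γ j w (w + v) * omega u (translate (w + v) (bondPattern j)) η :=
      (Equiv.sum_comp (Equiv.addLeft w)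
        fun z => γ j w z * omega u (translate z (bondPattern j)) η).symm
    rw [e2, e3]
    generalize h j w η = H
    rw [← Finset.sum_sub_distrib, Finset.mul_sum, Finset.mul_sum, ← Finset.sum_add_distrib]
    refine Finset.sum_congr rfl fun v _ => ?_
    rw [omega_bondPattern (by omega)]
    simp only [hγ, add_sub_cancel_left]
    have c2 := (chi_pos hu (w + v)).ne'
    have c3 := (chi_pos hu (w + v + e j)).ne'
    rw [show w + e j + v = w + v + e j by abel]
    unfold bondCurrent omegaHat
    field_simp
    ring
  have hA : ∀ j w v, q v * integralProd u (fun η => h j w η * (chi u w / chi u (w + v))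
            * (chi u (w + v) * bondCurrent u (w + v) (w + v + e j) η) * f η)
      ≤ q v * (θ * β * integralProd u
          (fun η => (√(f (exchange (w + v) (w + v + e j) η)) - √(f η)) ^ 2)
        + θ ^ 3 / β * integralProd u (fun η => h j w η ^ 2 * f η)) := by
    intro j w v
    by_cases hv : q v = 0
    · simp [hv]
    refine mul_le_mul_of_nonneg_left ?_ (hq0 v)
    have hdisj := disjoint_backSupport_frontSupport hP hPD (bondPattern_nonneg j)
      (bondPattern_abs_le j hD) (by omega) w (R := R)
    have hmem : ∀ y, y = w + v ∨ y = w + v + e j → y ∉ backSupport R P w := by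
      intro y hy hyb
      refine Set.disjoint_left.1 hdisj hyb ⟨w + v, ?_, ?_⟩
      · rw [add_sub_cancel_left]; exact hqR v hv
      · rw [translate_bondPattern]; simpa using hy
    have hdep : DependsOn (fun η => h j w η * (chi u w / chi u (w + v))) (backSupport R P w) := by
      intro η ξ hηξ
      have := dependsOn_sum_back (u := u) (B := P) (hαR j w) hηξ
      simp only [hh] at this ⊢
      rw [this]
    refine (integralProd_mul_bondCurrent_le hu (ne_add_unitVec (by omega) j _) hdep
      (hmem _ (Or.inl rfl)) (hmem _ (Or.inr rfl)) hf.1 hβ (hreg.le_edge _ j)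
      (hreg.one_sub_le_edge _ j)).trans ?_
    have hr : integralProd u (fun η => (h j w η * (chi u w / chi u (w + v))) ^ 2 * f η)
        ≤ θ ^ 2 * integralProd u (fun η => h j w η ^ 2 * f η) := by
      rw [← integralProd_const_mul]
      refine integralProd_mono hu fun η => ?_
      have c1 := chi_pos hu w
      have c2 := chi_pos hu (w + v)
      have h3 : chi u w / chi u (w + v) ≤ θ := (div_le_iff₀ c2).2 (hreg.chi_le w v (hqR v hv))
      have h4 : (chi u w / chi u (w + v)) ^ 2 ≤ θ ^ 2 :=
        pow_le_pow_left₀ (by positivity) h3 2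
      have h5 := mul_le_mul_of_nonneg_right h4 (mul_nonneg (sq_nonneg (h j w η)) (hf.1 η))
      calc _ = (chi u w / chi u (w + v)) ^ 2 * (h j w η ^ 2 * f η) := by ring
        _ ≤ _ := h5
    have h6 := mul_le_mul_of_nonneg_left hr (show 0 ≤ θ / β by positivity)
    have h7 : θ / β * (θ ^ 2 * integralProd u (fun η => h j w η ^ 2 * f η))
        = θ ^ 3 / β * integralProd u (fun η => h j w η ^ 2 * f η) := by ring
    rw [h7] at h6
    linarith
  have hsumA : ∑ j, ∑ w, ∑ v, q v * integralProd u (fun η => h j w η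
            * (chi u w / chi u (w + v))
            * (chi u (w + v) * bondCurrent u (w + v) (w + v + e j) η) * f η)
      ≤ 2 * θ * β * exclusionForm u f + d * (θ ^ 3 / β * (4 * colors d D ^ 2 * S
            * (colors d (R + D) * entropy u f + (N : ℝ) ^ d))) := by
    refine (Finset.sum_le_sum fun j _ => Finset.sum_le_sum fun w _ =>
      Finset.sum_le_sum fun v _ => hA j w v).trans ?_
    have hj : ∀ j, ∑ w, ∑ v, q v * (θ * β * integralProd u
          (fun η => (√(f (exchange (w + v) (w + v + e j) η)) - √(f η)) ^ 2)
        + θ ^ 3 / β * integralProd u (fun η => h j w η ^ 2 * f η))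
        ≤ θ * β * ∑ z, integralProd u (fun η => (√(f (exchange z (z + e j) η)) - √(f η)) ^ 2)
          + θ ^ 3 / β * (4 * colors d D ^ 2 * S
            * (colors d (R + D) * entropy u f + (N : ℝ) ^ d)) := by
      intro j
      have e1 : ∀ v, ∑ w, integralProd u
            (fun η => (√(f (exchange (w + v) (w + v + e j) η)) - √(f η)) ^ 2)
          = ∑ z, integralProd u (fun η => (√(f (exchange z (z + e j) η)) - √(f η)) ^ 2) :=
        fun v => Equiv.sum_comp (Equiv.addRight v)
          fun z => integralProd u (fun η => (√(f (exchange z (z + e j) η)) - √(f η)) ^ 2)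
      have e2 : ∑ w, ∑ v, q v * (θ * β * integralProd u
          (fun η => (√(f (exchange (w + v) (w + v + e j) η)) - √(f η)) ^ 2)
        + θ ^ 3 / β * integralProd u (fun η => h j w η ^ 2 * f η))
        = ∑ v, q v * (θ * β * ∑ w, integralProd u
          (fun η => (√(f (exchange (w + v) (w + v + e j) η)) - √(f η)) ^ 2)
        + θ ^ 3 / β * ∑ w, integralProd u (fun η => h j w η ^ 2 * f η)) := by
        rw [Finset.sum_comm]
        refine Finset.sum_congr rfl fun v _ => ?_
        rw [← Finset.mul_sum, Finset.sum_add_distrib, ← Finset.mul_sum, ← Finset.mul_sum]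
      rw [e2]
      simp_rw [e1]
      rw [← Finset.sum_mul, hq1, one_mul]
      have := sum_integralProd_sq_le hu hf hPne hPD (hαR j) hS0 (hαS j)
      have h3 : 0 ≤ θ ^ 3 / β := by positivity
      gcongr
    refine (Finset.sum_le_sum fun j _ => hj j).trans (le_of_eq ?_)
    rw [Finset.sum_add_distrib, ← Finset.mul_sum, Finset.sum_const, Finset.card_univ,
      Fintype.card_fin, nsmul_eq_mul]
    unfold exclusionForm
    ring
  have hsumB : ∑ j, ∑ w, integralProd u (fun η => h j w η
          * (∑ z, γ j w z * omega u (translate z (bondPattern j)) η) * f η)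
      ≤ d * (colors d (R + D) / κ * entropy u f
            + (N : ℝ) ^ d * (colors d D ^ 4 * (κ * S * S'))) := by
    have hj := fun j => sum_integralProd_mul_le hu hf hPne
      (show (bondPattern j).Nonempty from ⟨0, by simp [bondPattern]⟩) hP hPD
      (bondPattern_nonneg j) (bondPattern_abs_le j hD) hN (hαR j) (hγR j) hS0.le hS'0 (hαS j)
      (hγS j) hκ hκS
    refine (Finset.sum_le_sum fun j _ => hj j).trans (le_of_eq ?_)
    rw [Finset.sum_const, Finset.card_univ, Fintype.card_fin, nsmul_eq_mul]
  have hexp : integralProd u (fun η =>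
        (smoothed u G P q η - smoothed u G P (conv (boxWeight m) q) η) * f η)
      = (∑ j, ∑ w, ∑ v, q v * integralProd u (fun η => h j w η
            * (chi u w / chi u (w + v))
            * (chi u (w + v) * bondCurrent u (w + v) (w + v + e j) η) * f η))
        + ∑ j, ∑ w, integralProd u (fun η => h j w η
          * (∑ z, γ j w z * omega u (translate z (bondPattern j)) η) * f η) := by
    have e1 : (fun η => (smoothed u G P q η - smoothed u G P (conv (boxWeight m) q) η) * f η)
        = fun η => ∑ j, ∑ w, ((∑ v, q v * (h j w η * (chi u w / chi u (w + v))
            * (chi u (w + v) * bondCurrent u (w + v) (w + v + e j) η) * f η))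
          + h j w η * (∑ z, γ j w z * omega u (translate z (bondPattern j)) η) * f η) := by
      funext η
      rw [hpt η, Finset.sum_mul]
      refine Finset.sum_congr rfl fun j _ => ?_
      rw [Finset.sum_mul]
      refine Finset.sum_congr rfl fun w _ => ?_
      rw [add_mul, Finset.sum_mul]
      simp only [mul_assoc]
    rw [e1, integralProd_sum, ← Finset.sum_add_distrib]
    refine Finset.sum_congr rfl fun j _ => ?_
    rw [integralProd_sum, ← Finset.sum_add_distrib]
    refine Finset.sum_congr rfl fun w _ => ?_
    rw [integralProd_add, integralProd_sum]
    simp_rw [integralProd_const_mul]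
  rw [hexp]
  exact add_le_add hsumA hsumB

/-- The fully smoothed observable: both factors are averages over cubes of side `m`. -/
lemma integralProd_smoothed_conv_le {θ ε Γ : ℝ} {R m D : ℕ}
    (hreg : RegularProfile u θ ε R) {f : Config d N → ℝ} (hf : IsDensity u f)
    {P : Finset (Fin d → ℤ)} (hPne : P.Nonempty) (hP : ∀ b ∈ P, ∃ i, b i < 0)
    (hPD : ∀ b ∈ P, ∀ i, |b i| ≤ D) (hN : 2 * (R + D) + 1 ≤ N)
    (hm : 0 < m) (hmR : m ≤ R) {G : Torus d N → ℝ} (hG : ∀ x, |G x| ≤ Γ)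
    {q : Torus d N → ℝ} {Q : ℝ}
    (hq0 : ∀ v, 0 ≤ q v) (hq1 : ∑ v, q v = 1) (hqQ : ∀ v, q v ≤ Q)
    (hqR : ∀ v, q v ≠ 0 → InBox R v) {κ S S' : ℝ} (hκ : 0 < κ)
    (hSdef : S = (θ * Γ) ^ 2 * (1 / (m : ℝ)) ^ d) (hS'def : S' = θ ^ 2 * Q)
    (hκS : colors d D ^ 4 * (κ ^ 2 * S * S') ≤ 1 / 2) :
    integralProd u (fun η => smoothed u G P (conv (boxWeight m) q) η * f η)
      ≤ colors d (R + D) / κ * entropy u f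
            + (N : ℝ) ^ d * (colors d D ^ 4 * (κ * S * S')) := by
  have hu := hreg.mem_Ioo
  have hQ0 : 0 ≤ Q := (hq0 0).trans (hqQ 0)
  set α : Torus d N → Torus d N → ℝ :=
    fun w x => boxWeight m (w - x) * G x * (chi u x / chi u w) with hα
  set γ : Torus d N → Torus d N → ℝ := fun w z => q (z - w) * (chi u w / chi u z) with hγ
  have hpR : ∀ y : Torus d N, boxWeight m y ≠ 0 → InBox R y := fun y hy i =>
    (inBox_of_boxWeight_ne_zero hy i).trans (by omega)
  have hαS : ∀ w, ∑ x, α w x ^ 2 ≤ S := by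
    intro w
    rw [hSdef]
    refine sum_flow_coeff_sq_le hreg hG (boxWeight m) hpR ?_ w
    calc ∑ y : Torus d N, boxWeight m y ^ 2
        ≤ ∑ y : Torus d N, (1 / (m : ℝ)) ^ d * boxWeight m y := by
          refine Finset.sum_le_sum fun y _ => ?_
          rw [sq]
          exact mul_le_mul_of_nonneg_right (boxWeight_le m y) (boxWeight_nonneg m y)
      _ = _ := by rw [← Finset.mul_sum, sum_boxWeight hm (by omega), mul_one]
  have hγS : ∀ w, ∑ z, γ w z ^ 2 ≤ S' := by
    intro w
    rw [hS'def]
    refine sum_sq_le_of_abs_le w hq0 hq1 hqQ fun z => ?_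
    by_cases hz : q (z - w) = 0
    · simp [hγ, hz]
    · have h1 := hreg.chi_le w (z - w) (hqR _ hz)
      rw [add_sub_cancel] at h1
      have c1 := chi_pos hu w
      have c2 := chi_pos hu z
      have h3 : chi u w / chi u z ≤ θ := (div_le_iff₀ c2).2 h1
      simp only [hγ]
      rw [abs_mul, abs_of_nonneg (hq0 _), abs_of_pos (by positivity), mul_comm]
      exact mul_le_mul_of_nonneg_right h3 (hq0 _)
  have hpt : ∀ η, smoothed u G P (conv (boxWeight m) q) η
      = ∑ w, (∑ x, α w x * omega u (translate x P) η)
        * ∑ z, γ w z * omega u (translate z {0}) η := by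
    intro η
    unfold smoothed
    have e1 : ∀ s, ∑ v, conv (boxWeight m) q v * omegaHat u (s + v) η
        = ∑ w, boxWeight m (w - s) * ∑ v, q v * omegaHat u (w + v) η := by
      intro s
      rw [sum_conv_mul _ _ (fun x => omegaHat u x η),
        ← Equiv.sum_comp (Equiv.addLeft s)
          fun w => boxWeight m (w - s) * ∑ v, q v * omegaHat u (w + v) η]
      simp
    simp_rw [e1]
    simp_rw [Finset.mul_sum (s := (Finset.univ : Finset (Torus d N)))
      (f := fun w => boxWeight m (w - _) * ∑ v, q v * omegaHat u (w + v) η)]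
    rw [Finset.sum_comm]
    refine Finset.sum_congr rfl fun w _ => ?_
    have cw := (chi_pos hu w).ne'
    have e2 : ∑ z, γ w z * omega u (translate z {0}) η
        = chi u w * ∑ v, q v * omegaHat u (w + v) η := by
      rw [← Equiv.sum_comp (Equiv.addLeft w), Finset.mul_sum]
      refine Finset.sum_congr rfl fun v _ => ?_
      simp only [Equiv.coe_addLeft, hγ, add_sub_cancel_left]
      have : translate (w + v) ({0} : Finset (Fin d → ℤ)) = {w + v} := by
        rw [translate, Finset.image_singleton]
        simp
        rfl
      rw [this, omega, Finset.prod_singleton, omegaHat]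
      ring
    rw [e2, Finset.sum_mul]
    refine Finset.sum_congr rfl fun x _ => ?_
    simp only [hα]
    field_simp
  simp_rw [hpt, Finset.sum_mul (s := (Finset.univ : Finset (Torus d N)))
    (f := fun w => (∑ x, α w x * omega u (translate x P) _)
        * ∑ z, γ w z * omega u (translate z {0}) _)]
  rw [integralProd_sum]
  refine sum_integralProd_mul_le hu hf hPne (Finset.singleton_nonempty 0) hP hPD
    (by simp) (by simp) hN
    (fun w x hx => hpR _ (left_ne_zero_of_mul (left_ne_zero_of_mul hx)))
    (fun w z hz => hqR _ (left_ne_zero_of_mul hz)) ?_ ?_ hαS hγS hκ hκS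
  · rw [hSdef]; positivity
  · rw [hS'def]; positivity

end Step

/-! ### Regularity of two-layer profiles -/

section Profile

variable {γ K : ℝ} {ρ : ℝ → ℝ}

lemma deriv_deriv_nonpos_of_isLocalMax {g : ℝ → ℝ} {t : ℝ} (hc : ContinuousAt g t)
    (h : IsLocalMax g t) : deriv (deriv g) t ≤ 0 := by
  by_contra! hpos
  have hmin := isLocalMin_of_deriv_deriv_pos hpos h.deriv_eq_zero hc
  have heq : g =ᶠ[nhds t] fun _ => g t := by
    filter_upwards [h, hmin] with s hs hs'
    exact le_antisymm hs hs'
  have h1 : deriv g =ᶠ[nhds t] fun _ => 0 := by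
    have := heq.deriv
    simpa using this
  have h2 := h1.deriv_eq
  simp at h2
  linarith

lemma deriv_deriv_nonneg_of_isLocalMin {g : ℝ → ℝ} {t : ℝ} (hc : ContinuousAt g t)
    (h : IsLocalMin g t) : 0 ≤ deriv (deriv g) t := by
  have := deriv_deriv_nonpos_of_isLocalMax hc.neg h.neg
  have e : deriv (fun s => -g s) = fun s => -deriv g s := by
    funext s; exact deriv.fun_neg
  rw [show (-g) = fun s => -g s from rfl, e, deriv.fun_neg] at this
  linarith

lemma IsTwoLayerProfile.sqrt_pos (h : IsTwoLayerProfile γ K ρ) : 0 < √K := by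
  rcases (Real.sqrt_nonneg K).eq_or_lt with h0 | h0
  · have := h.two_layers
    rw [← h0] at this
    simp at this
  · exact h0

lemma IsTwoLayerProfile.pos (h : IsTwoLayerProfile γ K ρ) : 0 < K := Real.sqrt_pos.1 h.sqrt_pos

lemma IsTwoLayerProfile.exists_isMax (h : IsTwoLayerProfile γ K ρ) : ∃ t, ∀ s, ρ s ≤ ρ t := by
  obtain ⟨t, _, ht⟩ := isCompact_Icc.exists_isMaxOn (Set.nonempty_Icc.2 h.sqrt_pos.le)
    (h.contDiff.continuous.continuousOn (s := Set.Icc 0 (√K)))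
  refine ⟨t, fun s => ?_⟩
  obtain ⟨s', hs', hs⟩ := h.periodic.exists_mem_Ico₀ h.sqrt_pos s
  rw [hs]
  exact ht ⟨hs'.1, hs'.2.le⟩

lemma IsTwoLayerProfile.exists_isMin (h : IsTwoLayerProfile γ K ρ) : ∃ t, ∀ s, ρ t ≤ ρ s := by
  obtain ⟨t, _, ht⟩ := isCompact_Icc.exists_isMinOn (Set.nonempty_Icc.2 h.sqrt_pos.le)
    (h.contDiff.continuous.continuousOn (s := Set.Icc 0 (√K)))
  refine ⟨t, fun s => ?_⟩
  obtain ⟨s', hs', hs⟩ := h.periodic.exists_mem_Ico₀ h.sqrt_pos s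
  rw [hs]
  exact ht ⟨hs'.1, hs'.2.le⟩

/-- Maximum principle: the profile stays between the two minima of the potential. -/
lemma IsTwoLayerProfile.sq_le (h : IsTwoLayerProfile γ K ρ) (hγ : 1 / 2 < γ) (t : ℝ) :
    γ ^ 2 * (2 * ρ t - 1) ^ 2 ≤ 2 * γ - 1 := by
  obtain ⟨a, ha⟩ := h.exists_isMax
  obtain ⟨b, hb⟩ := h.exists_isMin
  have hca := deriv_deriv_nonpos_of_isLocalMax h.contDiff.continuous.continuousAt
    (Filter.Eventually.of_forall ha : IsLocalMax ρ a)
  have hcb := deriv_deriv_nonneg_of_isLocalMin h.contDiff.continuous.continuousAt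
    (Filter.Eventually.of_forall hb : IsLocalMin ρ b)
  rw [h.equation] at hca hcb
  unfold potentialDeriv at hca hcb
  have ha0 := ha 0
  have hb0 := hb 0
  rw [h.at_zero] at ha0 hb0
  have hat := ha t
  have hbt := hb t
  have hγ2 : 0 < γ ^ 2 := by positivity
  have hA : γ ^ 2 * (2 * ρ a - 1) ^ 2 ≤ 2 * γ - 1 := by
    by_contra! hcon
    have hpos : 0 < 2 * ρ a - 1 := by
      rcases (show 0 ≤ 2 * ρ a - 1 by linarith).eq_or_lt with h0 | h0
      · rw [← h0] at hcon; linarith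
      · exact h0
    nlinarith
  have hB : γ ^ 2 * (2 * ρ b - 1) ^ 2 ≤ 2 * γ - 1 := by
    by_contra! hcon
    have hneg : 2 * ρ b - 1 < 0 := by
      rcases (show 2 * ρ b - 1 ≤ 0 by linarith).eq_or_lt with h0 | h0
      · rw [h0] at hcon; linarith
      · exact h0
    nlinarith
  rcases le_total 0 (2 * ρ t - 1) with h0 | h0
  · refine le_trans (mul_le_mul_of_nonneg_left ?_ hγ2.le) hA
    exact pow_le_pow_left₀ h0 (by linarith) 2
  · refine le_trans (mul_le_mul_of_nonneg_left ?_ hγ2.le) hB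
    nlinarith

/-- Conservation of energy. -/
lemma IsTwoLayerProfile.energy (h : IsTwoLayerProfile γ K ρ) (s t : ℝ) :
    deriv ρ s ^ 2 + (2 * γ - 1) * (2 * ρ s - 1) ^ 2 / 2 - γ ^ 2 * (2 * ρ s - 1) ^ 4 / 4
      = deriv ρ t ^ 2 + (2 * γ - 1) * (2 * ρ t - 1) ^ 2 / 2 - γ ^ 2 * (2 * ρ t - 1) ^ 4 / 4 := by
  have hd1 : ∀ x, HasDerivAt ρ (deriv ρ x) x := fun x =>
    ((h.contDiff.differentiable (by norm_num)) x).hasDerivAt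
  have hc1 : ContDiff ℝ 1 (deriv ρ) := by
    have := h.contDiff
    rw [show (2 : WithTop ℕ∞) = 1 + 1 by norm_num, contDiff_succ_iff_deriv] at this
    exact this.2.2
  have hd2 : ∀ x, HasDerivAt (deriv ρ) (potentialDeriv γ (ρ x)) x := fun x => by
    have := ((hc1.differentiable (by norm_num)) x).hasDerivAt
    rwa [h.equation] at this
  have hU : ∀ x, HasDerivAt (fun y => 2 * ρ y - 1) (2 * deriv ρ x) x := fun x =>
    ((hd1 x).const_mul 2).sub_const 1
  have hE : ∀ x, HasDerivAt (fun y => deriv ρ y ^ 2 + (2 * γ - 1) * (2 * ρ y - 1) ^ 2 / 2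
      - γ ^ 2 * (2 * ρ y - 1) ^ 4 / 4) 0 x := by
    intro x
    have := (((hd2 x).pow 2).add ((((hU x).pow 2).const_mul (2 * γ - 1)).div_const 2)).sub
      ((((hU x).pow 4).const_mul (γ ^ 2)).div_const 4)
    refine this.congr_deriv ?_
    unfold potentialDeriv
    push_cast
    ring
  exact is_const_of_deriv_eq_zero (fun x => (hE x).differentiableAt) (fun x => (hE x).deriv) s t

/-- The logarithmic derivatives of `ρ` and `1 - ρ` are bounded uniformly in the period. For
`γ = 1` this is the only information available, since then `ρ` is not bounded away from `0`
and `1` as the period grows. -/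
lemma IsTwoLayerProfile.abs_deriv_le (h : IsTwoLayerProfile γ K ρ) (hγ : 1 / 2 < γ)
    (hγ' : γ ≤ 1) (t : ℝ) : |deriv ρ t| ≤ 2 * (ρ t * (1 - ρ t)) := by
  obtain ⟨a, ha⟩ := h.exists_isMax
  have hda : deriv ρ a = 0 :=
    IsLocalMax.deriv_eq_zero (Filter.Eventually.of_forall ha : IsLocalMax ρ a)
  have hen := h.energy t a
  rw [hda] at hen
  have hm := h.mem_Ioo t
  have hsq := h.sq_le hγ t
  have hx : 0 < ρ t * (1 - ρ t) := mul_pos hm.1 (by linarith [hm.2])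
  refine abs_le_of_sq_le_sq ?_ (by positivity)
  set U := 2 * ρ t - 1 with hUdef
  set W := 2 * ρ a - 1
  have hχ : 4 * (ρ t * (1 - ρ t)) = 1 - U ^ 2 := by rw [hUdef]; ring
  have h1 : 4 * γ ^ 2 * deriv ρ t ^ 2 ≤ (2 * γ - 1 - γ ^ 2 * U ^ 2) ^ 2 := by
    have h2 : 0 ≤ (2 * γ - 1 - γ ^ 2 * W ^ 2) ^ 2 := sq_nonneg _
    have e : 4 * γ ^ 2 * deriv ρ t ^ 2
      = (2 * γ - 1 - γ ^ 2 * U ^ 2) ^ 2 - (2 * γ - 1 - γ ^ 2 * W ^ 2) ^ 2 := by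
      linear_combination 4 * γ ^ 2 * hen
    linarith
  have h3 : 2 * γ - 1 - γ ^ 2 * U ^ 2 ≤ γ ^ 2 * (1 - U ^ 2) := by
    nlinarith [sq_nonneg (γ - 1)]
  have h4 : (2 * γ - 1 - γ ^ 2 * U ^ 2) ^ 2 ≤ (γ ^ 2 * (1 - U ^ 2)) ^ 2 :=
    pow_le_pow_left₀ (by linarith) h3 2
  have h5 : 4 * γ ^ 2 * deriv ρ t ^ 2 ≤ 4 * γ ^ 2 * (4 * γ ^ 2 * (ρ t * (1 - ρ t)) ^ 2) := by
    refine (h1.trans h4).trans (le_of_eq ?_)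
    rw [← hχ]; ring
  have h6 : deriv ρ t ^ 2 ≤ 4 * γ ^ 2 * (ρ t * (1 - ρ t)) ^ 2 :=
    le_of_mul_le_mul_left h5 (by positivity)
  have h7 : γ ^ 2 ≤ 1 := by nlinarith
  calc deriv ρ t ^ 2 ≤ 4 * γ ^ 2 * (ρ t * (1 - ρ t)) ^ 2 := h6
    _ ≤ 4 * 1 * (ρ t * (1 - ρ t)) ^ 2 := by gcongr
    _ = _ := by ring

/-- A positive function whose logarithmic derivative is at most `2`. -/
lemma le_exp_mul_of_abs_deriv_le {g : ℝ → ℝ} (hg : Differentiable ℝ g) (hpos : ∀ t, 0 < g t)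
    (hd : ∀ t, |deriv g t| ≤ 2 * g t) (s t : ℝ) : g s ≤ Real.exp (2 * |s - t|) * g t := by
  have hlog : ∀ x, HasDerivAt (fun y => Real.log (g y)) (deriv g x / g x) x := fun x =>
    (hg x).hasDerivAt.log (hpos x).ne'
  have h := Convex.norm_image_sub_le_of_norm_deriv_le (f := fun y => Real.log (g y))
    (C := 2) (s := Set.univ) (x := t) (y := s) (fun x _ => (hlog x).differentiableAt)
    (fun x _ => by
      rw [(hlog x).deriv, Real.norm_eq_abs, abs_div, abs_of_pos (hpos x),
        div_le_iff₀ (hpos x)]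
      exact hd x) convex_univ (Set.mem_univ _) (Set.mem_univ _)
  rw [Real.norm_eq_abs, Real.norm_eq_abs] at h
  have h1 := (abs_le.1 h).2
  calc g s = Real.exp (Real.log (g s)) := (Real.exp_log (hpos s)).symm
    _ ≤ Real.exp (2 * |s - t| + Real.log (g t)) := Real.exp_le_exp.2 (by linarith)
    _ = _ := by rw [Real.exp_add, Real.exp_log (hpos t)]

lemma IsTwoLayerProfile.le_exp_mul (h : IsTwoLayerProfile γ K ρ) (hγ : 1 / 2 < γ)
    (hγ' : γ ≤ 1) (s t : ℝ) : ρ s ≤ Real.exp (2 * |s - t|) * ρ t := by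
  refine le_exp_mul_of_abs_deriv_le (h.contDiff.differentiable (by norm_num))
    (fun t => (h.mem_Ioo t).1) (fun t => (h.abs_deriv_le hγ hγ' t).trans ?_) s t
  have := h.mem_Ioo t
  nlinarith [this.1, this.2]

lemma IsTwoLayerProfile.one_sub_le_exp_mul (h : IsTwoLayerProfile γ K ρ) (hγ : 1 / 2 < γ)
    (hγ' : γ ≤ 1) (s t : ℝ) : 1 - ρ s ≤ Real.exp (2 * |s - t|) * (1 - ρ t) := by
  have hd := h.contDiff.differentiable (n := 2) (by norm_num)
  refine le_exp_mul_of_abs_deriv_le (g := fun t => 1 - ρ t) (hd.const_sub 1)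
    (fun t => by linarith [(h.mem_Ioo t).2]) (fun t => ?_) s t
  rw [deriv_const_sub, abs_neg]
  refine (h.abs_deriv_le hγ hγ' t).trans ?_
  have := h.mem_Ioo t
  nlinarith [this.1, this.2]

lemma IsTwoLayerProfile.mul_one_sub_le (h : IsTwoLayerProfile γ K ρ) (hγ : 1 / 2 < γ)
    (hγ' : γ ≤ 1) (s t : ℝ) :
    ρ s * (1 - ρ s) ≤ Real.exp (4 * |s - t|) * (ρ t * (1 - ρ t)) := by
  have h1 := h.le_exp_mul hγ hγ' s t
  have h2 := h.one_sub_le_exp_mul hγ hγ' s t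
  have hs := h.mem_Ioo s
  have ht := h.mem_Ioo t
  calc _ ≤ (Real.exp (2 * |s - t|) * ρ t) * (Real.exp (2 * |s - t|) * (1 - ρ t)) :=
        mul_le_mul h1 h2 (by linarith [hs.2]) (mul_nonneg (Real.exp_pos _).le ht.1.le)
    _ = _ := by
        rw [show (4 : ℝ) * |s - t| = 2 * |s - t| + 2 * |s - t| by ring, Real.exp_add]
        ring

lemma IsTwoLayerProfile.abs_sub_le (h : IsTwoLayerProfile γ K ρ) (hγ : 1 / 2 < γ)
    (hγ' : γ ≤ 1) (s t : ℝ) :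
    |ρ s - ρ t| ≤ 2 * Real.exp (4 * |s - t|) * |s - t| * (ρ t * (1 - ρ t)) := by
  have hd := h.contDiff.differentiable (n := 2) (by norm_num)
  have hm := Convex.norm_image_sub_le_of_norm_deriv_le (f := ρ)
    (C := 2 * (Real.exp (4 * |s - t|) * (ρ t * (1 - ρ t)))) (s := Set.uIcc t s) (x := t) (y := s)
    (fun x _ => hd x) (fun x hx => by
      rw [Real.norm_eq_abs]
      refine (h.abs_deriv_le hγ hγ' x).trans ?_
      refine mul_le_mul_of_nonneg_left ((h.mul_one_sub_le hγ hγ' x t).trans ?_) (by norm_num)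
      have := h.mem_Ioo t
      refine mul_le_mul_of_nonneg_right (Real.exp_le_exp.2 ?_)
        (mul_nonneg this.1.le (by linarith [this.2]))
      have := Set.abs_sub_left_of_mem_uIcc hx
      linarith) (convex_uIcc t s) Set.left_mem_uIcc Set.right_mem_uIcc
  rw [Real.norm_eq_abs, Real.norm_eq_abs] at hm
  refine hm.trans (le_of_eq ?_)
  ring

end Profile

/-! ### Regularity of the discrete profile -/

section DiscreteProfile

variable {d N : ℕ} [NeZero N] [NeZero d] {γ K : ℝ} {ρ : ℝ → ℝ}

/-- Translations of the discrete profile, including those which wrap around the torus. -/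
lemma discreteProfile_add (h : IsTwoLayerProfile γ K ρ) (w v : Torus d N) :
    discreteProfile d N K ρ (w + v)
      = ρ (((w 0).val : ℝ) * √K / N + ((v 0).val : ℝ) * √K / N) := by
  have hN : (N : ℝ) ≠ 0 := by exact_mod_cast NeZero.ne N
  unfold discreteProfile
  rw [Pi.add_apply]
  rcases lt_or_ge ((w 0).val + (v 0).val) N with hlt | hge
  · rw [ZMod.val_add_of_lt hlt]
    congr 1
    push_cast
    ring
  · rw [ZMod.val_add_of_le hge, ← h.periodic]
    congr 1
    rw [Nat.cast_sub hge]
    push_cast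
    field_simp
    ring

lemma val_unitVec_le (j : Fin d) (i : Fin d) : (unitVec d N j i).val ≤ 1 := by
  by_cases h : i = j
  · subst h
    simp only [unitVec, Pi.single_eq_same]
    rcases Nat.lt_or_ge 1 N with h1 | h1
    · have : Fact (1 < N) := ⟨h1⟩
      rw [ZMod.val_one]
    · have := ZMod.val_lt (1 : ZMod N)
      omega
  · simp [unitVec, h]

/-- The discrete profile is regular on the scale `R` as soon as `R` is at most of the order of
the width `N / √K` of the transition layers. -/
lemma regularProfile_discreteProfile (h : IsTwoLayerProfile γ K ρ) (hγ : 1 / 2 < γ)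
    (hγ' : γ ≤ 1) {R : ℕ} {c : ℝ} (hR : 1 ≤ R) (hc : √K / N * R ≤ c) :
    RegularProfile (discreteProfile d N K ρ) (Real.exp (4 * c))
      (2 * Real.exp (4 * c) * (√K / N)) R := by
  have hσ : 0 ≤ √K / N := by positivity
  have hR1 : (1 : ℝ) ≤ R := by exact_mod_cast hR
  have hσc : √K / N ≤ c := by nlinarith
  have hc0 : 0 ≤ c := hσ.trans hσc
  have hval : ∀ w : Torus d N, discreteProfile d N K ρ w = ρ (((w 0).val : ℝ) * √K / N) :=
    fun w => rfl
  have hbox : ∀ v : Torus d N, InBox R v → ((v 0).val : ℝ) * √K / N ≤ c := by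
    intro v hv
    have : ((v 0).val : ℝ) ≤ R := by exact_mod_cast hv 0
    calc _ = √K / N * (v 0).val := by ring
      _ ≤ √K / N * R := mul_le_mul_of_nonneg_left this hσ
      _ ≤ c := hc
  have hedge : ∀ j, ((unitVec d N j 0).val : ℝ) * √K / N ≤ √K / N := by
    intro j
    have : ((unitVec d N j 0).val : ℝ) ≤ 1 := by exact_mod_cast val_unitVec_le (N := N) j 0
    calc _ = √K / N * (unitVec d N j 0).val := by ring
      _ ≤ √K / N * 1 := mul_le_mul_of_nonneg_left this hσ
      _ = _ := mul_one _
  have hnn : ∀ v : Torus d N, 0 ≤ ((v 0).val : ℝ) * √K / N := fun v => by positivity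
  refine ⟨fun x => h.mem_Ioo _, Real.one_le_exp (by positivity), ?_, ?_, ?_, ?_⟩
  · intro w v hv
    unfold chi
    rw [discreteProfile_add h, hval]
    refine (h.mul_one_sub_le hγ hγ' _ _).trans (mul_le_mul_of_nonneg_right
      (Real.exp_le_exp.2 ?_) ?_)
    · rw [sub_add_cancel_left, abs_neg, abs_of_nonneg (hnn v)]
      linarith [hbox v hv]
    · have := h.mem_Ioo (((w 0).val : ℝ) * √K / N + ((v 0).val : ℝ) * √K / N)
      exact mul_nonneg this.1.le (by linarith [this.2])
  · intro w j
    rw [discreteProfile_add h, hval]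
    refine (h.le_exp_mul hγ hγ' _ _).trans (mul_le_mul_of_nonneg_right
      (Real.exp_le_exp.2 ?_) (h.mem_Ioo _).1.le)
    rw [sub_add_cancel_left, abs_neg, abs_of_nonneg (hnn _)]
    linarith [hedge j]
  · intro w j
    rw [discreteProfile_add h, hval]
    refine (h.one_sub_le_exp_mul hγ hγ' _ _).trans (mul_le_mul_of_nonneg_right
      (Real.exp_le_exp.2 ?_) (by linarith [(h.mem_Ioo (((w 0).val : ℝ) * √K / N
        + ((unitVec d N j 0).val : ℝ) * √K / N)).2]))
    rw [sub_add_cancel_left, abs_neg, abs_of_nonneg (hnn _)]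
    linarith [hedge j]
  · intro w j
    unfold chi
    rw [discreteProfile_add h, hval]
    refine (h.abs_sub_le hγ hγ' _ _).trans (mul_le_mul_of_nonneg_right ?_ ?_)
    · rw [sub_add_cancel_left, abs_neg, abs_of_nonneg (hnn _)]
      have h1 := hedge j
      have h2 := hnn (unitVec d N j)
      have h3 : Real.exp (4 * (((unitVec d N j 0).val : ℝ) * √K / N)) ≤ Real.exp (4 * c) :=
        Real.exp_le_exp.2 (by linarith)
      exact mul_le_mul (by linarith) h1 h2 (by positivity)
    · have := h.mem_Ioo (((w 0).val : ℝ) * √K / N + ((unitVec d N j 0).val : ℝ) * √K / N)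
      exact mul_nonneg this.1.le (by linarith [this.2])

end DiscreteProfile

/-! ### Convolutions of weights -/

section Conv

variable {d N : ℕ} [NeZero N]

lemma conv_nonneg {p q : Torus d N → ℝ} (hp : ∀ v, 0 ≤ p v) (hq : ∀ v, 0 ≤ q v) (v : Torus d N) :
    0 ≤ conv p q v :=
  Finset.sum_nonneg fun y _ => mul_nonneg (hp y) (hq _)

lemma sum_conv {p q : Torus d N → ℝ} (hp : ∑ v, p v = 1) (hq : ∑ v, q v = 1) :
    ∑ v, conv p q v = 1 := by
  unfold conv
  rw [Finset.sum_comm]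
  have h : ∀ y, ∑ v, p y * q (v - y) = p y := by
    intro y
    have := Equiv.sum_comp (Equiv.subRight y) q
    simp only [Equiv.subRight_apply] at this
    rw [← Finset.mul_sum, this, hq, mul_one]
  simp_rw [h, hp]

lemma conv_le {p q : Torus d N → ℝ} {Q : ℝ} (hp : ∀ v, p v ≤ Q) (hq0 : ∀ v, 0 ≤ q v)
    (hq : ∑ v, q v = 1) (v : Torus d N) : conv p q v ≤ Q := by
  calc conv p q v ≤ ∑ y, Q * q (v - y) :=
        Finset.sum_le_sum fun y _ => mul_le_mul_of_nonneg_right (hp y) (hq0 _)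
    _ = Q := by
        have := Equiv.sum_comp (Equiv.subLeft v) q
        simp only [Equiv.subLeft_apply] at this
        rw [← Finset.mul_sum, this, hq, mul_one]

lemma inBox_of_conv_ne_zero {p q : Torus d N → ℝ} {a b : ℕ} (hp : ∀ v, p v ≠ 0 → InBox a v)
    (hq : ∀ v, q v ≠ 0 → InBox b v) (v : Torus d N) (hv : conv p q v ≠ 0) :
    InBox (a + b) v := by
  obtain ⟨y, _, hy⟩ := Finset.exists_ne_zero_of_sum_ne_zero hv
  intro i
  have h1 := hp y (left_ne_zero_of_mul hy) i
  have h2 := hq _ (right_ne_zero_of_mul hy) i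
  have h3 := ZMod.val_add_le (y i) ((v - y) i)
  rw [Pi.sub_apply, add_sub_cancel] at h3
  rw [Pi.sub_apply] at h2
  omega

lemma InBox.mono {a b : ℕ} {v : Torus d N} (h : InBox a v) (hab : a ≤ b) : InBox b v :=
  fun i => (h i).trans hab

lemma RegularProfile.mono {u : Torus d N → ℝ} {θ ε : ℝ} {R R' : ℕ}
    (h : RegularProfile u θ ε R) (hR : R' ≤ R) : RegularProfile u θ ε R' where
  mem_Ioo := h.mem_Ioo
  one_le := h.one_le
  chi_le w v hv := h.chi_le w v (hv.mono hR)
  le_edge := h.le_edge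
  one_sub_le_edge := h.one_sub_le_edge
  grad := h.grad

lemma exclusionForm_nonneg {u : Torus d N → ℝ} (hu : ∀ x, u x ∈ Set.Ioo (0 : ℝ) 1)
    (f : Config d N → ℝ) : 0 ≤ exclusionForm u f := by
  unfold exclusionForm
  refine mul_nonneg (by norm_num) (Finset.sum_nonneg fun j _ => Finset.sum_nonneg fun x _ => ?_)
  exact integralProd_nonneg hu fun _ => sq_nonneg _

end Conv

/-! ### Summing up the smoothing steps -/

section Bounds

lemma colors_add_le (d D : ℕ) {m : ℕ} (hm : 0 < m) :
    colors d (2 * m + D) ≤ (10 + 4 * (D : ℝ)) ^ d * (m : ℝ) ^ d := by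
  have h1 : (1 : ℝ) ≤ m := by exact_mod_cast hm
  rw [← mul_pow]
  unfold colors
  refine pow_le_pow_left₀ (by positivity) ?_ d
  push_cast
  nlinarith

set_option maxHeartbeats 1000000 in
/-- The cost of one smoothing step on the scale `m`, when `m ≤ l` and the current weights are at
most `Q`; here `g` stands for the energy of the flow, and `l` is the scale at which the error
is measured. -/
lemma exists_smoothing_step_bound (d D : ℕ) (hD : 1 ≤ D) {θ b : ℝ} (hθ : 1 ≤ θ) (hb : 1 ≤ b) :
    ∃ C : ℝ, 0 ≤ C ∧ ∀ (N : ℕ) [NeZero N] (u : Torus d N → ℝ) (ε K l g Q Γ δ : ℝ) (m : ℕ)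
      (P : Finset (Fin d → ℤ)) (G q : Torus d N → ℝ) (f : Config d N → ℝ),
      RegularProfile u θ ε (2 * m) → IsDensity u f → P.Nonempty → (∀ b ∈ P, ∃ i, b i < 0) →
      (∀ b ∈ P, ∀ i, |b i| ≤ D) → 2 * (2 * m + D) + 1 ≤ N → 0 < m → (∀ x, |G x| ≤ Γ) → 1 ≤ Γ →
      flowEnergy d m ≤ 2 * g → 0 < g → (∀ v, 0 ≤ q v) → ∑ v, q v = 1 → (∀ v, q v ≤ Q) →
      (∀ v, q v ≠ 0 → InBox (2 * m) v) → 1 ≤ K → ε ^ 2 = b ^ 2 * K / (N : ℝ) ^ 2 → (m : ℝ) ≤ l →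
      g * l ^ d ≤ (N : ℝ) ^ 2 → (m : ℝ) ^ d * l ^ d * g * Q ≤ 2 ^ d * (N : ℝ) ^ 2 →
      0 < δ → δ < 1 →
      K * integralProd u (fun η =>
          (smoothed u G P q η - smoothed u G P (conv (boxWeight m) q) η) * f η)
        ≤ δ / 3 * (N : ℝ) ^ 2 * exclusionForm u f
          + C * (1 / δ) * Γ ^ 2 * K ^ 2 * (entropy u f + ((N : ℝ) / l) ^ d) := by
  set k := colors d D
  have hkpos : 0 < k := colors_pos d D
  set A₀ : ℝ := (10 + 4 * (D : ℝ)) ^ d with hA₀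
  have hA₀1 : 1 ≤ A₀ := one_le_pow₀ (by linarith [Nat.cast_nonneg (α := ℝ) D])
  -- `τ` is small enough for the exponential moments at the exponent `τ m ^ d / (Γ K)` to exist
  set τ : ℝ := 1 / (2 * k ^ 2 * θ ^ 2 * 2 ^ (d + 1) * b) with hτ
  refine ⟨24 * d * θ ^ 6 * k ^ 2 * 2 ^ (d + 2) * A₀
    + (d * A₀ / τ + d * k ^ 4 * τ * θ ^ 4 * 2 ^ (2 * d + 2) * b ^ 2), by positivity, ?_⟩
  intro N _ u ε K l g Q Γ δ m P G q f hreg hf hPne hP hPD hN hm hG hΓ hE hg hq0 hq1 hqQ hqR hK hε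
    hml hgl hA hδ hδ1
  have hNpos : (0 : ℝ) < N := by exact_mod_cast Nat.pos_of_ne_zero (NeZero.ne N)
  have hK0 : 0 < K := by linarith
  have hΓ0 : 0 < Γ := by linarith
  have hm0 : (0 : ℝ) < m := by exact_mod_cast hm
  have hl0 : 0 < l := hm0.trans_le hml
  have hQ0 : 0 ≤ Q := (hq0 0).trans (hqQ 0)
  set H := entropy u f
  have hH0 : 0 ≤ H := entropy_nonneg hreg.mem_Ioo hf
  set B := H + ((N : ℝ) / l) ^ d with hB
  have hX0 : 0 ≤ ((N : ℝ) / l) ^ d := by positivity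
  have hNX : (N : ℝ) ^ d = l ^ d * ((N : ℝ) / l) ^ d := by
    rw [← mul_pow, mul_div_cancel₀ _ hl0.ne']
  set S : ℝ := (θ * Γ) ^ 2 * (2 ^ (d + 1) * (2 * g)) with hS
  set S' : ℝ := (ε * θ) ^ 2 * Q with hS'
  set β : ℝ := δ * (N : ℝ) ^ 2 / (6 * θ * K) with hβ
  have hβ0 : 0 < β := by positivity
  set κ : ℝ := τ * (m : ℝ) ^ d / (Γ * K) with hκ
  have hκ0 : 0 < κ := by positivity
  have hSS : S * S' = θ ^ 4 * Γ ^ 2 * 2 ^ (d + 2) * g * b ^ 2 * K * Q / (N : ℝ) ^ 2 := by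
    rw [hS, hS', mul_pow ε θ, hε]
    field_simp
    ring
  have hτ2 : k ^ 4 * θ ^ 4 * 2 ^ (2 * d + 2) * b ^ 2 * τ ^ 2 = 1 / 4 := by
    rw [hτ, show 2 * d + 2 = (d + 1) * 2 by ring, pow_mul]
    field_simp
    norm_num
  have hval : k ^ 4 * (κ ^ 2 * S * S') ≤ 1 / 2 := by
    have e : k ^ 4 * (κ ^ 2 * S * S')
        = k ^ 4 * θ ^ 4 * 2 ^ (d + 2) * b ^ 2 * τ ^ 2
          * ((m : ℝ) ^ d * (m : ℝ) ^ d * g * Q / (N : ℝ) ^ 2) / K := by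
      rw [mul_assoc (κ ^ 2), hSS, hκ]
      field_simp
    have h1 : (m : ℝ) ^ d * (m : ℝ) ^ d * g * Q / (N : ℝ) ^ 2 ≤ 2 ^ d := by
      rw [div_le_iff₀ (by positivity)]
      refine le_trans ?_ hA
      gcongr
    rw [e, div_le_iff₀ hK0]
    calc _ ≤ k ^ 4 * θ ^ 4 * 2 ^ (d + 2) * b ^ 2 * τ ^ 2 * 2 ^ d := by gcongr
      _ = k ^ 4 * θ ^ 4 * 2 ^ (2 * d + 2) * b ^ 2 * τ ^ 2 := by ring
      _ = 1 / 4 := hτ2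
      _ ≤ 1 / 2 * K := by linarith
  have hstep := integralProd_smoothed_sub_le hreg hf hPne hP hPD hD hN hm (by omega) hG hΓ0 hE
    (by positivity) hq0 hq1 hqQ hqR hβ0 hκ0 hS hS' hval
  have hcol := colors_add_le d D hm
  rw [← hA₀] at hcol
  -- the Dirichlet form
  have t1 : K * (2 * θ * β * exclusionForm u f) = δ / 3 * (N : ℝ) ^ 2 * exclusionForm u f := by
    rw [hβ]; field_simp; ring
  -- the squares of the currents
  have t2 : K * (d * (θ ^ 3 / β * (4 * k ^ 2 * S * (colors d (2 * m + D) * H + (N : ℝ) ^ d))))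
      ≤ (24 * d * θ ^ 6 * k ^ 2 * 2 ^ (d + 2) * A₀) * (1 / δ) * Γ ^ 2 * K ^ 2 * B := by
    have h1 : g * (colors d (2 * m + D) * H + (N : ℝ) ^ d) ≤ A₀ * (N : ℝ) ^ 2 * B := by
      calc g * (colors d (2 * m + D) * H + (N : ℝ) ^ d)
          ≤ g * (A₀ * l ^ d * H + A₀ * (l ^ d * ((N : ℝ) / l) ^ d)) := by
            rw [← hNX]
            have h2 : colors d (2 * m + D) * H ≤ A₀ * l ^ d * H :=
              mul_le_mul_of_nonneg_right (hcol.trans (by gcongr)) hH0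
            have h3 : (N : ℝ) ^ d ≤ A₀ * (N : ℝ) ^ d :=
              le_mul_of_one_le_left (by positivity) hA₀1
            exact mul_le_mul_of_nonneg_left (add_le_add h2 h3) hg.le
        _ = A₀ * (g * l ^ d) * B := by rw [hB]; ring
        _ ≤ A₀ * (N : ℝ) ^ 2 * B := by gcongr
    have e : K * (d * (θ ^ 3 / β * (4 * k ^ 2 * S * (colors d (2 * m + D) * H + (N : ℝ) ^ d))))
        = 24 * d * θ ^ 6 * k ^ 2 * 2 ^ (d + 2) * (1 / δ) * Γ ^ 2 * K ^ 2 / (N : ℝ) ^ 2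
          * (g * (colors d (2 * m + D) * H + (N : ℝ) ^ d)) := by
      rw [hβ, hS]
      field_simp
      ring
    rw [e]
    calc _ ≤ 24 * d * θ ^ 6 * k ^ 2 * 2 ^ (d + 2) * (1 / δ) * Γ ^ 2 * K ^ 2 / (N : ℝ) ^ 2
          * (A₀ * (N : ℝ) ^ 2 * B) := mul_le_mul_of_nonneg_left h1 (by positivity)
      _ = _ := by field_simp
  -- the nonlinear corrections
  have hδΓ : Γ ≤ 1 / δ * Γ ^ 2 := by
    have h1 : 1 ≤ 1 / δ := by rw [le_div_iff₀ hδ]; linarith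
    nlinarith
  have t3 : K * (d * (colors d (2 * m + D) / κ * H + (N : ℝ) ^ d * (k ^ 4 * (κ * S * S'))))
      ≤ (d * A₀ / τ + d * k ^ 4 * τ * θ ^ 4 * 2 ^ (2 * d + 2) * b ^ 2) * (1 / δ) * Γ ^ 2
        * K ^ 2 * B := by
    have h1 : K * (d * (colors d (2 * m + D) / κ * H)) ≤ d * A₀ / τ * Γ * K ^ 2 * H := by
      calc K * (d * (colors d (2 * m + D) / κ * H))
          ≤ K * (d * (A₀ * (m : ℝ) ^ d / κ * H)) :=
            mul_le_mul_of_nonneg_left (mul_le_mul_of_nonneg_left (mul_le_mul_of_nonneg_right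
              (div_le_div_of_nonneg_right hcol hκ0.le) hH0) (Nat.cast_nonneg d)) hK0.le
        _ = _ := by rw [hκ]; field_simp
    have h2 : K * (d * ((N : ℝ) ^ d * (k ^ 4 * (κ * S * S'))))
        ≤ d * k ^ 4 * τ * θ ^ 4 * 2 ^ (2 * d + 2) * b ^ 2 * Γ * K ^ 2 * ((N : ℝ) / l) ^ d := by
      have e : K * (d * ((N : ℝ) ^ d * (k ^ 4 * (κ * S * S'))))
          = d * k ^ 4 * τ * θ ^ 4 * 2 ^ (d + 2) * b ^ 2 * Γ * K / (N : ℝ) ^ 2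
            * ((N : ℝ) / l) ^ d * ((m : ℝ) ^ d * l ^ d * g * Q) := by
        rw [mul_assoc κ, hSS, hκ, hNX]
        field_simp
      rw [e]
      calc _ ≤ d * k ^ 4 * τ * θ ^ 4 * 2 ^ (d + 2) * b ^ 2 * Γ * K / (N : ℝ) ^ 2
            * ((N : ℝ) / l) ^ d * (2 ^ d * (N : ℝ) ^ 2) :=
            mul_le_mul_of_nonneg_left hA (by positivity)
        _ = d * k ^ 4 * τ * θ ^ 4 * 2 ^ (2 * d + 2) * b ^ 2 * Γ * K * ((N : ℝ) / l) ^ d := by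
            field_simp
            ring
        _ ≤ d * k ^ 4 * τ * θ ^ 4 * 2 ^ (2 * d + 2) * b ^ 2 * Γ * K ^ 2
              * ((N : ℝ) / l) ^ d := by
            have : K ≤ K ^ 2 := by nlinarith
            gcongr
    have h3 : H ≤ B := by rw [hB]; linarith
    have h4 : ((N : ℝ) / l) ^ d ≤ B := by rw [hB]; linarith
    calc _ = K * (d * (colors d (2 * m + D) / κ * H))
          + K * (d * ((N : ℝ) ^ d * (k ^ 4 * (κ * S * S')))) := by ring
      _ ≤ d * A₀ / τ * Γ * K ^ 2 * B
          + d * k ^ 4 * τ * θ ^ 4 * 2 ^ (2 * d + 2) * b ^ 2 * Γ * K ^ 2 * B :=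
          add_le_add (h1.trans (by gcongr)) (h2.trans (by gcongr))
      _ = (d * A₀ / τ + d * k ^ 4 * τ * θ ^ 4 * 2 ^ (2 * d + 2) * b ^ 2) * Γ * K ^ 2 * B := by
          ring
      _ ≤ (d * A₀ / τ + d * k ^ 4 * τ * θ ^ 4 * 2 ^ (2 * d + 2) * b ^ 2) * (1 / δ * Γ ^ 2)
          * K ^ 2 * B := by gcongr
      _ = _ := by ring
  have hmain := mul_le_mul_of_nonneg_left hstep hK0.le
  rw [mul_add, mul_add, t1] at hmain
  refine hmain.trans ?_
  calc _ ≤ δ / 3 * (N : ℝ) ^ 2 * exclusionForm u f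
        + (24 * d * θ ^ 6 * k ^ 2 * 2 ^ (d + 2) * A₀) * (1 / δ) * Γ ^ 2 * K ^ 2 * B
        + (d * A₀ / τ + d * k ^ 4 * τ * θ ^ 4 * 2 ^ (2 * d + 2) * b ^ 2) * (1 / δ) * Γ ^ 2
        * K ^ 2 * B := add_le_add (add_le_add le_rfl t2) t3
    _ = _ := by ring

/-- The contribution of the fully smoothed observable. -/
lemma exists_smoothed_bound (d D : ℕ) {θ : ℝ} (hθ : 1 ≤ θ) :
    ∃ C : ℝ, 0 ≤ C ∧ ∀ (N : ℕ) [NeZero N] (u : Torus d N → ℝ) (ε K l Γ δ : ℝ) (m : ℕ)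
      (P : Finset (Fin d → ℤ)) (G q : Torus d N → ℝ) (f : Config d N → ℝ),
      RegularProfile u θ ε (2 * m) → IsDensity u f → P.Nonempty → (∀ b ∈ P, ∃ i, b i < 0) →
      (∀ b ∈ P, ∀ i, |b i| ≤ D) → 2 * (2 * m + D) + 1 ≤ N → 0 < m → (∀ x, |G x| ≤ Γ) → 1 ≤ Γ →
      (∀ v, 0 ≤ q v) → ∑ v, q v = 1 → (∀ v, q v ≤ (1 / (m : ℝ)) ^ d) →
      (∀ v, q v ≠ 0 → InBox (2 * m) v) → 1 ≤ K → l / 2 ≤ m → 0 < l → 0 < δ → δ < 1 →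
      K * integralProd u (fun η => smoothed u G P (conv (boxWeight m) q) η * f η)
        ≤ C * (1 / δ) * Γ ^ 2 * K ^ 2 * (entropy u f + ((N : ℝ) / l) ^ d) := by
  set k := colors d D
  have hkpos : 0 < k := colors_pos d D
  set A₀ : ℝ := (10 + 4 * (D : ℝ)) ^ d with hA₀
  set τ : ℝ := 1 / (2 * k ^ 2 * θ ^ 2) with hτ
  refine ⟨A₀ / τ + k ^ 4 * τ * θ ^ 4 * 2 ^ d, by positivity, ?_⟩
  intro N _ u ε K l Γ δ m P G q f hreg hf hPne hP hPD hN hm hG hΓ hq0 hq1 hqQ hqR hK hml hl0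
    hδ hδ1
  have hK0 : 0 < K := by linarith
  have hm0 : (0 : ℝ) < m := by exact_mod_cast hm
  set H := entropy u f
  have hH0 : 0 ≤ H := entropy_nonneg hreg.mem_Ioo hf
  set B := H + ((N : ℝ) / l) ^ d with hB
  have hX0 : 0 ≤ ((N : ℝ) / l) ^ d := by positivity
  set S : ℝ := (θ * Γ) ^ 2 * (1 / (m : ℝ)) ^ d with hS
  set S' : ℝ := θ ^ 2 * (1 / (m : ℝ)) ^ d with hS'
  set κ : ℝ := τ * (m : ℝ) ^ d / Γ with hκ
  have hκ0 : 0 < κ := by positivity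
  have hSS : S * S' = θ ^ 4 * Γ ^ 2 * (1 / (m : ℝ)) ^ d * (1 / (m : ℝ)) ^ d := by
    rw [hS, hS']; ring
  have hval : k ^ 4 * (κ ^ 2 * S * S') ≤ 1 / 2 := by
    have e : k ^ 4 * (κ ^ 2 * S * S') = 1 / 4 := by
      rw [mul_assoc (κ ^ 2), hSS, hκ, hτ, one_div_pow]
      field_simp
      norm_num
    rw [e]; norm_num
  have hstep := integralProd_smoothed_conv_le hreg hf hPne hP hPD hN hm (by omega) hG
    hq0 hq1 hqQ hqR hκ0 hS hS' hval
  have hcol := colors_add_le d D hm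
  rw [← hA₀] at hcol
  have hδΓ : Γ * K ≤ 1 / δ * Γ ^ 2 * K ^ 2 := by
    have h1 : 1 ≤ 1 / δ := by rw [le_div_iff₀ hδ]; linarith
    have h2 : Γ ≤ 1 / δ * Γ ^ 2 := by nlinarith
    have h3 : K ≤ K ^ 2 := by nlinarith
    exact mul_le_mul h2 h3 hK0.le (by positivity)
  have h1 : K * (colors d (2 * m + D) / κ * H) ≤ A₀ / τ * (Γ * K) * H := by
    calc K * (colors d (2 * m + D) / κ * H) ≤ K * (A₀ * (m : ℝ) ^ d / κ * H) := by gcongr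
      _ = _ := by rw [hκ]; field_simp
  have hNm : ((N : ℝ) / m) ^ d ≤ 2 ^ d * ((N : ℝ) / l) ^ d := by
    rw [← mul_pow]
    refine pow_le_pow_left₀ (by positivity) ?_ d
    rw [div_le_iff₀ hm0]
    calc (N : ℝ) = 2 * ((N : ℝ) / l) * (l / 2) := by field_simp
      _ ≤ _ := by gcongr
  have h2 : K * ((N : ℝ) ^ d * (k ^ 4 * (κ * S * S')))
      ≤ k ^ 4 * τ * θ ^ 4 * 2 ^ d * (Γ * K) * ((N : ℝ) / l) ^ d := by
    have e : K * ((N : ℝ) ^ d * (k ^ 4 * (κ * S * S')))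
        = k ^ 4 * τ * θ ^ 4 * (Γ * K) * ((N : ℝ) / m) ^ d := by
      rw [mul_assoc κ, hSS, hκ, one_div_pow, div_pow]
      field_simp
    rw [e]
    calc _ ≤ k ^ 4 * τ * θ ^ 4 * (Γ * K) * (2 ^ d * ((N : ℝ) / l) ^ d) :=
          mul_le_mul_of_nonneg_left hNm (by positivity)
      _ = _ := by ring
  have h3 : H ≤ B := by rw [hB]; linarith
  have h4 : ((N : ℝ) / l) ^ d ≤ B := by rw [hB]; linarith
  have hmain := mul_le_mul_of_nonneg_left hstep hK0.le
  refine hmain.trans ?_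
  calc _ = K * (colors d (2 * m + D) / κ * H)
        + K * ((N : ℝ) ^ d * (k ^ 4 * (κ * S * S'))) := by ring
    _ ≤ A₀ / τ * (Γ * K) * B + k ^ 4 * τ * θ ^ 4 * 2 ^ d * (Γ * K) * B :=
        add_le_add (h1.trans (by gcongr)) (h2.trans (by gcongr))
    _ = (A₀ / τ + k ^ 4 * τ * θ ^ 4 * 2 ^ d) * (Γ * K) * B := by ring
    _ ≤ (A₀ / τ + k ^ 4 * τ * θ ^ 4 * 2 ^ d) * (1 / δ * Γ ^ 2 * K ^ 2) * B := by gcongr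
    _ = _ := by ring

/-- The estimate for the product of `ω_s` and of `ω_{s+P}`. The average is first spread to the
scale `r ≈ √l`, then to the scale `m ≈ l`: after the first step the nonlinear part of
`bondCurrent` is averaged over a cube of side `r`, and this gain compensates for the larger
range of the second step. -/
lemma exists_smoothed_one_bound (d D : ℕ) (hD : 1 ≤ D) {θ b : ℝ} (hθ : 1 ≤ θ) (hb : 1 ≤ b) :
    ∃ C : ℝ, 0 ≤ C ∧ ∀ (N : ℕ) [NeZero N] (u : Torus d N → ℝ) (ε K l g Γ δ : ℝ) (r m : ℕ)
      (P : Finset (Fin d → ℤ)) (G : Torus d N → ℝ) (f : Config d N → ℝ),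
      RegularProfile u θ ε (2 * m) → IsDensity u f → P.Nonempty → (∀ b ∈ P, ∃ i, b i < 0) →
      (∀ b ∈ P, ∀ i, |b i| ≤ D) → 2 * (2 * m + D) + 1 ≤ N → 0 < r → r ≤ m →
      (∀ x, |G x| ≤ Γ) → 1 ≤ Γ →
      flowEnergy d r ≤ 2 * g → flowEnergy d m ≤ 2 * g → 0 < g →
      1 ≤ K → ε ^ 2 = b ^ 2 * K / (N : ℝ) ^ 2 → (m : ℝ) ≤ l → l / 2 ≤ m →
      g * l ^ d ≤ (N : ℝ) ^ 2 → (r : ℝ) ^ d * l ^ d * g ≤ 2 ^ d * (N : ℝ) ^ 2 →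
      (m : ℝ) ^ d * l ^ d * g * (1 / (r : ℝ)) ^ d ≤ 2 ^ d * (N : ℝ) ^ 2 →
      0 < δ → δ < 1 →
      K * integralProd u (fun η => smoothed u G P (boxWeight 1) η * f η)
        ≤ δ * (N : ℝ) ^ 2 * exclusionForm u f
          + C * (1 / δ) * Γ ^ 2 * K ^ 2 * (entropy u f + ((N : ℝ) / l) ^ d) := by
  obtain ⟨C₁, hC₁, h₁⟩ := exists_smoothing_step_bound d D hD hθ hb
  obtain ⟨C₂, hC₂, h₂⟩ := exists_smoothed_bound d D hθ
  refine ⟨3 * C₁ + C₂, by positivity, ?_⟩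
  intro N _ u ε K l g Γ δ r m P G f hreg hf hPne hP hPD hN hr hrm hG hΓ hEr hEm hg hK hε hml hlm
    hgl hAr hAm hδ hδ1
  have hm : 0 < m := hr.trans_le hrm
  have hm0 : (0 : ℝ) < m := by exact_mod_cast hm
  have hr0 : (0 : ℝ) < r := by exact_mod_cast hr
  have hl0 : 0 < l := hm0.trans_le hml
  have hrl : (r : ℝ) ≤ l := le_trans (by exact_mod_cast hrm) hml
  set p : ℕ → Torus d N → ℝ := fun k => boxWeight k
  have hp1 : ∀ k, 0 < k → k ≤ m → ∑ v, p k v = 1 := fun k hk hkm => sum_boxWeight hk (by omega)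
  have hp0 : ∀ k v, 0 ≤ p k v := fun k v => boxWeight_nonneg k v
  set q₀ := p 1
  set q₁ := conv (p r) q₀
  set q₂ := conv (p m) q₁
  set q₃ := conv (p m) q₂
  have s0 : ∑ v, q₀ v = 1 := hp1 1 one_pos hm
  have s1 : ∑ v, q₁ v = 1 := sum_conv (hp1 r hr hrm) s0
  have s2 : ∑ v, q₂ v = 1 := sum_conv (hp1 m hm le_rfl) s1
  have n0 : ∀ v, 0 ≤ q₀ v := hp0 1
  have n1 : ∀ v, 0 ≤ q₁ v := conv_nonneg (hp0 r) n0
  have n2 : ∀ v, 0 ≤ q₂ v := conv_nonneg (hp0 m) n1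
  have b0 : ∀ v, q₀ v ≤ 1 := fun v => by simpa using boxWeight_le 1 v
  have b1 : ∀ v, q₁ v ≤ (1 / (r : ℝ)) ^ d := conv_le (boxWeight_le r) n0 s0
  have b2 : ∀ v, q₂ v ≤ (1 / (m : ℝ)) ^ d := conv_le (boxWeight_le m) n1 s1
  have hrm' : (1 / (m : ℝ)) ^ d ≤ (1 / (r : ℝ)) ^ d :=
    pow_le_pow_left₀ (by positivity) (one_div_le_one_div_of_le hr0 (by exact_mod_cast hrm)) d
  have i0 : ∀ v, q₀ v ≠ 0 → InBox 0 v := fun v hv => inBox_of_boxWeight_ne_zero hv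
  have i1 : ∀ v, q₁ v ≠ 0 → InBox (r - 1 + 0) v :=
    inBox_of_conv_ne_zero (fun v hv => inBox_of_boxWeight_ne_zero hv) i0
  have i2 : ∀ v, q₂ v ≠ 0 → InBox (m - 1 + (r - 1 + 0)) v :=
    inBox_of_conv_ne_zero (fun v hv => inBox_of_boxWeight_ne_zero hv) i1
  have e1 := h₁ N u ε K l g 1 Γ δ r P G q₀ f (hreg.mono (by omega)) hf hPne hP hPD (by omega) hr
    hG hΓ hEr hg n0 s0 b0 (fun v hv => (i0 v hv).mono (by omega)) hK hε hrl hgl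
    (by rw [mul_one]; exact hAr) hδ hδ1
  have e2 := h₁ N u ε K l g _ Γ δ m P G q₁ f hreg hf hPne hP hPD hN hm
    hG hΓ hEm hg n1 s1 b1 (fun v hv => (i1 v hv).mono (by omega)) hK hε hml hgl hAm hδ hδ1
  have e3 := h₁ N u ε K l g _ Γ δ m P G q₂ f hreg hf hPne hP hPD hN hm
    hG hΓ hEm hg n2 s2 (fun v => (b2 v).trans hrm') (fun v hv => (i2 v hv).mono (by omega)) hK hε
    hml hgl hAm hδ hδ1
  have e4 := h₂ N u ε K l Γ δ m P G q₂ f hreg hf hPne hP hPD hN hm hG hΓ n2 s2 b2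
    (fun v hv => (i2 v hv).mono (by omega)) hK hlm hl0 hδ hδ1
  have hsplit : integralProd u (fun η => smoothed u G P q₀ η * f η)
      = integralProd u (fun η => (smoothed u G P q₀ η - smoothed u G P q₁ η) * f η)
        + integralProd u (fun η => (smoothed u G P q₁ η - smoothed u G P q₂ η) * f η)
        + integralProd u (fun η => (smoothed u G P q₂ η - smoothed u G P q₃ η) * f η)
        + integralProd u (fun η => smoothed u G P q₃ η * f η) := by
    rw [← integralProd_add, ← integralProd_add, ← integralProd_add]
    congr 1
    funext η
    ring
  change K * integralProd u (fun η => smoothed u G P q₀ η * f η) ≤ _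
  rw [hsplit, mul_add, mul_add, mul_add]
  refine (add_le_add (add_le_add (add_le_add e1 e2) e3) e4).trans (le_of_eq ?_)
  ring

end Bounds

/-! ### The mesoscopic scale -/

section Scale

/-- The relation defining the mesoscopic scale, in terms of `s = √l`. -/
lemma IsMesoscopicScale.sqrt_pow {d N : ℕ} {l : ℝ} (h : IsMesoscopicScale d N l) :
    √l ^ (3 * d) * gFun d l = (N : ℝ) ^ 2 := by
  rw [← h.2]
  congr 1
  rw [Real.sqrt_eq_rpow, ← Real.rpow_natCast, ← Real.rpow_mul h.1.le]
  congr 1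
  push_cast
  ring

lemma gFun_le {d : ℕ} {l l₀ : ℝ} (hl : 0 < l) (hl₀ : 1 ≤ l₀) (h : l ≤ l₀) : gFun d l ≤ l₀ := by
  unfold gFun
  split_ifs
  · exact h
  · linarith [Real.log_le_sub_one_of_pos hl]
  · exact hl₀

lemma one_le_gFun {d : ℕ} {l : ℝ} (hl : Real.exp 1 ≤ l) : 1 ≤ gFun d l := by
  have h1 : 1 ≤ l := (Real.one_le_exp (by norm_num)).trans hl
  unfold gFun
  split_ifs
  · exact h1
  · rw [Real.le_log_iff_exp_le (by linarith)]; exact hl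
  · exact le_rfl

lemma IsMesoscopicScale.lt_of_large {d N : ℕ} {l l₀ : ℝ} (h : IsMesoscopicScale d N l)
    (hl₀ : 1 ≤ l₀) (hN : √l₀ ^ (3 * d) * l₀ < N) : l₀ < l := by
  by_contra! hle
  have h1 : √l ^ (3 * d) * gFun d l ≤ √l₀ ^ (3 * d) * l₀ := by
    calc _ ≤ √l ^ (3 * d) * l₀ :=
          mul_le_mul_of_nonneg_left (gFun_le h.1 hl₀ hle) (by positivity)
      _ ≤ _ := mul_le_mul_of_nonneg_right
          (pow_le_pow_left₀ (Real.sqrt_nonneg _) (Real.sqrt_le_sqrt hle) _) (by linarith)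
  rw [h.sqrt_pow] at h1
  have h2 : 0 ≤ √l₀ ^ (3 * d) * l₀ := mul_nonneg (by positivity) (by linarith)
  have h3 : (1 : ℝ) ≤ N := by
    have : (0 : ℝ) < N := h2.trans_lt hN
    exact_mod_cast this
  nlinarith

lemma sq_le_pow_mul_gFun {d : ℕ} (hd : 0 < d) {l : ℝ} (hl : Real.exp 1 ≤ l) :
    l ^ 2 ≤ l ^ d * gFun d l := by
  have h1 : 1 ≤ l := (Real.one_le_exp (by norm_num)).trans hl
  rcases Nat.lt_or_ge 1 d with hd1 | hd1
  · calc l ^ 2 ≤ l ^ d := pow_le_pow_right₀ h1 hd1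
      _ ≤ _ := le_mul_of_one_le_right (by positivity) (one_le_gFun hl)
  · obtain rfl : d = 1 := by omega
    simp only [gFun, if_true]
    rw [pow_one, sq]

lemma IsMesoscopicScale.mul_le {d N : ℕ} (hd : 0 < d) {l : ℝ} (h : IsMesoscopicScale d N l)
    (hl : Real.exp 1 ≤ l) (hl2 : 25 ^ 2 ≤ l) : 5 * l ≤ N := by
  have hs2 : √l ^ 2 = l := Real.sq_sqrt (by linarith)
  have hs : 25 ≤ √l := Real.le_sqrt_of_sq_le hl2
  have h2 : √l ^ d * l ^ 2 ≤ (N : ℝ) ^ 2 := by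
    rw [← h.sqrt_pow]
    calc √l ^ d * l ^ 2 ≤ √l ^ d * (l ^ d * gFun d l) :=
          mul_le_mul_of_nonneg_left (sq_le_pow_mul_gFun hd hl) (by positivity)
      _ = √l ^ (3 * d) * gFun d l := by
          have : √l ^ (3 * d) = √l ^ d * l ^ d := by
            rw [← hs2, Real.sqrt_sq (Real.sqrt_nonneg l), ← pow_mul, ← pow_add]
            congr 1
            ring
          rw [this]; ring
  have h3 : 25 ≤ √l ^ d := hs.trans (le_self_pow₀ (by linarith) (by omega))
  refine le_of_sq_le_sq ?_ (Nat.cast_nonneg N)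
  nlinarith [sq_nonneg l]

/-- The mesoscopic scale is at most of the order of the width `N / √K` of the layers. -/
lemma IsMesoscopicScale.sqrt_mul_le {d N : ℕ} (hd : 0 < d) {l K M : ℝ}
    (h : IsMesoscopicScale d N l) (hl : Real.exp 1 ≤ l) (hK : 0 ≤ K) (hM : 1 ≤ M)
    (hKM : K ^ 2 ≤ M * l ^ d) : √K * l ≤ M * N := by
  have h1 : 1 ≤ l := (Real.one_le_exp (by norm_num)).trans hl
  have hs2 : √l ^ 2 = l := Real.sq_sqrt (by linarith)
  have hN2 : (N : ℝ) ^ 4 = l ^ d * (l ^ d * gFun d l) ^ 2 := by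
    have : (N : ℝ) ^ 4 = ((N : ℝ) ^ 2) ^ 2 := by ring
    rw [this, ← h.sqrt_pow]
    have : √l ^ (3 * d) = √l ^ d * l ^ d := by
      rw [← hs2, Real.sqrt_sq (Real.sqrt_nonneg l), ← pow_mul, ← pow_add]
      congr 1
      ring
    rw [this]
    have h3 : (√l ^ d) ^ 2 = l ^ d := by rw [← pow_mul, mul_comm d 2, pow_mul, hs2]
    rw [← h3]
    ring
  have h4 : (l ^ 2) ^ 2 ≤ (l ^ d * gFun d l) ^ 2 :=
    pow_le_pow_left₀ (by positivity) (sq_le_pow_mul_gFun hd hl) 2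
  have h5 : (√K * l) ^ 4 ≤ (M * N) ^ 4 := by
    have e : (√K * l) ^ 4 = K ^ 2 * l ^ 4 := by
      rw [mul_pow, show √K ^ 4 = (√K ^ 2) ^ 2 by ring, Real.sq_sqrt hK]
    rw [e, mul_pow, hN2]
    calc K ^ 2 * l ^ 4 ≤ M * l ^ d * (l ^ 2) ^ 2 := by
          rw [show l ^ 4 = (l ^ 2) ^ 2 by ring]
          gcongr
      _ ≤ M * l ^ d * (l ^ d * gFun d l) ^ 2 := by gcongr
      _ = M * (l ^ d * (l ^ d * gFun d l) ^ 2) := by ring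
      _ ≤ M ^ 4 * (l ^ d * (l ^ d * gFun d l) ^ 2) := by
          have : M ≤ M ^ 4 := le_self_pow₀ hM (by norm_num)
          gcongr
  exact le_of_pow_le_pow_left₀ (by norm_num) (by positivity) h5

lemma IsMesoscopicScale.gFun_mul_pow_le {d N : ℕ} {l : ℝ} (h : IsMesoscopicScale d N l)
    (hl : Real.exp 1 ≤ l) : gFun d l * l ^ d ≤ (N : ℝ) ^ 2 := by
  have h1 : 1 ≤ l := (Real.one_le_exp (by norm_num)).trans hl
  have hs1 : 1 ≤ √l := Real.one_le_sqrt.2 h1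
  have hs2 : √l ^ 2 = l := Real.sq_sqrt (by linarith)
  have hg := one_le_gFun (d := d) hl
  rw [← h.sqrt_pow, mul_comm]
  refine mul_le_mul_of_nonneg_right ?_ (by linarith)
  calc l ^ d = √l ^ (2 * d) := by rw [pow_mul, hs2]
    _ ≤ _ := pow_le_pow_right₀ hs1 (by omega)

/-- First step: the scales `1` and `r ≤ √l`. -/
lemma IsMesoscopicScale.first_scale {d N r : ℕ} {l : ℝ} (h : IsMesoscopicScale d N l)
    (hl : Real.exp 1 ≤ l) (hr : (r : ℝ) ≤ √l) :
    (r : ℝ) ^ d * l ^ d * gFun d l ≤ 2 ^ d * (N : ℝ) ^ 2 := by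
  have hs2 : √l ^ 2 = l := Real.sq_sqrt h.1.le
  have hg := one_le_gFun (d := d) hl
  calc (r : ℝ) ^ d * l ^ d * gFun d l ≤ √l ^ d * l ^ d * gFun d l := by
        have : (r : ℝ) ^ d ≤ √l ^ d := pow_le_pow_left₀ (Nat.cast_nonneg r) hr d
        have := h.1
        gcongr
    _ = (N : ℝ) ^ 2 := by
        rw [← h.sqrt_pow]
        congr 1
        nth_rewrite 2 [← hs2]
        rw [← pow_mul, ← pow_add]
        congr 1
        ring
    _ ≤ _ := le_mul_of_one_le_left (by positivity) (one_le_pow₀ (by norm_num))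

/-- Second step: the scales `r ≥ √l / 2` and `m ≤ l`. -/
lemma IsMesoscopicScale.second_scale {d N r m : ℕ} {l : ℝ} (h : IsMesoscopicScale d N l)
    (hl : Real.exp 1 ≤ l) (hr : √l / 2 ≤ r) (hm : (m : ℝ) ≤ l) :
    (m : ℝ) ^ d * l ^ d * gFun d l * (1 / (r : ℝ)) ^ d ≤ 2 ^ d * (N : ℝ) ^ 2 := by
  have hs2 : √l ^ 2 = l := Real.sq_sqrt h.1.le
  have hs0 : 0 < √l := Real.sqrt_pos.2 h.1
  have hg := one_le_gFun (d := d) hl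
  have hl0 := h.1
  have h1 : (1 / (r : ℝ)) ^ d ≤ (2 / √l) ^ d := by
    refine pow_le_pow_left₀ (by positivity) ?_ d
    rw [div_le_div_iff₀ (by linarith) hs0]
    linarith
  calc _ ≤ l ^ d * l ^ d * gFun d l * (2 / √l) ^ d := by gcongr
    _ = 2 ^ d * (√l ^ (3 * d) * gFun d l) := by
        have e : l ^ d = √l ^ d * √l ^ d := by rw [← mul_pow, ← sq, hs2]
        rw [div_pow, pow_mul', e]
        field_simp
    _ = _ := by rw [h.sqrt_pow]

end Scale

/-! ### Factoring the observable -/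

section Observable

variable {d N : ℕ} [NeZero N] {u : Torus d N → ℝ}

/-- A point `a` of `A` which maximizes the sum of the coordinates: no other point of `A` is in
the positive orthant with vertex `a`. -/
lemma exists_extremal {A : Finset (Fin d → ℤ)} (hA : A.Nonempty) :
    ∃ a ∈ A, ∀ b ∈ A, b ≠ a → ∃ i, b i - a i < 0 := by
  obtain ⟨a, ha, hmax⟩ := A.exists_max_image (fun b => ∑ i, b i) hA
  refine ⟨a, ha, fun b hb hne => ?_⟩
  by_contra! hcon
  obtain ⟨i, hi⟩ := Function.ne_iff.1 hne
  have : ∑ i, a i < ∑ i, b i :=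
    Finset.sum_lt_sum (fun j _ => by linarith [hcon j])
      ⟨i, Finset.mem_univ i, lt_of_le_of_ne (by linarith [hcon i]) (Ne.symm hi)⟩
  linarith [hmax b hb]

/-- Factoring `ω_{x+a}` out of `ω_{x+A}`. -/
lemma observable_eq_smoothed (hu : ∀ x, u x ∈ Set.Ioo (0 : ℝ) 1) {A : Finset (Fin d → ℤ)}
    {a : Fin d → ℤ} (ha : a ∈ A) {D : ℕ}
    (hP : ∀ b ∈ (A.erase a).image (fun b => b - a), ∃ i, b i < 0)
    (hPD : ∀ b ∈ (A.erase a).image (fun b => b - a), ∀ i, |b i| ≤ D) (hN : 2 * D < N)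
    (G : Torus d N → ℝ) (η : Config d N) :
    observable u G A η
      = smoothed u (fun s => G (fun i => s i - (a i : ZMod N)))
          ((A.erase a).image fun b => b - a) (boxWeight 1) η := by
  set P := (A.erase a).image fun b => b - a
  have hmem : ∀ s : Torus d N, s ∉ translate s P := by
    intro s hs
    have hdisj := disjoint_backSupport_frontSupport (N := N) (R := 0) hP hPD
      (Q := {0}) (by simp) (by simp) (by omega) s
    have h0 : InBox 0 (s - s) := fun i => by simp
    exact Set.disjoint_left.1 hdisj ⟨s, h0, hs⟩
      ⟨s, h0, mem_translate.2 ⟨0, by simp, by simp⟩⟩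
  have htr : ∀ s : Torus d N, translate (fun i => s i - (a i : ZMod N)) A
      = insert s (translate s P) := by
    intro s
    ext y
    rw [Finset.mem_insert, mem_translate, mem_translate]
    constructor
    · rintro ⟨b, hb, hy⟩
      by_cases hba : b = a
      · left
        subst hba
        funext i
        rw [hy i]; ring
      · right
        refine ⟨b - a, Finset.mem_image.2 ⟨b, Finset.mem_erase.2 ⟨hba, hb⟩, rfl⟩, fun i => ?_⟩
        rw [hy i, Pi.sub_apply]
        push_cast
        ring
    · rintro (rfl | ⟨p, hp, hy⟩)
      · exact ⟨a, ha, fun i => by ring⟩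
      · obtain ⟨b, hb, rfl⟩ := Finset.mem_image.1 hp
        refine ⟨b, (Finset.mem_erase.1 hb).2, fun i => ?_⟩
        rw [hy i, Pi.sub_apply]
        push_cast
        ring
  let e : Torus d N ≃ Torus d N := Equiv.subRight (fun i => (a i : ZMod N))
  unfold observable smoothed
  rw [← Equiv.sum_comp e]
  refine Finset.sum_congr rfl fun s _ => ?_
  have he : e s = fun i => s i - (a i : ZMod N) := rfl
  rw [he, htr s, omega, Finset.prod_insert (hmem s)]
  have hsum : ∑ v, boxWeight 1 v * omegaHat u (s + v) η = omegaHat u s η := by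
    simp [boxWeight_one]
  rw [hsum]
  have hc := (chi_pos hu s).ne'
  simp only [omega, omegaHat]
  field_simp

lemma abs_le_iSup_abs (G : Torus d N → ℝ) (x : Torus d N) : |G x| ≤ ⨆ y, |G y| :=
  le_ciSup (f := fun y => |G y|) (Set.finite_range _).bddAbove x

/-- The bound without any cancellation. -/
lemma integralProd_observable_le (hu : ∀ x, u x ∈ Set.Ioo (0 : ℝ) 1) {f : Config d N → ℝ}
    (hf : IsDensity u f) (G : Torus d N → ℝ) (A : Finset (Fin d → ℤ)) :
    integralProd u (fun η => observable u G A η * f η) ≤ (N : ℝ) ^ d * ⨆ x, |G x| := by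
  calc _ ≤ integralProd u (fun η => ((N : ℝ) ^ d * ⨆ x, |G x|) * f η) := by
        refine integralProd_mono hu fun η => mul_le_mul_of_nonneg_right ?_ (hf.1 η)
        calc observable u G A η ≤ ∑ _x : Torus d N, ⨆ x, |G x| := by
              refine Finset.sum_le_sum fun x _ => (le_abs_self _).trans ?_
              rw [abs_mul]
              calc _ ≤ |G x| * 1 :=
                    mul_le_mul_of_nonneg_left (abs_omega_le_one hu _ η) (abs_nonneg _)
                _ ≤ _ := by rw [mul_one]; exact abs_le_iSup_abs G x
          _ = _ := by
              rw [Finset.sum_const, Finset.card_univ, nsmul_eq_mul, card_torus]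
    _ = _ := by rw [integralProd_const_mul, hf.2, mul_one]

end Observable

/-! ### The estimate on large tori -/

section LargeTorus

variable {d : ℕ} [NeZero d] {γ : ℝ} {K ℓ : ℕ → ℝ} {A : Finset (Fin d → ℤ)}

/-- The estimate for all sufficiently large `N`. -/
lemma exists_bound_of_large (hγ : 1 / 2 < γ) (hγ' : γ ≤ 1) (hK : Tendsto K atTop atTop)
    (hℓ : ∀ N : ℕ, 1 ≤ N → IsMesoscopicScale d N (ℓ N))
    (hKℓ : ∃ M : ℝ, ∀ N : ℕ, 1 ≤ N → K N ^ 2 / ℓ N ^ d ≤ M) (hA : 2 ≤ A.card) :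
    ∃ C : ℝ, 0 ≤ C ∧ ∃ N₀ : ℕ, ∀ (N : ℕ) [NeZero N], N₀ ≤ N → ∀ ρ : ℝ → ℝ,
      IsTwoLayerProfile γ (K N) ρ → ∀ (G : Torus d N → ℝ) (δ : ℝ), 0 < δ → δ < 1 →
      ∀ f : Config d N → ℝ, IsDensity (discreteProfile d N (K N) ρ) f →
        K N * integralProd (discreteProfile d N (K N) ρ)
            (fun η => observable (discreteProfile d N (K N) ρ) G A η * f η)
          ≤ δ * (N : ℝ) ^ 2 * exclusionForm (discreteProfile d N (K N) ρ) f
            + C * (1 / δ) * (1 + (⨆ x, |G x|) ^ 2) * K N ^ 2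
              * (entropy (discreteProfile d N (K N) ρ) f + ((N : ℝ) / ℓ N) ^ d) := by
  have hd : 0 < d := Nat.pos_of_ne_zero (NeZero.ne d)
  -- the geometry of `A`
  obtain ⟨a, haA, ha⟩ := exists_extremal (A := A) (Finset.card_pos.1 (by omega))
  set P := (A.erase a).image fun b => b - a
  have hPne : P.Nonempty := by
    refine Finset.Nonempty.image (Finset.card_pos.1 ?_) _
    rw [Finset.card_erase_of_mem haA]
    omega
  have hP : ∀ b ∈ P, ∃ i, b i < 0 := by
    intro p hp
    obtain ⟨b, hb, rfl⟩ := Finset.mem_image.1 hp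
    exact ha b (Finset.mem_erase.1 hb).2 (Finset.mem_erase.1 hb).1
  obtain ⟨D, hD1, hPD⟩ : ∃ D : ℕ, 1 ≤ D ∧ ∀ b ∈ P, ∀ i, |b i| ≤ (D : ℤ) := by
    refine ⟨1 + ∑ b ∈ P, ∑ i, (b i).natAbs, by omega, fun b hb i => ?_⟩
    have h1 : (b i).natAbs ≤ ∑ i, (b i).natAbs :=
      Finset.single_le_sum (f := fun i => (b i).natAbs) (fun _ _ => Nat.zero_le _)
        (Finset.mem_univ i)
    have h2 : ∑ i, (b i).natAbs ≤ ∑ b ∈ P, ∑ i, (b i).natAbs :=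
      Finset.single_le_sum (f := fun b : Fin d → ℤ => ∑ i, (b i).natAbs)
        (fun _ _ => Nat.zero_le _) hb
    rw [Int.abs_eq_natAbs]
    exact_mod_cast (by omega : (b i).natAbs ≤ 1 + ∑ b ∈ P, ∑ i, (b i).natAbs)
  -- the constants
  obtain ⟨M₀, hM₀⟩ := hKℓ
  set M := max M₀ 1
  have hM1 : 1 ≤ M := le_max_right _ _
  -- `c` bounds the distance `2 m √K / N` on which the profile is compared with itself
  set c : ℝ := 2 * M with hc
  set θ : ℝ := Real.exp (4 * c)
  have hθ1 : 1 ≤ θ := Real.one_le_exp (by positivity)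
  set b : ℝ := 2 * θ with hb
  have hb1 : 1 ≤ b := by linarith
  obtain ⟨C₁, hC₁, hmain⟩ := exists_smoothed_one_bound d D hD1 hθ1 hb1
  obtain ⟨N₁, hN₁⟩ := Filter.eventually_atTop.1 (hK.eventually_ge_atTop 1)
  -- for `l > l₀`, one has `1 ≤ g_d(l)`, `5 l ≤ N`, and boxes of side `2 m + D` do not wrap around
  set l₀ : ℝ := max (max (Real.exp 1) (25 ^ 2)) (4 * D + 2) with hl₀
  have hl₀1 : 1 ≤ l₀ := by
    rw [hl₀]
    exact (Real.one_le_exp (by norm_num)).trans ((le_max_left _ _).trans (le_max_left _ _))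
  obtain ⟨N₂, hN₂⟩ := exists_nat_gt (√l₀ ^ (3 * d) * l₀)
  refine ⟨2 * C₁, by positivity, max N₁ N₂, ?_⟩
  intro N _ hge ρ hρ G δ hδ hδ1 f hf
  have hN1 : 1 ≤ N := Nat.pos_of_ne_zero (NeZero.ne N)
  have hNpos : (0 : ℝ) < N := by exact_mod_cast hN1
  have hu : ∀ x, discreteProfile d N (K N) ρ x ∈ Set.Ioo (0 : ℝ) 1 := fun x => hρ.mem_Ioo _
  have hscale := hℓ N hN1
  have hl0 := hscale.1
  have hKpos := hρ.pos
  set u := discreteProfile d N (K N) ρ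
  have hH0 := entropy_nonneg hu hf
  set g : ℝ := ⨆ x, |G x|
  have hg0 : 0 ≤ g := (abs_nonneg _).trans (abs_le_iSup_abs G 0)
  have hK1 : 1 ≤ K N := hN₁ N ((le_max_left _ _).trans hge)
  have hlarge : l₀ < ℓ N := by
    refine hscale.lt_of_large hl₀1 (hN₂.trans_le ?_)
    exact_mod_cast (le_max_right N₁ N₂).trans hge
  set l := ℓ N
  have hle : Real.exp 1 ≤ l :=
    ((le_max_left _ _).trans (le_max_left _ _)).trans hlarge.le
  have hl25 : 25 ^ 2 ≤ l := ((le_max_right _ _).trans (le_max_left _ _)).trans hlarge.le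
  have hlD : 4 * (D : ℝ) + 2 ≤ l := (le_max_right _ _).trans hlarge.le
  have h5l := hscale.mul_le hd hle hl25
  have hs25 : 25 ≤ √l := Real.le_sqrt_of_sq_le hl25
  have hs2 : √l ^ 2 = l := Real.sq_sqrt hl0.le
  set m := ⌊l⌋₊
  set r := ⌊√l⌋₊
  have hml : (m : ℝ) ≤ l := Nat.floor_le hl0.le
  have hlm : l < m + 1 := Nat.lt_floor_add_one l
  have hrs : (r : ℝ) ≤ √l := Nat.floor_le (by linarith)
  have hsr : √l < r + 1 := Nat.lt_floor_add_one (√l)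
  have hr0 : 0 < r := Nat.floor_pos.2 (by linarith)
  have hrm : r ≤ m := Nat.floor_le_floor (by nlinarith)
  have hNbig : 2 * (2 * m + D) + 1 ≤ N := by
    have : (2 * (2 * m + D) + 1 : ℝ) ≤ N := by linarith
    exact_mod_cast this
  have hKM : K N ^ 2 ≤ M * l ^ d := by
    have := hM₀ N hN1
    rw [div_le_iff₀ (by positivity)] at this
    exact this.trans (mul_le_mul_of_nonneg_right (le_max_left _ _) (by positivity))
  have hwidth := hscale.sqrt_mul_le hd hle hKpos.le hM1 hKM
  have hreg : RegularProfile u θ (b * (√(K N) / N)) (2 * m) := by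
    refine regularProfile_discreteProfile hρ hγ hγ' (by omega) ?_
    rw [div_mul_eq_mul_div, div_le_iff₀ hNpos]
    push_cast
    calc √(K N) * (2 * (m : ℝ)) ≤ √(K N) * (2 * l) := by gcongr
      _ = 2 * (√(K N) * l) := by ring
      _ ≤ 2 * (M * N) := by gcongr
      _ = c * N := by rw [hc]; ring
  have hε : (b * (√(K N) / N)) ^ 2 = b ^ 2 * K N / (N : ℝ) ^ 2 := by
    rw [mul_pow, div_pow, Real.sq_sqrt hKpos.le]
    ring
  have hgpos : 0 < gFun d l := by linarith [one_le_gFun (d := d) hle]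
  -- `1 + ‖G‖` instead of `‖G‖`, which may vanish
  have key := hmain N u (b * (√(K N) / N)) (K N) l (gFun d l) (1 + g) δ r m P
    (fun s => G (fun i => s i - (a i : ZMod N))) f hreg hf hPne hP hPD hNbig hr0 hrm
    (fun x => (abs_le_iSup_abs G _).trans (by linarith)) (by linarith)
    (flowEnergy_le hd hle (le_trans (by exact_mod_cast hrm) hml)) (flowEnergy_le hd hle hml)
    hgpos hK1 hε hml (by linarith) (hscale.gFun_mul_pow_le hle) (hscale.first_scale hle hrs)
    (hscale.second_scale hle (by linarith) hml) hδ hδ1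
  have hobs : ∀ η, observable u G A η
      = smoothed u (fun s => G (fun i => s i - (a i : ZMod N))) P (boxWeight 1) η :=
    fun η => observable_eq_smoothed hu haA hP hPD (by omega) G η
  simp_rw [hobs]
  refine key.trans (add_le_add le_rfl ?_)
  have hgg : C₁ * (1 + g) ^ 2 ≤ 2 * C₁ * (1 + g ^ 2) := by
    have h1 : (1 + g) ^ 2 ≤ 2 * (1 + g ^ 2) := by nlinarith [sq_nonneg (g - 1)]
    have h2 := mul_le_mul_of_nonneg_left h1 hC₁
    linarith
  calc C₁ * (1 / δ) * (1 + g) ^ 2 * K N ^ 2 * (entropy u f + ((N : ℝ) / l) ^ d)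
      = C₁ * (1 + g) ^ 2 * ((1 / δ) * K N ^ 2 * (entropy u f + ((N : ℝ) / l) ^ d)) := by ring
    _ ≤ 2 * C₁ * (1 + g ^ 2)
          * ((1 / δ) * K N ^ 2 * (entropy u f + ((N : ℝ) / l) ^ d)) := by gcongr
    _ = _ := by ring

end LargeTorus

end GlauberKawasaki

theorem theorem4p1 (d : ℕ) [NeZero d] (γ : ℝ) (hγ : 1 / 2 < γ) (hγ' : γ ≤ 1)
    (K ℓ : ℕ → ℝ) (hK : Tendsto K atTop atTop)
    (hℓ : ∀ N : ℕ, 1 ≤ N → IsMesoscopicScale d N (ℓ N))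
    (hKℓ : ∃ M : ℝ, ∀ N : ℕ, 1 ≤ N → K N ^ 2 / ℓ N ^ d ≤ M)
    (A : Finset (Fin d → ℤ)) (hA : 2 ≤ A.card) :
    ∃ C : ℝ, ∀ (N : ℕ) [NeZero N] (ρ : ℝ → ℝ), IsTwoLayerProfile γ (K N) ρ →
      ∀ (G : Torus d N → ℝ) (δ : ℝ), 0 < δ → δ < 1 →
      ∀ f : Config d N → ℝ, IsDensity (discreteProfile d N (K N) ρ) f →
        K N * integralProd (discreteProfile d N (K N) ρ)
            (fun η => observable (discreteProfile d N (K N) ρ) G A η * f η)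
          ≤ δ * (N : ℝ) ^ 2 * exclusionForm (discreteProfile d N (K N) ρ) f
            + C * (1 / δ) * (1 + (⨆ x, |G x|) ^ 2) * K N ^ 2
              * (entropy (discreteProfile d N (K N) ρ) f + ((N : ℝ) / ℓ N) ^ d) := by
  obtain ⟨C₁, hC₁, N₀, hlarge⟩ := exists_bound_of_large hγ hγ' hK hℓ hKℓ hA
  -- for the finitely many small `N` the constant may depend on `N`
  set C₂ : ℝ := ∑ n ∈ Finset.range N₀, |ℓ n ^ d / K n|
  have hC₂0 : 0 ≤ C₂ := Finset.sum_nonneg fun _ _ => abs_nonneg _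
  refine ⟨C₁ + C₂, ?_⟩
  intro N _ ρ hρ G δ hδ hδ1 f hf
  have hN1 : 1 ≤ N := Nat.pos_of_ne_zero (NeZero.ne N)
  have hu : ∀ x, discreteProfile d N (K N) ρ x ∈ Set.Ioo (0 : ℝ) 1 := fun x => hρ.mem_Ioo _
  have hscale := hℓ N hN1
  have hl0 := hscale.1
  have hKpos := hρ.pos
  set u := discreteProfile d N (K N) ρ
  have hH0 := entropy_nonneg hu hf
  have hI0 := exclusionForm_nonneg hu f
  rcases lt_or_ge N N₀ with hlt | hge
  · set g : ℝ := ⨆ x, |G x| with hg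
    have hδ' : 1 ≤ 1 / δ := by rw [le_div_iff₀ hδ]; linarith
    have h1 := mul_le_mul_of_nonneg_left (integralProd_observable_le hu hf G A) hKpos.le
    have h2 : ℓ N ^ d / K N ≤ C₁ + C₂ := by
      have h3 : |ℓ N ^ d / K N| ≤ C₂ :=
        Finset.single_le_sum (f := fun n => |ℓ n ^ d / K n|) (fun _ _ => abs_nonneg _)
          (Finset.mem_range.2 hlt)
      linarith [le_abs_self (ℓ N ^ d / K N)]
    have hgg : g ≤ 1 + g ^ 2 := by nlinarith [sq_nonneg (g - 1)]
    calc _ ≤ K N * ((N : ℝ) ^ d * g) := h1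
      _ ≤ K N * ((N : ℝ) ^ d * (1 + g ^ 2)) := by gcongr
      _ = ℓ N ^ d / K N * 1 * (1 + g ^ 2) * K N ^ 2 * ((N : ℝ) / ℓ N) ^ d := by
          rw [div_pow]; field_simp
      _ ≤ (C₁ + C₂) * (1 / δ) * (1 + g ^ 2) * K N ^ 2
            * (entropy u f + ((N : ℝ) / ℓ N) ^ d) := by
          gcongr
          linarith
      _ ≤ _ := le_add_of_nonneg_left (by positivity)
  · refine (hlarge N hge ρ hρ G δ hδ hδ1 f hf).trans ?_
    gcongr
    linarith
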